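/- Call \emph{run-length straight-line program} (RLSLP) a grammar $G$ with finitely many variables, one of which is initial, where each variable $A$ has exactly one rule, of the form $A\to a$ with $a$ a terminal symbol (a natural number), $A\to BC$, or $A\to B^t$ with $t\ge 3$, and where no variable can reach itself. Every variable $A$ generates a unique string $\exp(A)$, namely $a$, $\exp(B)\cdot\exp(C)$, or $\exp(B)^t$, respectively. $G$ represents the string generated by its initial variable, and its size $|G|$ is the sum of the sizes of its rules, which are $1$, $2$ and $2$, respectively. Given a prime $\mu$ and an integer $c$, the Karp--Rabin fingerprint of a string $X[1..m]$ of natural numbers is $\kappa(X)=\bigl(\sum_{k=1}^{m}X[k]\,c^{k-1}\bigr)\bmod\mu\in\{0,\dots,\mu-1\}$. The model of computation is the word RAM with unit-cost addition, subtraction, multiplication, integer division and remainder, comparison, and indirect memory access on words of $w$ bits, where $w\ge W(\lfloor\log_2 N\rfloor+1)$ for an absolute constant $W\ge 1$ and any $N$ that bounds the length $n$ of the represented text, the number of words of the input, and the numbers in the input. (The input lists $\mu$, the sign and the absolute value of $c$, the number of variables of $G$, its initial variable, and, for each variable, three words describing its rule. If $\mu$, $|c|$, $|G|$ and all numbers appearing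 in the rules of $G$ are $n^{\mathcal O(1)}$, as usual, then words of $\Theta(\log n)$ bits suffice.) \textbf{Theorem.} There are two fixed programs, a construction program and a query program, and constants $K$ and $W\ge 1$, such that the following holds for every RLSLP $G$ representing a text $T[1..n]$, every prime $\mu$ and every integer $c$, on every word RAM as above. Given $G$, $\mu$ and $c$, the construction program halts within $K\,|G|\,(\lfloor\log_2 n\rfloor+1)$ steps and leaves in memory a data structure of at most $K\,|G|$ words. For all $1\le i\le j\le n$, the query program, given $i$, $j$ and this data structure (with arbitrary contents in the remaining memory), halts within $K(\lfloor\log_2 n\rfloor+1)$ steps, outputs $\kappa(T[i..j])$, and leaves the data structure unchanged. In other words, there is a data structure of size $\mathcal O(|G|)$ that is built in time $\mathcal O(|G|\log n)$ and computes the fingerprint of any substring of $T$ in time $\mathcal O(\log n)$. -/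

import Mathlib

/-! ### Run-length straight-line programs -/

/-- Right-hand side of a rule over variables `V`; terminal symbols are natural numbers. -/
inductive RLRule (V : Type) : Type
  /-- `A → a` -/
  | term (a : ℕ) : RLRule V
  /-- `A → B C` -/
  | pair (B C : V) : RLRule V
  /-- `A → B^t` -/
  | run (B : V) (t : ℕ) : RLRule V

namespace RLRule

/-- `r.Uses B`: the variable `B` occurs in the right-hand side `r`. -/
def Uses {V : Type} : RLRule V → V → Prop
  | term _, _ => False
  | pair B C, X => X = B ∨ X = C
  | run B _, X => X = B

/-- Size of a right-hand side; a run-length rule stores `B` and `t`. -/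
def size {V : Type} : RLRule V → ℕ
  | term _ => 1
  | pair _ _ => 2
  | run _ _ => 2

end RLRule

/-- A run-length straight-line program. The variables carry arbitrary numbers `0, …, m - 1`
(no topological order is assumed), and unreachable variables are allowed. -/
structure RLSLP where
  /-- number of variables -/
  m : ℕ
  /-- the rule of each variable -/
  rule : Fin m → RLRule (Fin m)
  /-- the initial variable -/
  start : Fin m
  /-- no variable can reach itself -/
  acyclic : ∀ A : Fin m, ¬ Relation.TransGen (fun X Y => (rule Y).Uses X) A A
  /-- exponents of run-length rules are at least 3 -/
  three_le : ∀ (A B : Fin m) (t : ℕ), rule A = RLRule.run B t → 3 ≤ t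

namespace RLSLP

theorem wf (G : RLSLP) : WellFounded (fun X Y => (G.rule Y).Uses X) := by
  have : Std.Irrefl (Relation.TransGen (fun X Y => (G.rule Y).Uses X)) := ⟨G.acyclic⟩
  exact WellFounded.mono
    (Finite.wellFounded_of_trans_of_irrefl (Relation.TransGen (fun X Y => (G.rule Y).Uses X)))
    (fun _ _ h => Relation.TransGen.single h)

/-- One unfolding of the expansion: the string of a right-hand side, given the strings of the
variables in it. -/
def expandRule {V : Type} : (r : RLRule V) → ((B : V) → r.Uses B → List ℕ) → List ℕ
  | .term a, _ => [a]
  | .pair B C, e => e B (Or.inl rfl) ++ e C (Or.inr rfl)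
  | .run B t, e => (List.replicate t (e B rfl)).flatten

/-- `G.exp A`: the string generated by the variable `A`. -/
noncomputable def exp (G : RLSLP) : Fin G.m → List ℕ :=
  G.wf.fix (fun A ih => expandRule (G.rule A) ih)

theorem exp_eq (G : RLSLP) (A : Fin G.m) :
    G.exp A = expandRule (G.rule A) (fun B _ => G.exp B) :=
  G.wf.fix_eq _ A

theorem exp_term (G : RLSLP) {A : Fin G.m} {a : ℕ} (h : G.rule A = .term a) :
    G.exp A = [a] := by
  rw [exp_eq, h]; rfl

theorem exp_pair (G : RLSLP) {A B C : Fin G.m} (h : G.rule A = .pair B C) :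
    G.exp A = G.exp B ++ G.exp C := by
  rw [exp_eq, h]; rfl

theorem exp_run (G : RLSLP) {A B : Fin G.m} {t : ℕ} (h : G.rule A = .run B t) :
    G.exp A = (List.replicate t (G.exp B)).flatten := by
  rw [exp_eq, h]; rfl

/-- `G` represents the text `T`. -/
def Represents (G : RLSLP) (T : List ℕ) : Prop := G.exp G.start = T

/-- `|G|`: the sum of the sizes of the right-hand sides. -/
def size (G : RLSLP) : ℕ := ∑ A : Fin G.m, (G.rule A).size

/-- Three words describing one rule: a tag and two arguments. -/
def encodeRule {m : ℕ} : RLRule (Fin m) → List ℕ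
  | .term a => [0, a, 0]
  | .pair B C => [1, (B : ℕ), (C : ℕ)]
  | .run B t => [2, (B : ℕ), t]

/-- The words describing a grammar: number of variables, initial variable, and then the rules. -/
def encode (G : RLSLP) : List ℕ :=
  [G.m, (G.start : ℕ)] ++ (List.ofFn (fun A => encodeRule (G.rule A))).flatten

end RLSLP

/-! ### Substrings and Karp–Rabin fingerprints -/

/-- `T[i..j]`, with positions counted from 1. -/
def substr (T : List ℕ) (i j : ℕ) : List ℕ := (T.drop (i - 1)).take (j + 1 - i)

/-- The Karp–Rabin fingerprint `(∑ₖ X[k] cᵏ) mod μ`, where `k` counts from 0. -/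
def karpRabin (μ : ℕ) (c : ℤ) (X : List ℕ) : ℤ :=
  (∑ k : Fin X.length, (X.get k : ℤ) * c ^ (k : ℕ)) % (μ : ℤ)

/-- The words describing the fingerprint function: the modulus, and the sign and the absolute value
of the base. -/
def encodeKR (μ : ℕ) (c : ℤ) : List ℕ := [μ, if c < 0 then 1 else 0, c.natAbs]

/-! ### The word RAM

Programs are finite texts of RAM instructions on registers and on an addressable memory, composed by
sequencing, branching and looping. Every instruction and every test costs one step. The results of
arithmetic operations are reduced to `w`-bit words. -/

namespace RAM

/-- Arithmetic on words. -/
inductive Op : Type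
  | add | sub | mul | div | mod

/-- The value of an operation on `w`-bit words: arithmetic modulo `2 ^ w`, with subtraction truncated
at 0, and with integer quotient and remainder. -/
def Op.eval (w : ℕ) : Op → ℕ → ℕ → ℕ
  | .add, x, y => (x + y) % 2 ^ w
  | .sub, x, y => (x - y) % 2 ^ w
  | .mul, x, y => (x * y) % 2 ^ w
  | .div, x, y => (x / y) % 2 ^ w
  | .mod, x, y => (x % y) % 2 ^ w

/-- Tests on two registers. -/
inductive Test : Type
  /-- `r_a < r_b` -/
  | lt (a b : ℕ) : Test
  /-- `r_a = r_b` -/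
  | eq (a b : ℕ) : Test

/-- Programs; numerical arguments are names of registers, except the value `v` in `const`. -/
inductive Prog : Type
  /-- do nothing -/
  | skip : Prog
  /-- `r_d := v` -/
  | const (d v : ℕ) : Prog
  /-- `r_d := r_a` -/
  | copy (d a : ℕ) : Prog
  /-- `r_d := r_a o r_b` -/
  | arith (o : Op) (d a b : ℕ) : Prog
  /-- `r_d := mem[r_a]` -/
  | load (d a : ℕ) : Prog
  /-- `mem[r_a] := r_b` -/
  | store (a b : ℕ) : Prog
  /-- first `p`, then `q` -/
  | seq (p q : Prog) : Prog
  /-- if the test succeeds then `p` else `q` -/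
  | cond (b : Test) (p q : Prog) : Prog
  /-- repeat `p` as long as the test succeeds -/
  | loop (b : Test) (p : Prog) : Prog

/-- Contents of the registers and of the memory. -/
structure State where
  /-- registers -/
  reg : ℕ → ℕ
  /-- memory -/
  mem : ℕ → ℕ

/-- Whether a test succeeds in a state. -/
def Test.Holds (s : State) : Test → Prop
  | .lt a b => s.reg a < s.reg b
  | .eq a b => s.reg a = s.reg b

/-- Write a register. -/
def State.setReg (s : State) (d x : ℕ) : State := { s with reg := Function.update s.reg d x }

/-- Write a memory cell. -/
def State.setMem (s : State) (a x : ℕ) : State := { s with mem := Function.update s.mem a x }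

/-- `Exec w p s t s'`: on a machine with `w`-bit words, the program `p` started in state `s` halts
after `t` steps in state `s'`. -/
inductive Exec (w : ℕ) : Prog → State → ℕ → State → Prop
  | skip (s : State) : Exec w .skip s 1 s
  | const (d v : ℕ) (s : State) : Exec w (.const d v) s 1 (s.setReg d (v % 2 ^ w))
  | copy (d a : ℕ) (s : State) : Exec w (.copy d a) s 1 (s.setReg d (s.reg a))
  | arith (o : Op) (d a b : ℕ) (s : State) :
      Exec w (.arith o d a b) s 1 (s.setReg d (o.eval w (s.reg a) (s.reg b)))
  | load (d a : ℕ) (s : State) : Exec w (.load d a) s 1 (s.setReg d (s.mem (s.reg a)))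
  | store (a b : ℕ) (s : State) : Exec w (.store a b) s 1 (s.setMem (s.reg a) (s.reg b))
  | seq {p q : Prog} {s₁ s₂ s₃ : State} {t u : ℕ} :
      Exec w p s₁ t s₂ → Exec w q s₂ u s₃ → Exec w (.seq p q) s₁ (t + u) s₃
  | cond_true {b : Test} {p q : Prog} {s s' : State} {t : ℕ} :
      b.Holds s → Exec w p s t s' → Exec w (.cond b p q) s (t + 1) s'
  | cond_false {b : Test} {p q : Prog} {s s' : State} {t : ℕ} :
      ¬ b.Holds s → Exec w q s t s' → Exec w (.cond b p q) s (t + 1) s'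
  | loop_true {b : Test} {p : Prog} {s₁ s₂ s₃ : State} {t u : ℕ} :
      b.Holds s₁ → Exec w p s₁ t s₂ → Exec w (.loop b p) s₂ u s₃ →
      Exec w (.loop b p) s₁ (t + u + 1) s₃
  | loop_false {b : Test} {p : Prog} {s : State} :
      ¬ b.Holds s → Exec w (.loop b p) s 1 s

/-- The words of `l`, followed by zeros. -/
def words (l : List ℕ) : ℕ → ℕ := fun k => l.getD k 0

/-- Start of a program: the arguments are in registers `0, 1, …`, and the other registers are 0. -/
def State.init (args : List ℕ) (M : ℕ → ℕ) : State := ⟨words args, M⟩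

end RAM

/-! ### A small imperative language on top of the word RAM -/

/-! Fingerprints act as affine maps. Horner's rule makes a string `X` act on residues: `kap μ c X y`
is the fingerprint of `X` followed by any string of fingerprint `y`. This is the map `y ↦ f + p *
y`, where `f` is the fingerprint of `X` and `p` is the power of `c` to the length of `X`
(`kap_eq_aff`). Concatenation composes such maps, and `B^t` is a `t`-th power, found by repeated
squaring in about `log t` steps (`affpow_spec`). If every node of a derivation structure stores
length, `f` and `p`, a single descent yields the fingerprint of a suffix of the text, and two
suffixes give a substring by subtraction (`kap_substr`). The time is the depth, where a run node
counts `log t + 1`. What remains is balancing: a structure for the text with `O(|G|)` nodes and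
depth `O(log n)` in this sense (`Dat.Built.node_var`).

Balancing uses symmetric centroid edges. Let `occ v` count the paths from the initial variable to
`v`. An edge is symmetric centroid if both `log len` and `log occ` (rounded down) agree at its ends.
Two children, or two parents, with equal logarithms would push the logarithm of the sum up by one
(`Gram.log_lt_of_add_le`), so a variable has at most one such edge in each direction, and these
edges form disjoint paths. Along every other edge a potential bounded by `2 * log n` drops
(`Gram.Ord.pot_lt`, `Gram.Ord.pot_le`). So a descent changes paths `O(log n)` times, and only the
moves inside a path have to be made fast.

Inside a path, the string at a position is a pair of contexts wrapped around the string at the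
lowest position. The siblings hanging off the path must sit at a depth that shrinks with the
logarithm of their length, so that the sum over the paths telescopes. All paths are laid side by
side under one binary heap, where a node of level `e` stands for a block of `2^e` consecutive edges.
With `m` the common logarithm of the lengths on the path, the block is cut if it leaves the path or
if its ends lie in different cells of a grid of width `2^(m-e)`. An uncut block carries siblings of
total length below `2^(m-e)`, which pays for a complete tree over it (`Dat.Built.node_blk`). A
second context per heap node reaches back to the last cut of its level. It is built by one
composition: either the context of the parent, followed by a remainder on the same level, or the own
block, followed by the context of the neighbour. A parity argument on the cells shows that boundedly
many compositions suffice per level, and each level gained frees 7 units (`Dat.Built.node_suf`). On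
the leaf level the grid is trivial, so the last cut is the end of the path (`Dat.Ok.leaf_hi_q`). The
total depth is at most `8 * log len + 3 * pot + 1`.

On the machine side, a small structured language is compiled to the RAM, and `sym` reduces the
correctness of straight-line code to arithmetic side conditions. The construction is a sequence of
linear passes; the factor `log n` stems from the powers for run rules and from rounding to powers of
2. -/

namespace WhileLang

/-- Environment and memory seen by structured programs. -/
structure HS where
  v : ℕ → ℕ
  m : ℕ → ℕ

/-- Assign a variable. -/
def HS.set (h : HS) (x a : ℕ) : HS := ⟨fun y => if y = x then a else h.v y, h.m⟩

/-- Write a memory word. -/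
def HS.wr (h : HS) (x a : ℕ) : HS := ⟨h.v, fun y => if y = x then a else h.m y⟩

/-- Expressions. -/
inductive Ex : Type
  | k (n : ℕ) | r (x : ℕ) | ld (e : Ex) | op (o : RAM.Op) (a b : Ex)

instance : Add Ex := ⟨Ex.op .add⟩
instance : Sub Ex := ⟨Ex.op .sub⟩
instance : Mul Ex := ⟨Ex.op .mul⟩
instance : Div Ex := ⟨Ex.op .div⟩
instance : Mod Ex := ⟨Ex.op .mod⟩
instance instOfNatEx (n : ℕ) : OfNat Ex n := ⟨Ex.k n⟩

/-- Arithmetic on unbounded natural numbers. -/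
def opVal : RAM.Op → ℕ → ℕ → ℕ
  | .add, x, y => x + y
  | .sub, x, y => x - y
  | .mul, x, y => x * y
  | .div, x, y => x / y
  | .mod, x, y => x % y

/-- Value of an expression over unbounded natural numbers. -/
def Ex.eval (h : HS) : Ex → ℕ
  | .k n => n
  | .r x => h.v x
  | .ld e => h.m (e.eval h)
  | .op o a b => opVal o (a.eval h) (b.eval h)

/-- No subexpression overflows, and only proper variables occur. -/
def Ex.ok (B : ℕ) (h : HS) : Ex → Prop
  | .k n => n < B
  | .r x => x < 64
  | .ld e => e.ok B h
  | .op o a b => a.ok B h ∧ b.ok B h ∧ opVal o (a.eval h) (b.eval h) < B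

/-- Number of instructions that evaluate an expression. -/
def Ex.cost : Ex → ℕ
  | .k _ => 1
  | .r _ => 1
  | .ld e => e.cost + 1
  | .op _ a b => a.cost + b.cost + 1

/-- Evaluate an expression into register `d`, using no register below `d`. -/
def Ex.comp : Ex → ℕ → RAM.Prog
  | .k n, d => .const d n
  | .r x, d => .copy d x
  | .ld e, d => .seq (e.comp d) (.load d d)
  | .op o a b, d => .seq (a.comp d) (.seq (b.comp (d + 1)) (.arith o d d (d + 1)))

theorem ex_simps :
    (∀ h n, (Ex.k n).eval h = n) ∧ (∀ h n, (Ex.r n).eval h = h.v n) ∧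
    (∀ h a, (Ex.ld a).eval h = h.m (a.eval h)) ∧
    (∀ h (n : ℕ), (no_index (OfNat.ofNat n) : Ex).eval h = (OfNat.ofNat n : ℕ)) ∧
    (∀ (h) (a b : Ex), (a + b).eval h = a.eval h + b.eval h) ∧
    (∀ (h) (a b : Ex), (a - b).eval h = a.eval h - b.eval h) ∧
    (∀ (h) (a b : Ex), (a * b).eval h = a.eval h * b.eval h) ∧
    (∀ (h) (a b : Ex), (a / b).eval h = a.eval h / b.eval h) ∧
    (∀ (h) (a b : Ex), (a % b).eval h = a.eval h % b.eval h) ∧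
    (∀ (h : HS) (x y c : ℕ), (h.set x c).v y = if y = x then c else h.v y) ∧
    (∀ (h : HS) (x c : ℕ), (h.set x c).m = h.m) ∧ (∀ (h : HS) (x c : ℕ), (h.wr x c).v = h.v) :=
  ⟨fun _ _ => rfl, fun _ _ => rfl, fun _ _ => rfl, fun _ _ => rfl, fun _ _ _ => rfl,
    fun _ _ _ => rfl, fun _ _ _ => rfl, fun _ _ _ => rfl, fun _ _ _ => rfl, fun _ _ _ _ => rfl,
    fun _ _ _ => rfl, fun _ _ _ => rfl⟩

theorem wr_m (h : HS) (x y c : ℕ) : (h.wr x c).m y = if y = x then c else h.m y := rfl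

theorem wr_self (h : HS) {x y : ℕ} (c : ℕ) (e : y = x) : (h.wr x c).m y = c := if_pos e

theorem wr_ne (h : HS) {x y : ℕ} (c : ℕ) (e : y ≠ x) : (h.wr x c).m y = h.m y := if_neg e

theorem ok_simps :
    (∀ B h n, (Ex.k n).ok B h = (n < B)) ∧ (∀ B h n, (Ex.r n).ok B h = (n < 64)) ∧
    (∀ B h a, (Ex.ld a).ok B h = a.ok B h) ∧
    (∀ B h (n : ℕ), (no_index (OfNat.ofNat n) : Ex).ok B h = ((OfNat.ofNat n : ℕ) < B)) ∧
    (∀ B h (a b : Ex), (a + b).ok B h = (a.ok B h ∧ b.ok B h ∧ a.eval h + b.eval h < B)) ∧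
    (∀ B h (a b : Ex), (a - b).ok B h = (a.ok B h ∧ b.ok B h ∧ a.eval h - b.eval h < B)) ∧
    (∀ B h (a b : Ex), (a * b).ok B h = (a.ok B h ∧ b.ok B h ∧ a.eval h * b.eval h < B)) ∧
    (∀ B h (a b : Ex), (a / b).ok B h = (a.ok B h ∧ b.ok B h ∧ a.eval h / b.eval h < B)) ∧
    (∀ B h (a b : Ex), (a % b).ok B h = (a.ok B h ∧ b.ok B h ∧ a.eval h % b.eval h < B)) :=
  ⟨fun _ _ _ => rfl, fun _ _ _ => rfl, fun _ _ _ => rfl, fun _ _ _ => rfl, fun _ _ _ _ => rfl,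
    fun _ _ _ _ => rfl, fun _ _ _ _ => rfl, fun _ _ _ _ => rfl, fun _ _ _ _ => rfl⟩

theorem cost_simps :
    (∀ n, (Ex.k n).cost = 1) ∧ (∀ n, (Ex.r n).cost = 1) ∧ (∀ a, (Ex.ld a).cost = a.cost + 1) ∧
    (∀ n : ℕ, (no_index (OfNat.ofNat n) : Ex).cost = 1) ∧
    (∀ a b : Ex, (a + b).cost = a.cost + b.cost + 1) ∧
    (∀ a b : Ex, (a - b).cost = a.cost + b.cost + 1) ∧
    (∀ a b : Ex, (a * b).cost = a.cost + b.cost + 1) ∧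
    (∀ a b : Ex, (a / b).cost = a.cost + b.cost + 1) ∧
    (∀ a b : Ex, (a % b).cost = a.cost + b.cost + 1) :=
  ⟨fun _ => rfl, fun _ => rfl, fun _ => rfl, fun _ => rfl, fun _ _ => rfl, fun _ _ => rfl,
    fun _ _ => rfl, fun _ _ => rfl, fun _ _ => rfl⟩

/-- A machine state implements an environment. -/
def Rel (h : HS) (s : RAM.State) : Prop := s.mem = h.m ∧ ∀ x < 64, s.reg x = h.v x

/-- Registers from 64 on serve as an evaluation stack: the left operand rests in `d` while the right
one is computed from `d + 1` on. Under `ok`, reduction modulo `2 ^ w` changes nothing, so machine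
arithmetic agrees with that of ℕ. -/
theorem Ex.comp_spec {w : ℕ} {h : HS} (e : Ex) : ∀ (d : ℕ) (s : RAM.State), 64 ≤ d → Rel h s →
    e.ok (2 ^ w) h → ∃ s', RAM.Exec w (e.comp d) s e.cost s' ∧ s'.mem = s.mem ∧
      (∀ x < d, s'.reg x = s.reg x) ∧ s'.reg d = e.eval h := by
  induction e with
  | k n =>
    intro d s hd hr ho
    refine ⟨_, RAM.Exec.const d n s, rfl, fun x hx => ?_, ?_⟩
    · simp [RAM.State.setReg, Function.update_of_ne (ne_of_lt hx)]
    · simpa [RAM.State.setReg, Ex.eval] using Nat.mod_eq_of_lt ho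
  | r y =>
    intro d s hd hr ho
    refine ⟨_, RAM.Exec.copy d y s, rfl, fun x hx => ?_, ?_⟩
    · simp [RAM.State.setReg, Function.update_of_ne (ne_of_lt hx)]
    · simpa [RAM.State.setReg, Ex.eval] using hr.2 y ho
  | ld e ih =>
    intro d s hd hr ho
    obtain ⟨s', h1, h2, h3, h4⟩ := ih d s hd hr ho
    refine ⟨_, .seq h1 (.load d d s'), h2, fun x hx => ?_, ?_⟩
    · simp [RAM.State.setReg, Function.update_of_ne (ne_of_lt hx), h3 x hx]
    · simp [RAM.State.setReg, Ex.eval, h4, h2, hr.1]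
  | op o a b iha ihb =>
    intro d s hd hr ho
    obtain ⟨hoa, hob, hoo⟩ := ho
    obtain ⟨s1, h1, h2, h3, h4⟩ := iha d s hd hr hoa
    have hr1 : Rel h s1 := ⟨h2.trans hr.1, fun x hx => (h3 x (by omega)).trans (hr.2 x hx)⟩
    obtain ⟨s2, k1, k2, k3, k4⟩ := ihb (d + 1) s1 (by omega) hr1 hob
    refine ⟨s2.setReg d (o.eval w (s2.reg d) (s2.reg (d + 1))), ?_, ?_, ?_, ?_⟩
    · have := RAM.Exec.seq h1 (RAM.Exec.seq k1 (RAM.Exec.arith (w := w) o d d (d + 1) s2))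
      rwa [← add_assoc] at this
    · exact k2.trans h2
    · intro x hx
      simp [RAM.State.setReg, Function.update_of_ne (ne_of_lt hx), h3 x hx, k3 x (by omega)]
    · have : s2.reg d = a.eval h := (k3 d (by omega)).trans h4
      simp only [RAM.State.setReg, Function.update_self, this, k4, Ex.eval]
      cases o <;> exact Nat.mod_eq_of_lt hoo

/-- Tests on expressions. -/
inductive Tst : Type
  | lt (a b : Ex) | eq (a b : Ex)

def Tst.Tr (h : HS) : Tst → Prop
  | .lt a b => a.eval h < b.eval h
  | .eq a b => a.eval h = b.eval h

def Tst.ok (B : ℕ) (h : HS) : Tst → Prop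
  | .lt a b => a.ok B h ∧ b.ok B h
  | .eq a b => a.ok B h ∧ b.ok B h

def Tst.cost : Tst → ℕ
  | .lt a b => a.cost + b.cost
  | .eq a b => a.cost + b.cost

def Tst.comp : Tst → RAM.Prog
  | .lt a b => .seq (a.comp 64) (b.comp 65)
  | .eq a b => .seq (a.comp 64) (b.comp 65)

def Tst.test : Tst → RAM.Test
  | .lt _ _ => .lt 64 65
  | .eq _ _ => .eq 64 65

theorem Tst.comp_spec {w : ℕ} {h : HS} (b : Tst) {s : RAM.State} (hr : Rel h s)
    (ho : b.ok (2 ^ w) h) : ∃ s', RAM.Exec w b.comp s b.cost s' ∧ Rel h s' ∧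
      (b.test.Holds s' ↔ b.Tr h) := by
  have key : ∀ a b : Ex, a.ok (2 ^ w) h → b.ok (2 ^ w) h → ∃ s',
      RAM.Exec w (.seq (a.comp 64) (b.comp 65)) s (a.cost + b.cost) s' ∧ Rel h s' ∧
      s'.reg 64 = a.eval h ∧ s'.reg 65 = b.eval h := by
    intro a b ha hb
    obtain ⟨s1, h1, h2, h3, h4⟩ := a.comp_spec 64 s le_rfl hr ha
    have hr1 : Rel h s1 := ⟨h2.trans hr.1, fun x hx => (h3 x hx).trans (hr.2 x hx)⟩
    obtain ⟨s2, k1, k2, k3, k4⟩ := b.comp_spec 65 s1 (by omega) hr1 hb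
    exact ⟨s2, .seq h1 k1, ⟨k2.trans hr1.1, fun x hx => (k3 x (by omega)).trans (hr1.2 x hx)⟩,
      (k3 64 (by omega)).trans h4, k4⟩
  cases b with
  | lt a b =>
    obtain ⟨s', h1, h2, h3, h4⟩ := key a b ho.1 ho.2
    exact ⟨s', h1, h2, by simp [Tst.test, RAM.Test.Holds, Tst.Tr, h3, h4]⟩
  | eq a b =>
    obtain ⟨s', h1, h2, h3, h4⟩ := key a b ho.1 ho.2
    exact ⟨s', h1, h2, by simp [Tst.test, RAM.Test.Holds, Tst.Tr, h3, h4]⟩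

theorem tst_simps :
    (∀ h a b, (Tst.lt a b).Tr h = (a.eval h < b.eval h)) ∧
    (∀ h a b, (Tst.eq a b).Tr h = (a.eval h = b.eval h)) ∧
    (∀ B h a b, (Tst.lt a b).ok B h = (a.ok B h ∧ b.ok B h)) ∧
    (∀ B h a b, (Tst.eq a b).ok B h = (a.ok B h ∧ b.ok B h)) ∧
    (∀ a b, (Tst.lt a b).cost = a.cost + b.cost) ∧ (∀ a b, (Tst.eq a b).cost = a.cost + b.cost) :=
  ⟨fun _ _ _ => rfl, fun _ _ _ => rfl, fun _ _ _ _ => rfl, fun _ _ _ _ => rfl, fun _ _ => rfl,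
    fun _ _ => rfl⟩

/-- Structured programs; `call p` behaves like `p`. -/
inductive St : Type
  | skip | asg (x : ℕ) (e : Ex) | sto (a e : Ex) | seq (p q : St) | ite (b : Tst) (p q : St)
  | loop (b : Tst) (p : St) | call (p : St)

infixr:40 " ;; " => St.seq

def St.comp : St → RAM.Prog
  | .skip => .skip
  | .asg x e => .seq (e.comp 64) (.copy x 64)
  | .sto a e => .seq (a.comp 64) (.seq (e.comp 65) (.store 64 65))
  | .seq p q => .seq p.comp q.comp
  | .ite b p q => .seq b.comp (.cond b.test p.comp q.comp)
  -- A RAM test only compares registers, so the operands are evaluated once before the loop and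
  -- again after each pass.
  | .loop b p => .seq b.comp (.loop b.test (.seq p.comp b.comp))
  | .call p => p.comp

/-- `WP w p Q h`: started in `h`, the program `p` halts after some time `t` in some `h'` with
`Q t h'`. -/
def WP (w : ℕ) (p : St) (Q : ℕ → HS → Prop) (h : HS) : Prop :=
  ∀ s, Rel h s → ∃ t s' h', RAM.Exec w p.comp s t s' ∧ Rel h' s' ∧ Q t h'

theorem WP.mono {w : ℕ} {p : St} {Q Q' : ℕ → HS → Prop} {h : HS} (hp : WP w p Q h)
    (hq : ∀ t h', Q t h' → Q' t h') : WP w p Q' h := by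
  intro s hs
  obtain ⟨t, s', h', h1, h2, h3⟩ := hp s hs
  exact ⟨t, s', h', h1, h2, hq _ _ h3⟩

theorem WP.seq {w : ℕ} {p q : St} {Q : ℕ → HS → Prop} {h : HS}
    (hp : WP w p (fun t h' => WP w q (fun u h'' => Q (t + u) h'') h') h) : WP w (.seq p q) Q h := by
  intro s hs
  obtain ⟨t, s', h', h1, h2, h3⟩ := hp s hs
  obtain ⟨u, s'', h'', k1, k2, k3⟩ := h3 s' h2
  exact ⟨t + u, s'', h'', .seq h1 k1, k2, k3⟩

/-- Symbolic execution of loop-free code. -/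
def sym (w : ℕ) : St → (ℕ → HS → Prop) → HS → Prop
  | .skip, Q, h => Q 1 h
  | .asg x e, Q, h => x < 64 ∧ e.ok (2 ^ w) h ∧ Q (e.cost + 1) (h.set x (e.eval h))
  | .sto a e, Q, h => a.ok (2 ^ w) h ∧ e.ok (2 ^ w) h ∧
      Q (a.cost + e.cost + 1) (h.wr (a.eval h) (e.eval h))
  | .seq p q, Q, h => sym w p (fun t h' => sym w q (fun u h'' => Q (t + u) h'') h') h
  | .ite b p q, Q, h => b.ok (2 ^ w) h ∧ (b.Tr h → sym w p (fun t h' => Q (b.cost + (t + 1)) h') h) ∧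
      (¬ b.Tr h → sym w q (fun t h' => Q (b.cost + (t + 1)) h') h)
  | .loop b p, Q, h => WP w (.loop b p) Q h
  | .call p, Q, h => WP w p Q h

/-- Unfolding `sym` stops at loops and calls, which remain as `WP` goals. There the loop rules or
the specification of the called program are applied, with the rest of the code as postcondition. -/
theorem sym.sound {w : ℕ} (p : St) : ∀ {Q : ℕ → HS → Prop} {h : HS}, sym w p Q h → WP w p Q h := by
  induction p with
  | skip => exact fun hq s hs => ⟨1, s, _, .skip s, hs, hq⟩
  | asg x e =>
    rintro Q h ⟨hx, ho, hq⟩ s hs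
    obtain ⟨s', h1, h2, h3, h4⟩ := e.comp_spec 64 s le_rfl hs ho
    refine ⟨_, s'.setReg x (s'.reg 64), h.set x (e.eval h), .seq h1 (.copy x 64 s'),
      ⟨h2.trans hs.1, fun y hy => ?_⟩, hq⟩
    by_cases hyx : y = x
    · subst hyx; simp [RAM.State.setReg, HS.set, h4]
    · simp [RAM.State.setReg, HS.set, hyx, h3 y hy, hs.2 y hy]
  | sto a e =>
    rintro Q h ⟨ha, he, hq⟩ s hs
    obtain ⟨s1, h1, h2, h3, h4⟩ := a.comp_spec 64 s le_rfl hs ha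
    have hr1 : Rel h s1 := ⟨h2.trans hs.1, fun x hx => (h3 x hx).trans (hs.2 x hx)⟩
    obtain ⟨s2, k1, k2, k3, k4⟩ := e.comp_spec 65 s1 (by omega) hr1 he
    refine ⟨a.cost + e.cost + 1, s2.setMem (s2.reg 64) (s2.reg 65),
      h.wr (a.eval h) (e.eval h), ?_, ⟨?_, fun y hy => ?_⟩, hq⟩
    · have := RAM.Exec.seq h1 (RAM.Exec.seq k1 (RAM.Exec.store (w := w) 64 65 s2))
      rwa [← add_assoc] at this
    · have : s2.reg 64 = a.eval h := (k3 64 (by omega)).trans h4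
      funext y
      simp [RAM.State.setMem, HS.wr, this, k4, k2.trans hr1.1, Function.update_apply]
    · exact (k3 y (by omega)).trans (hr1.2 y hy)
  | seq p q ihp ihq => exact fun hq => WP.seq ((ihp hq).mono fun _ _ h => ihq h)
  | ite b p q ihp ihq =>
    rintro Q h ⟨hb, ht, hf⟩ s hs
    obtain ⟨s1, h1, h2, h3⟩ := b.comp_spec hs hb
    by_cases hb : b.Tr h
    · obtain ⟨t, s', h', k1, k2, k3⟩ := ihp (ht hb) s1 h2
      exact ⟨_, s', h', .seq h1 (.cond_true (h3.2 hb) k1), k2, k3⟩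
    · obtain ⟨t, s', h', k1, k2, k3⟩ := ihq (hf hb) s1 h2
      exact ⟨_, s', h', .seq h1 (.cond_false (fun h => hb (h3.1 h)) k1), k2, k3⟩
  | loop b p _ => exact fun h => h
  | call p _ => exact fun h => h

/-- Loops: `J t h` is an invariant of the states `h` reached after `t ≤ T` steps. -/
theorem WP.loop {w : ℕ} {b : Tst} {p : St} {Q : ℕ → HS → Prop} (J : ℕ → HS → Prop) (T : ℕ)
    (hok : ∀ t h, J t h → b.ok (2 ^ w) h) (hT : ∀ t h, J t h → t ≤ T)
    (hstep : ∀ t h, J t h → b.Tr h → WP w p (fun u h' => J (t + u + b.cost + 1) h') h)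
    (hexit : ∀ t h, J t h → ¬ b.Tr h → Q (t + b.cost + 1) h) {h : HS} (h0 : J 0 h) :
    WP w (.loop b p) Q h := by
  -- Each pass adds at least 1 to `t`, which stays at most `T`; so `T - t` is a termination measure,
  -- and no separate variant is needed.
  have main : ∀ n t h s, T - t < n → J t h → Rel h s → ∀ s1, RAM.Exec w b.comp s b.cost s1 →
      Rel h s1 → (b.test.Holds s1 ↔ b.Tr h) →
      ∃ u s' h', RAM.Exec w (.loop b.test (.seq p.comp b.comp)) s1 u s' ∧ Rel h' s' ∧
        Q (t + b.cost + u) h' := by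
    intro n
    induction n with
    | zero => intro t h s hf; omega
    | succ n ih =>
      intro t h s hf hJ hs s1 e1 r1 b1
      by_cases hb : b.Tr h
      · obtain ⟨u, s2, h2, e2, r2, J2⟩ := hstep t h hJ hb s1 r1
        obtain ⟨s3, e3, r3, b3⟩ := b.comp_spec r2 (hok _ _ J2)
        have := hT _ _ J2
        obtain ⟨u', s4, h4, e4, r4, q4⟩ := ih _ h2 s2 (by omega) J2 r2 s3 e3 r3 b3
        refine ⟨_, s4, h4, .loop_true (b1.2 hb) (.seq e2 e3) e4, r4, ?_⟩
        convert q4 using 1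
        omega
      · exact ⟨1, s1, h, .loop_false (fun h => hb (b1.1 h)), r1, hexit t h hJ hb⟩
  intro s hs
  obtain ⟨s1, e1, r1, b1⟩ := b.comp_spec hs (hok _ _ h0)
  obtain ⟨u, s', h', e2, r2, q⟩ := main _ 0 h s (Nat.lt_succ_self _) h0 hs s1 e1 r1 b1
  exact ⟨_, s', h', .seq e1 e2, r2, by simpa using q⟩

/-- Loops with `n` iterations of cost at most `c`. -/
theorem WP.for {w : ℕ} {b : Tst} {p : St} {Q : ℕ → HS → Prop} (n c : ℕ) (I : ℕ → HS → Prop)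
    (hok : ∀ i h, i ≤ n → I i h → b.ok (2 ^ w) h)
    (htr : ∀ i h, i ≤ n → I i h → (b.Tr h ↔ i < n))
    (hstep : ∀ i h, i < n → I i h → WP w p (fun u h' => I (i + 1) h' ∧ u + b.cost + 1 ≤ c) h)
    (hexit : ∀ t h, I n h → t ≤ n * c + b.cost + 1 → Q t h) {h : HS} (h0 : I 0 h) :
    WP w (.loop b p) Q h := by
  have main : ∀ k i h s, i + k = n → I i h → Rel h s → (b.test.Holds s ↔ b.Tr h) → ∃ u s' h',
      RAM.Exec w (.loop b.test (.seq p.comp b.comp)) s u s' ∧ Rel h' s' ∧ I n h' ∧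
        u ≤ k * c + 1 := by
    intro k
    induction k with
    | zero =>
      intro i h s hi hI hs hb
      have hi' : i = n := by omega
      subst hi'
      exact ⟨1, s, h, .loop_false fun hh => lt_irrefl _ ((htr i h le_rfl hI).1 (hb.1 hh)), hs, hI,
        by omega⟩
    | succ k ih =>
      intro i h s hi hI hs hb
      obtain ⟨u, s2, h2, e2, r2, I2, c2⟩ := hstep i h (by omega) hI s hs
      obtain ⟨s3, e3, r3, b3⟩ := b.comp_spec r2 (hok _ _ (by omega) I2)
      obtain ⟨u', s4, h4, e4, r4, I4, c4⟩ := ih (i + 1) h2 s3 (by omega) I2 r3 b3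
      refine ⟨_, s4, h4, .loop_true (hb.2 ((htr i h (by omega) hI).2 (by omega)))
        (.seq e2 e3) e4, r4, I4, ?_⟩
      rw [Nat.succ_mul]; omega
  intro s hs
  obtain ⟨s1, e1, r1, b1⟩ := b.comp_spec hs (hok _ _ (Nat.zero_le _) h0)
  obtain ⟨u, s', h', e2, r2, I2, c2⟩ := main n 0 h s1 (by omega) h0 r1 b1
  exact ⟨_, s', h', .seq e1 e2, r2, hexit _ _ I2 (by omega)⟩

end WhileLang

/-! ### Fingerprints as affine maps -/

namespace WhileLang

/-- Horner evaluation modulo `μ`, started with `y`. -/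
def kap (μ c : ℕ) (X : List ℕ) (y : ℕ) : ℕ := X.foldr (fun a z => (a + c * z) % μ) y

/-- An affine map modulo `μ`. -/
def aff (μ f p y : ℕ) : ℕ := (f + p * y) % μ

theorem kap_append (μ c : ℕ) (X Y : List ℕ) (y : ℕ) :
    kap μ c (X ++ Y) y = kap μ c X (kap μ c Y y) := by simp [kap]

theorem kap_lt {μ : ℕ} (c : ℕ) (X : List ℕ) {y : ℕ} (hy : y < μ) : kap μ c X y < μ := by
  cases X with
  | nil => simpa [kap]
  | cons a X => exact Nat.mod_lt _ (by omega)

theorem kap_modEq (μ c : ℕ) (X : List ℕ) (y : ℕ) :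
    kap μ c X y ≡ kap μ c X 0 + c ^ X.length * y [MOD μ] := by
  induction X with
  | nil => simpa [kap] using Nat.ModEq.refl y
  | cons a X ih =>
    have h1 : kap μ c (a :: X) y ≡ a + c * kap μ c X y [MOD μ] := Nat.mod_modEq _ _
    have h2 : kap μ c (a :: X) 0 ≡ a + c * kap μ c X 0 [MOD μ] := Nat.mod_modEq _ _
    refine h1.trans (((Nat.ModEq.rfl.add (ih.mul_left c))).trans ?_)
    refine Nat.ModEq.trans ?_ (h2.symm.add_right _)
    rw [List.length_cons, pow_succ]
    ring_nf; rfl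

/-- Two residues determine the action of a string, whatever its length; they are the fields 4 and 5
of its record. -/
theorem kap_eq_aff {μ : ℕ} (c : ℕ) (X : List ℕ) {y : ℕ} (hy : y < μ) :
    kap μ c X y = aff μ (kap μ c X 0) (c ^ X.length % μ) y := by
  have h := kap_modEq μ c X y
  rw [aff, ← Nat.mod_eq_of_lt (kap_lt c X hy)]
  exact h.trans (Nat.ModEq.rfl.add (((Nat.mod_modEq _ _).symm).mul_right y))

theorem kap_replicate {μ : ℕ} (c : ℕ) (X : List ℕ) (e : ℕ) {y : ℕ} (hy : y < μ) :
    kap μ c (List.replicate e X).flatten y =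
      (aff μ (kap μ c X 0) (c ^ X.length % μ))^[e] y := by
  induction e with
  | zero => simp [kap]
  | succ e ih =>
    have h0 : 0 < μ := by omega
    rw [List.replicate_succ, List.flatten_cons, kap_append, Function.iterate_succ_apply', ← ih,
      kap_eq_aff c X (kap_lt c _ hy)]

/-- The squaring step of `affpow`: squares of affine maps are again given by two residues. -/
theorem aff_aff (μ f p y : ℕ) :
    aff μ f p (aff μ f p y) = aff μ ((f + p * f) % μ) (p * p % μ) y := by
  have h1 : f + p * ((f + p * y) % μ) ≡ f + p * (f + p * y) [MOD μ] :=
    Nat.ModEq.rfl.add ((Nat.mod_modEq _ _).mul_left _)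
  have h2 : (f + p * f) % μ + p * p % μ * y ≡ (f + p * f) + p * p * y [MOD μ] :=
    (Nat.mod_modEq _ _).add ((Nat.mod_modEq _ _).mul_right _)
  rw [show f + p * (f + p * y) = f + p * f + p * p * y by ring] at h1
  exact h1.trans h2.symm

/-- Lets `affpow` also compute the power of the base that belongs to a run. -/
theorem aff_pow (μ c l e : ℕ) : (aff μ 0 (c ^ l % μ))^[e] (1 % μ) = c ^ (e * l) % μ := by
  induction e with
  | zero => simp
  | succ e ih =>
    rw [Function.iterate_succ_apply', ih, aff, zero_add, ← Nat.mul_mod, ← pow_add]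
    congr 2
    ring

/-- Lets `affpow` shift a fingerprint by `e` positions at the end of a query. -/
theorem aff_zero_pow {μ c : ℕ} (e : ℕ) {y : ℕ} (hy : y < μ) :
    (aff μ 0 (c % μ))^[e] y = c ^ e * y % μ := by
  induction e with
  | zero => simp [Nat.mod_eq_of_lt hy]
  | succ e ih =>
    rw [Function.iterate_succ_apply', ih, aff, zero_add, ← Nat.mul_mod]
    congr 1
    ring

/-- The value is at most `(μ - 1) + (μ - 1)²`, that is `(μ - 1) * μ`. So words that hold `μ²`
evaluate affine maps without overflow. -/
theorem add_mul_lt_sq {μ f p y : ℕ} (hf : f < μ) (hp : p < μ) (hy : y < μ) :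
    f + p * y < μ * μ := by
  have h1 : p * y ≤ (μ - 1) * (μ - 1) := Nat.mul_le_mul (by omega) (by omega)
  obtain ⟨k, rfl⟩ : ∃ k, μ = k + 1 := ⟨μ - 1, by omega⟩
  simp only [Nat.add_sub_cancel] at h1
  nlinarith

/-! ### Powers of affine maps by repeated squaring; rounding to powers of 2 -/

open Ex St

/-- `r43 := (aff r40 r41)^[r42] r43`, with the modulus in `r2`. -/
def affpow : St := .loop (.lt 0 (r 42))
  (.ite (.eq (r 42 % 2) 1) (.asg 43 ((r 40 + r 41 * r 43) % r 2)) .skip ;;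
   .asg 40 ((r 40 + r 41 * r 40) % r 2) ;; .asg 41 ((r 41 * r 41) % r 2) ;; .asg 42 (r 42 / 2))

/-- The value of the current map, iterated `r42` times on `r43`, is invariant: an odd exponent
spends one application on `r43`, and then the map is squared and the exponent halved. -/
theorem affpow_spec {w μ : ℕ} {Q : ℕ → HS → Prop} {h : HS} (hμ : 2 ≤ μ) (hB : μ * μ ≤ 2 ^ w)
    (h2 : h.v 2 = μ) (h0 : h.v 40 < μ) (h1 : h.v 41 < μ) (h3 : h.v 43 < μ)
    (he : h.v 42 < 2 ^ w)
    (hQ : ∀ t v, (∀ x < 40, v x = h.v x) → v 43 = (aff μ (h.v 40) (h.v 41))^[h.v 42] (h.v 43) →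
      t ≤ 60 * (Nat.log 2 (h.v 42) + 2) → Q t ⟨v, h.m⟩) : WP w affpow Q h := by
  have hB2 : 2 < 2 ^ w := by nlinarith
  refine WP.loop (fun t g => g.m = h.m ∧ (∀ x < 40, g.v x = h.v x) ∧ g.v 40 < μ ∧ g.v 41 < μ ∧
    g.v 43 < μ ∧ g.v 42 ≤ h.v 42 ∧ (aff μ (g.v 40) (g.v 41))^[g.v 42] (g.v 43) =
      (aff μ (h.v 40) (h.v 41))^[h.v 42] (h.v 43) ∧
    t + (if g.v 42 = 0 then 0 else 60 * (Nat.log 2 (g.v 42) + 1)) ≤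
      60 * (Nat.log 2 (h.v 42) + 1)) (60 * (Nat.log 2 (h.v 42) + 1))
    ?_ (fun t g hg => by have := hg.2.2.2.2.2.2.2; omega) ?_ ?_ ?_
  · intro t g _
    simp only [tst_simps, ok_simps]; omega
  · rintro t g ⟨hm, hx, g0, g1, g3, ge, gi, gt⟩ hb
    have g2 : g.v 2 = μ := (hx 2 (by omega)).trans h2
    simp only [tst_simps, ex_simps] at hb
    refine sym.sound _ ?_
    -- Halving either makes the exponent 0 or lowers its logarithm by one; both release the 60 steps
    -- that pay for a pass.
    have hlog : (if g.v 42 / 2 = 0 then 0 else 60 * (Nat.log 2 (g.v 42 / 2) + 1)) + 60 ≤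
        60 * (Nat.log 2 (g.v 42) + 1) := by
      split_ifs with hz
      · omega
      · have := Nat.log_of_one_lt_of_le (b := 2) (n := g.v 42) (by omega) (by omega)
        omega
    rw [if_neg (by omega)] at gt
    have b1 := add_mul_lt_sq g0 g1 g3
    have b2 := add_mul_lt_sq g0 g1 g0
    have b3 := add_mul_lt_sq g0 g1 g1
    have b4 : ∀ x, x % μ < μ := fun x => Nat.mod_lt _ (by omega)
    have b5 : μ < 2 ^ w := by nlinarith
    have b6 := fun x => (b4 x).trans b5
    simp only [sym, tst_simps, ok_simps, ex_simps, g2, cost_simps, reduceIte, Nat.reduceEqDiff]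
    refine ⟨⟨⟨by omega, by omega, by omega⟩, by omega⟩, fun hodd => ?_, fun heven => ?_⟩
    · refine ⟨by omega, ⟨by simp; omega, by omega, b6 _⟩, by omega, ⟨by simp; omega, by omega, b6 _⟩,
        by omega, ⟨by simp; omega, by omega, b6 _⟩, by omega, ⟨by omega, by omega, by omega⟩, ?_⟩
      refine ⟨hm, fun x hx' => ?_, b4 _, b4 _, b4 _, by omega, ?_, by omega⟩
      · simp only [show x ≠ 40 by omega, show x ≠ 41 by omega, show x ≠ 42 by omega,
          show x ≠ 43 by omega, reduceIte, hx x hx']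
      · rw [← gi]
        conv_rhs => rw [show g.v 42 = 2 * (g.v 42 / 2) + 1 by omega, Function.iterate_add_apply,
          Function.iterate_mul]
        congr 1
        funext y
        exact (aff_aff _ _ _ _).symm
    · refine ⟨by omega, ⟨by simp; omega, by omega, b6 _⟩,
        by omega, ⟨by simp; omega, by omega, b6 _⟩, by omega, ⟨by omega, by omega, by omega⟩, ?_⟩
      refine ⟨hm, fun x hx' => ?_, b4 _, b4 _, g3, by omega, ?_, by omega⟩
      · simp only [show x ≠ 40 by omega, show x ≠ 41 by omega, show x ≠ 42 by omega,
          reduceIte, hx x hx']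
      · rw [← gi]
        conv_rhs => rw [show g.v 42 = 2 * (g.v 42 / 2) by omega, Function.iterate_mul]
        congr 1
        funext y
        exact (aff_aff _ _ _ _).symm
  · rintro t g ⟨hm, hx, g0, g1, g3, ge, gi, gt⟩ hb
    simp only [tst_simps, ex_simps] at hb
    have h42 : g.v 42 = 0 := by omega
    rw [h42] at gi
    have := hQ (t + Tst.cost (.lt 0 (r 42)) + 1) g.v hx gi (by
      simp only [tst_simps, cost_simps]; omega)
    rw [← hm] at this
    exact this
  · exact ⟨rfl, fun _ _ => rfl, h0, h1, h3, le_rfl, rfl, by split_ifs <;> omega⟩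

/-- `r41 := 2 ^ log₂ r40` -/
def flog : St := .asg 41 1 ;; .loop (.lt (r 41 * 2) (r 40 + 1)) (.asg 41 (r 41 * 2))

theorem flog_spec {w : ℕ} {Q : ℕ → HS → Prop} {h : HS} (hB : 2 * h.v 40 + 4 ≤ 2 ^ w)
    (hQ : ∀ t v, (∀ x, x ≠ 41 → v x = h.v x) → v 41 = 2 ^ Nat.log 2 (h.v 40) →
      t ≤ 20 * (Nat.log 2 (h.v 40) + 2) → Q t ⟨v, h.m⟩) : WP w flog Q h := by
  refine sym.sound _ ?_
  simp only [flog, sym, ok_simps, ex_simps, cost_simps]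
  refine ⟨by omega, by omega, ?_⟩
  refine WP.for (Nat.log 2 (h.v 40)) 20 (fun i g => g.m = h.m ∧ (∀ x, x ≠ 41 → g.v x = h.v x) ∧
    g.v 41 = 2 ^ i) ?_ ?_ ?_ ?_ ?_
  · rintro i g hi ⟨g1, g2, g3⟩
    have h1 : 2 ^ i ≤ h.v 40 ∨ i = 0 := by
      rcases Nat.eq_zero_or_pos (h.v 40) with h0 | h0
      · right; simpa [h0] using hi
      · left; exact Nat.pow_le_of_le_log (by omega) hi
    have h2 : 2 ^ i ≤ h.v 40 + 1 := by
      rcases h1 with h1 | rfl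
      · omega
      · simp
    simp only [tst_simps, ok_simps, ex_simps, g3, g2 40 (by omega)]
    omega
  · rintro i g hi ⟨g1, g2, g3⟩
    simp only [tst_simps, ex_simps, g3, g2 40 (by omega)]
    rw [← pow_succ, Nat.lt_succ_iff]
    constructor
    · intro hh
      exact Nat.le_log_of_pow_le (by omega) hh
    · intro hh
      exact Nat.pow_le_of_le_log (by rintro h0; simp [h0] at hh) hh
  · rintro i g hi ⟨g1, g2, g3⟩
    have h1 : 2 ^ i ≤ h.v 40 :=
      Nat.pow_le_of_le_log (by rintro h0; simp [h0] at hi) hi.le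
    refine sym.sound _ ?_
    simp only [sym, ok_simps, ex_simps, cost_simps, tst_simps, g3, g1]
    refine ⟨by omega, by omega, ⟨trivial, fun x hx => ?_, ?_⟩, by omega⟩
    · rw [if_neg hx, g2 x hx]
    · rw [if_pos trivial, pow_succ]
  · rintro t g ⟨g1, g2, g3⟩ ht
    have := hQ (1 + 1 + t) g.v g2 g3 (by simp only [tst_simps, cost_simps] at ht; omega)
    rw [← g1] at this
    exact this
  · exact ⟨rfl, fun x hx => by simp [ex_simps, hx], by simp [ex_simps]⟩

end WhileLang

/-! ### Grammars indexed by natural numbers, and symmetric centroid edges -/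

namespace WhileLang

/-- A grammar given by arrays: kinds 0, 1, 2 stand for terminal, pair and run-length rules. -/
structure Gram where
  m : ℕ
  kd : ℕ → ℕ
  a1 : ℕ → ℕ
  a2 : ℕ → ℕ
  st : ℕ
  str : ℕ → List ℕ
  st_lt : st < m
  kd_le : ∀ A < m, kd A ≤ 2
  term : ∀ A < m, kd A = 0 → str A = [a1 A]
  pair : ∀ A < m, kd A = 1 → a1 A < m ∧ a2 A < m ∧ str A = str (a1 A) ++ str (a2 A)
  run : ∀ A < m, kd A = 2 → a1 A < m ∧ 3 ≤ a2 A ∧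
    str A = (List.replicate (a2 A) (str (a1 A))).flatten
  ne : ∀ A < m, str A ≠ []

namespace Gram

variable (G : Gram)

/-- Length of the expansion. -/
def len (A : ℕ) : ℕ := (G.str A).length

/-- `X` occurs in the rule of `A`. -/
def Ch (A X : ℕ) : Prop := (G.kd A = 1 ∧ (X = G.a1 A ∨ X = G.a2 A)) ∨ (G.kd A = 2 ∧ X = G.a1 A)

/-- Number of occurrences of `X` in the rule of `A`. -/
def mul (A X : ℕ) : ℕ :=
  if G.kd A = 1 then (if G.a1 A = X then 1 else 0) + (if G.a2 A = X then 1 else 0)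
  else if G.kd A = 2 then (if G.a1 A = X then G.a2 A else 0) else 0

/-- Variables reachable from the initial one. -/
inductive Rch : ℕ → Prop
  | st : Rch G.st
  | step {A X : ℕ} : Rch A → G.Ch A X → Rch X

variable {G}

theorem len_pos {A : ℕ} (h : A < G.m) : 0 < G.len A := List.length_pos_iff.2 (G.ne A h)

theorem len_pair {A : ℕ} (h : A < G.m) (hk : G.kd A = 1) :
    G.len A = G.len (G.a1 A) + G.len (G.a2 A) := by
  simp [len, (G.pair A h hk).2.2]

theorem len_run {A : ℕ} (h : A < G.m) (hk : G.kd A = 2) :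
    G.len A = G.a2 A * G.len (G.a1 A) := by
  simp [len, (G.run A h hk).2.2]

theorem Ch.lt {A X : ℕ} (h : A < G.m) (hc : G.Ch A X) : X < G.m := by
  rcases hc with ⟨hk, rfl | rfl⟩ | ⟨hk, rfl⟩
  · exact (G.pair A h hk).1
  · exact (G.pair A h hk).2.1
  · exact (G.run A h hk).1

/-- Strings are nonempty and exponents are at least 3. From here on length plays the role of
acyclicity, as a rank on the variables. -/
theorem Ch.len_lt {A X : ℕ} (h : A < G.m) (hc : G.Ch A X) : G.len X < G.len A := by
  have hX := len_pos (hc.lt h)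
  rcases hc with ⟨hk, rfl | rfl⟩ | ⟨hk, rfl⟩
  · have := len_pos (G.pair A h hk).2.1
    rw [len_pair h hk]; omega
  · have := len_pos (G.pair A h hk).1
    rw [len_pair h hk]; omega
  · have := (G.run A h hk).2.1
    rw [len_run h hk]; nlinarith

theorem Rch.lt {A : ℕ} (h : G.Rch A) : A < G.m := by
  induction h with
  | st => exact G.st_lt
  | step _ hc ih => exact hc.lt ih

theorem Rch.len_le {A : ℕ} (h : G.Rch A) : G.len A ≤ G.len G.st := by
  induction h with
  | st => exact le_rfl
  | step h hc ih => exact (hc.len_lt h.lt).le.trans ih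

theorem Ch.of_mul {A X : ℕ} (h : G.mul A X ≠ 0) : G.Ch A X := by
  unfold mul at h
  unfold Ch
  split_ifs at h <;> simp_all

theorem Ch.mul_pos {A X : ℕ} (hA : A < G.m) (h : G.Ch A X) : 1 ≤ G.mul A X := by
  unfold mul
  rcases h with ⟨hk, rfl | rfl⟩ | ⟨hk, rfl⟩
  · simp [hk]
  · simp [hk]
  · have := (G.run A hA hk).2.1
    simp [hk]; omega

theorem sum_ite_le (k : ℕ → ℕ) (x : ℕ) : ∀ {a : List ℕ}, a.Nodup →
    (a.map (fun v => if x = v then k v else 0)).sum ≤ k x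
  | [], _ => by simp
  | y :: a, h => by
    rw [List.nodup_cons] at h
    rw [List.map_cons, List.sum_cons]
    by_cases hxy : x = y
    · subst hxy
      have : (a.map (fun v => if x = v then k v else 0)).sum = 0 := by
        rw [List.sum_eq_zero]
        intro z hz
        obtain ⟨v, hv, rfl⟩ := List.mem_map.1 hz
        rw [if_neg]
        rintro rfl
        exact h.1 hv
      simp [this]
    · simpa [hxy] using sum_ite_le k x h.2

theorem sum_map_add' (f g : ℕ → ℕ) (a : List ℕ) :
    (a.map (fun v => f v + g v)).sum = (a.map f).sum + (a.map g).sum := by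
  induction a with
  | nil => rfl
  | cons x a ih => simp only [List.map_cons, List.sum_cons, ih]; omega

/-- The variables occurring in a rule expand to disjoint factors of the string of `A`. -/
theorem sum_mul_len_le {A : ℕ} (hA : A < G.m) {a : List ℕ} (ha : a.Nodup) :
    (a.map (fun v => G.mul A v * G.len v)).sum ≤ G.len A := by
  have hk := G.kd_le A hA
  interval_cases h : G.kd A
  · simp [mul, h]
  · rw [len_pair hA h]
    have h1 := sum_ite_le (fun v => G.len v) (G.a1 A) ha
    have h2 := sum_ite_le (fun v => G.len v) (G.a2 A) ha
    have : (fun v => G.mul A v * G.len v) = fun v =>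
        (if G.a1 A = v then G.len v else 0) + (if G.a2 A = v then G.len v else 0) := by
      funext v
      simp only [mul, h, reduceIte]
      split_ifs <;> omega
    rw [this, sum_map_add']
    omega
  · rw [len_run hA h]
    refine le_trans (le_of_eq ?_) (sum_ite_le (fun v => G.a2 A * G.len v) (G.a1 A) ha)
    congr 1
    refine List.map_congr_left fun v _ => ?_
    simp only [mul, h]
    split_ifs <;> simp_all

/-! ### Numbers of occurrences along a topological order -/

variable (G)

/-- Number of paths from the initial variable, accumulated over the variables of the list. -/
def occ (l : List ℕ) : ℕ → ℕ :=
  l.foldr (fun u P v => P v + G.mul u v * P u) (fun v => if v = G.st then 1 else 0)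

/-- A list of the reachable variables in which children precede parents. -/
structure Ord (l : List ℕ) : Prop where
  nodup : l.Nodup
  rch : ∀ v ∈ l, G.Rch v
  st_mem : G.st ∈ l
  topo : ∀ a u b, l = a ++ u :: b → ∀ X, G.Ch u X → X ∈ a

variable {G}

theorem occ_cons (u : ℕ) (l : List ℕ) (v : ℕ) :
    G.occ (u :: l) v = G.occ l v + G.mul u v * G.occ l u := rfl

namespace Ord

variable {l : List ℕ} (O : G.Ord l)
include O

theorem lt {v : ℕ} (h : v ∈ l) : v < G.m := (O.rch v h).lt

theorem ch_mem {u X : ℕ} (h : u ∈ l) (hc : G.Ch u X) : X ∈ l := by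
  obtain ⟨a, b, rfl⟩ := List.append_of_mem h
  exact List.mem_append_left _ (O.topo a u b rfl X hc)

theorem mem_of_rch {v : ℕ} (h : G.Rch v) : v ∈ l := by
  induction h with
  | st => exact O.st_mem
  | step _ hc ih => exact O.ch_mem ih hc

/-- The fold runs from the end of the list, where the parents are. Once it has reached `v`, the
entries still to come have `v` in no rule, so the count of `v` is final. -/
theorem occ_final {v : ℕ} {b : List ℕ} (hv : v ∈ b) : ∀ (a a0 : List ℕ), l = a0 ++ (a ++ b) →
    G.occ (a ++ b) v = G.occ b v := by
  intro a
  induction a with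
  | nil => intro _ _; rfl
  | cons x a ih =>
    intro a0 h
    rw [List.cons_append, occ_cons, ih (a0 ++ [x]) (by simp [h])]
    have : G.mul x v = 0 := by
      by_contra hne
      have h1 := O.topo a0 x (a ++ b) (by simp [h]) v (Ch.of_mul hne)
      have h2 := O.nodup
      rw [h, List.nodup_append] at h2
      exact h2.2.2 v h1 v (by simp [hv]) rfl
    simp [this]

/-- Conservation of mass: at first all weight, `len st`, sits at the initial variable. Expanding `u`
moves `occ u * len u` to its children, whose lengths with multiplicity add up to at most `len u`. -/
theorem occ_sum : ∀ (b a : List ℕ), l = a ++ b →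
    (a.map (fun v => G.occ b v * G.len v)).sum ≤ G.len G.st := by
  intro b
  induction b with
  | nil =>
    intro a h
    have := sum_ite_le (fun v => G.len v) G.st (a := a)
      (by have h0 := O.nodup; rw [h, List.append_nil] at h0; exact h0)
    refine le_trans (le_of_eq ?_) this
    congr 1
    refine List.map_congr_left fun v _ => ?_
    simp only [occ, List.foldr_nil, ite_mul, one_mul, zero_mul, eq_comm]
  | cons u b ih =>
    intro a h
    have h1 := ih (a ++ [u]) (by simp [h])
    have hu : u ∈ l := by simp [h]
    have hn : a.Nodup := by
      have := O.nodup
      rw [h, List.nodup_append] at this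
      exact this.1
    have h2 := Nat.mul_le_mul_left (G.occ b u) (sum_mul_len_le (O.lt hu) hn)
    rw [List.map_append, List.sum_append] at h1
    simp only [List.map_cons, List.map_nil, List.sum_cons, List.sum_nil] at h1
    have h3 : (fun v => G.occ (u :: b) v * G.len v) = fun v =>
        G.occ b v * G.len v + G.occ b u * (G.mul u v * G.len v) := by
      funext v; rw [occ_cons]; ring
    rw [h3, sum_map_add', List.sum_map_mul_left]
    omega

/-- One summand of `occ_sum`, taken just before `v` is expanded, when its count is already final.
Together with `len v ≥ 1` it bounds `occ` by the text length, for the potential as well as for the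
word size. -/
theorem occ_mul_len {v : ℕ} (hv : v ∈ l) : G.occ l v * G.len v ≤ G.len G.st := by
  obtain ⟨a, b, rfl⟩ := List.append_of_mem hv
  have h1 := O.occ_sum b (a ++ [v]) (by simp)
  have h2 := O.occ_final (v := v) (b := v :: b) (by simp) a [] (by simp)
  have h3 : G.mul v v = 0 := by
    by_contra hne
    exact lt_irrefl _ ((Ch.of_mul hne).len_lt (O.lt hv))
  rw [occ_cons, h3, zero_mul, add_zero] at h2
  rw [h2]
  simp only [List.map_append, List.map_cons, List.map_nil, List.sum_append, List.sum_cons,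
    List.sum_nil] at h1
  omega

/-- By `occ_final` the count of `u` that is passed on at its turn is already `occ l u`; so the fold
satisfies the recursion over parents. -/
theorem occ_eq (v : ℕ) : ∀ (b a : List ℕ), l = a ++ b →
    G.occ b v = (if v = G.st then 1 else 0) + (b.map (fun u => G.mul u v * G.occ l u)).sum := by
  intro b
  induction b with
  | nil => intro a h; simp [occ]
  | cons u b ih =>
    intro a h
    have h1 := O.occ_final (v := u) (b := u :: b) (by simp) a [] (by simp [h])
    have h3 : G.mul u u = 0 := by
      by_contra hne
      exact lt_irrefl _ ((Ch.of_mul hne).len_lt (O.lt (v := u) (by simp [h])))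
    rw [occ_cons u b u, h3, zero_mul, add_zero, ← h] at h1
    rw [occ_cons, ih (a ++ [u]) (by simp [h]), List.map_cons, List.sum_cons, h1]
    omega

theorem occ_eq' (v : ℕ) :
    G.occ l v = (if v = G.st then 1 else 0) + ∑ u ∈ l.toFinset, G.mul u v * G.occ l u := by
  rw [List.sum_toFinset _ O.nodup]
  exact O.occ_eq v l [] rfl

theorem occ_le_ch {u v : ℕ} (hu : u ∈ l) (hc : G.Ch u v) : G.occ l u ≤ G.occ l v := by
  rw [O.occ_eq' v]
  have h1 := Finset.single_le_sum (f := fun u => G.mul u v * G.occ l u) (s := l.toFinset)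
    (fun _ _ => Nat.zero_le _) (List.mem_toFinset.2 hu)
  have h2 := Nat.mul_le_mul_right (G.occ l u) (hc.mul_pos (O.lt hu))
  omega

theorem occ_add_le {u u' v : ℕ} (hu : u ∈ l) (hu' : u' ∈ l) (hne : u ≠ u') (hc : G.Ch u v)
    (hc' : G.Ch u' v) : G.occ l u + G.occ l u' ≤ G.occ l v := by
  rw [O.occ_eq' v]
  have h1 : ∑ x ∈ ({u, u'} : Finset ℕ), G.mul x v * G.occ l x ≤
      ∑ x ∈ l.toFinset, G.mul x v * G.occ l x :=
    Finset.sum_le_sum_of_subset (by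
      intro x hx
      rcases Finset.mem_insert.1 hx with rfl | hx
      · exact List.mem_toFinset.2 hu
      · rw [Finset.mem_singleton.1 hx]; exact List.mem_toFinset.2 hu')
  rw [Finset.sum_pair hne] at h1
  have h2 := Nat.mul_le_mul_right (G.occ l u) (hc.mul_pos (O.lt hu))
  have h3 := Nat.mul_le_mul_right (G.occ l u') (hc'.mul_pos (O.lt hu'))
  omega

theorem occ_pos {v : ℕ} (hv : v ∈ l) : 1 ≤ G.occ l v := by
  have h := O.rch v hv
  clear hv
  induction h with
  | st => rw [O.occ_eq' G.st, if_pos rfl]; omega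
  | step h hc ih => exact ih.trans (O.occ_le_ch (O.mem_of_rch h) hc)

theorem len_pos {v : ℕ} (hv : v ∈ l) : 1 ≤ G.len v := Gram.len_pos (O.lt hv)

theorem occ_le {v : ℕ} (hv : v ∈ l) : G.occ l v ≤ G.len G.st := by
  have h1 := O.occ_mul_len hv
  have h2 := O.len_pos hv
  nlinarith

theorem len_le {v : ℕ} (hv : v ∈ l) : G.len v ≤ G.len G.st := (O.rch v hv).len_le

end Ord

/-- Symmetric centroid edges. -/
def SC (G : Gram) (l : List ℕ) (u v : ℕ) : Prop :=
  G.Ch u v ∧ Nat.log 2 (G.len u) = Nat.log 2 (G.len v) ∧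
    Nat.log 2 (G.occ l u) = Nat.log 2 (G.occ l v)

/-- Two numbers that are at least `2^k` add up to at least `2^(k+1)`. Applied to lengths and to
numbers of occurrences, this is why symmetric centroid edges form paths. -/
theorem log_lt_of_add_le {a b x : ℕ} (ha : 1 ≤ a) (hb : 1 ≤ b) (h : Nat.log 2 a = Nat.log 2 b)
    (hx : a + b ≤ x) : Nat.log 2 a < Nat.log 2 x := by
  have h1 : 2 ^ Nat.log 2 a ≤ a := Nat.pow_log_le_self 2 (by omega)
  have h2 : 2 ^ Nat.log 2 b ≤ b := Nat.pow_log_le_self 2 (by omega)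
  refine Nat.le_log_of_pow_le (by omega) ?_
  rw [← h] at h2
  rw [pow_succ]
  omega

namespace Ord

variable {l : List ℕ} (O : G.Ord l)
include O

/-- A run, or a pair of two equal variables, is at least twice as long as its child, so the
logarithm of the length changes. -/
theorem sc_kd {u v : ℕ} (hu : u ∈ l) (h : G.SC l u v) : G.kd u = 1 ∧ G.a1 u ≠ G.a2 u := by
  obtain ⟨hc, hL, -⟩ := h
  have hv := O.len_pos (O.ch_mem hu hc)
  have hlt := O.lt hu
  rcases hc with ⟨hk, hx⟩ | ⟨hk, rfl⟩
  · refine ⟨hk, fun he => ?_⟩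
    have hv' : v = G.a1 u := by rcases hx with rfl | rfl <;> simp [he]
    have := len_pair hlt hk
    rw [← he, ← hv'] at this
    exact absurd hL (ne_of_gt (log_lt_of_add_le hv hv rfl this.ge))
  · have h3 := (G.run u hlt hk).2.1
    have := len_run hlt hk
    have h4 : G.len (G.a1 u) + G.len (G.a1 u) ≤ G.len u := by rw [this]; nlinarith
    exact absurd hL (ne_of_gt (log_lt_of_add_le hv hv rfl h4))

/-- Two distinct children with the logarithm of `u` would have too large a total length. -/
theorem sc_child_unique {u v v' : ℕ} (hu : u ∈ l) (h : G.SC l u v) (h' : G.SC l u v') : v = v' := by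
  have hk := O.sc_kd hu h
  by_contra hne
  have hv := O.len_pos (O.ch_mem hu h.1)
  have hv' := O.len_pos (O.ch_mem hu h'.1)
  have hl := len_pair (O.lt hu) hk.1
  have e : G.len v + G.len v' ≤ G.len u := by
    rcases h.1 with ⟨_, rfl | rfl⟩ | ⟨h2, _⟩
    · rcases h'.1 with ⟨_, rfl | rfl⟩ | ⟨h2, _⟩
      · exact absurd rfl hne
      · omega
      · omega
    · rcases h'.1 with ⟨_, rfl | rfl⟩ | ⟨h2, _⟩
      · omega
      · exact absurd rfl hne
      · omega
    · omega
  exact absurd h.2.1 (ne_of_gt (log_lt_of_add_le hv hv' (h.2.1.symm.trans h'.2.1) e))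

/-- The dual argument: two distinct parents would contribute too many occurrences to `v`. -/
theorem sc_parent_unique {u u' v : ℕ} (hu : u ∈ l) (hu' : u' ∈ l) (h : G.SC l u v)
    (h' : G.SC l u' v) : u = u' := by
  by_contra hne
  exact absurd h.2.2 (ne_of_lt (log_lt_of_add_le (O.occ_pos hu) (O.occ_pos hu')
    (h.2.2.trans h'.2.2.symm) (O.occ_add_le hu hu' hne h.1 h'.1)))

end Ord

/-- The potential that decreases along all edges but the symmetric centroid edges. -/
def pot (G : Gram) (l : List ℕ) (v : ℕ) : ℕ :=
  Nat.log 2 (G.len v) + (Nat.log 2 (G.len G.st) - Nat.log 2 (G.occ l v))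

theorem pot_sc {l : List ℕ} {u v : ℕ} (h : G.SC l u v) : G.pot l u = G.pot l v := by
  unfold pot
  rw [h.2.1, h.2.2]

namespace Ord

variable {l : List ℕ} (O : G.Ord l)
include O

/-- Downwards lengths decrease and numbers of occurrences do not, so both terms of the potential are
monotone; if neither moves, the edge is symmetric centroid. The truncated subtraction in `pot` is
harmless because `occ` is at most the text length. -/
theorem pot_lt {u v : ℕ} (hu : u ∈ l) (hc : G.Ch u v) (hn : ¬ G.SC l u v) :
    G.pot l v < G.pot l u := by
  have h1 : Nat.log 2 (G.len v) ≤ Nat.log 2 (G.len u) :=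
    Nat.log_mono_right (hc.len_lt (O.lt hu)).le
  have h2 : Nat.log 2 (G.occ l u) ≤ Nat.log 2 (G.occ l v) :=
    Nat.log_mono_right (O.occ_le_ch hu hc)
  have h3 : Nat.log 2 (G.occ l v) ≤ Nat.log 2 (G.len G.st) :=
    Nat.log_mono_right (O.occ_le (O.ch_mem hu hc))
  have h4 : ¬ (Nat.log 2 (G.len u) = Nat.log 2 (G.len v) ∧
    Nat.log 2 (G.occ l u) = Nat.log 2 (G.occ l v)) := fun h => hn ⟨hc, h⟩
  unfold pot
  omega

theorem pot_le {u : ℕ} (hu : u ∈ l) : G.pot l u ≤ 2 * Nat.log 2 (G.len G.st) := by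
  have h1 : Nat.log 2 (G.len u) ≤ Nat.log 2 (G.len G.st) := Nat.log_mono_right (O.len_le hu)
  unfold pot
  omega

end Ord

end Gram

end WhileLang

/-! ### Blocks of symmetric centroid paths -/

namespace WhileLang

/-- A grammar with an ordering `l` of its variables, a placement `va` of the variables on positions
`1, …, cnt`, the position `pid` of the last variable of the path of each position, and a binary heap
with `2 ^ K` leaves. Records of 64 words start at address `VB`. -/
structure Dat where
  G : Gram
  l : List ℕ
  cnt : ℕ
  va : ℕ → ℕ
  pid : ℕ → ℕ
  K : ℕ
  VB : ℕ

namespace Dat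

variable (D : Dat)

/-- Consecutive positions with equal `pid` form the maximal symmetric centroid paths. -/
structure Ok : Prop where
  ord : D.G.Ord D.l
  mem : ∀ x, 1 ≤ x → x ≤ D.cnt → D.va x ∈ D.l
  pid_out : ∀ x, x = 0 ∨ D.cnt < x → D.pid x = 0
  pid_pos : ∀ x, 1 ≤ x → x ≤ D.cnt → 1 ≤ D.pid x ∧ D.pid x ≤ x
  bot : ∀ x, 1 ≤ x → x ≤ D.cnt → D.pid x = x → ∀ X, ¬ D.G.SC D.l (D.va x) X
  sc : ∀ x, 1 ≤ x → x ≤ D.cnt → D.pid x ≠ x →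
    D.G.SC D.l (D.va x) (D.va (x - 1)) ∧ D.pid (x - 1) = D.pid x
  surj : ∀ v ∈ D.l, ∃ x, 1 ≤ x ∧ x ≤ D.cnt ∧ D.va x = v
  cnt_le : D.cnt ≤ 2 ^ D.K

/-- Level of a heap node. -/
def lev (h : ℕ) : ℕ := D.K - Nat.log 2 h
/-- The block of a heap node consists of the edges between the positions `lo` and `hi`. -/
def lo (h : ℕ) : ℕ := h * 2 ^ D.lev h - 2 ^ D.K
def hi (h : ℕ) : ℕ := D.lo h + 2 ^ D.lev h
/-- Index of the grid cell at a level. -/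
def cell (e x : ℕ) : ℕ :=
  D.G.len (D.va x) * 2 ^ e / 2 ^ Nat.log 2 (D.G.len (D.va x))
/-- The block leaves a path or crosses the grid. -/
def cut (h : ℕ) : Prop :=
  D.pid (D.hi h) = 0 ∨ D.pid (D.lo h) ≠ D.pid (D.hi h) ∨
    D.cell (D.lev h) (D.lo h) ≠ D.cell (D.lev h) (D.hi h)
instance (h : ℕ) : Decidable (D.cut h) := by unfold cut; infer_instance

/-- The last cut block up to `h`. -/
def q : ℕ → ℕ
  | 0 => 0
  | h + 1 => if D.cut (h + 1) then h + 1 else q h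

/-- For a position above the end of its path, `itL x` and `itR x` are what its rule adds on the two
sides of the string of position `x - 1`: the sibling on one side, nothing on the other. -/
def itL (x : ℕ) : List ℕ :=
  if D.G.a1 (D.va x) = D.va (x - 1) then [] else D.G.str (D.G.a1 (D.va x))
def itR (x : ℕ) : List ℕ :=
  if D.G.a1 (D.va x) = D.va (x - 1) then D.G.str (D.G.a2 (D.va x)) else []

def CL (x : ℕ) : ℕ → List ℕ
  | 0 => []
  | k + 1 => D.itL (x + k + 1) ++ CL x k
def CR (x : ℕ) : ℕ → List ℕ
  | 0 => []
  | k + 1 => CR x k ++ D.itR (x + k + 1)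

/-- What precedes, and what follows, the string of position `x` in the string of position `y`. -/
def cL (x y : ℕ) : List ℕ := D.CL x (y - x)
def cR (x y : ℕ) : List ℕ := D.CR x (y - x)

theorem CL_add (x a b : ℕ) : D.CL x (a + b) = D.CL (x + a) b ++ D.CL x a := by
  induction b with
  | zero => rfl
  | succ b ih => rw [← add_assoc, CL, ih, CL, List.append_assoc]; congr 2; omega

theorem CR_add (x a b : ℕ) : D.CR x (a + b) = D.CR x a ++ D.CR (x + a) b := by
  induction b with
  | zero => simp [CR]
  | succ b ih => rw [← add_assoc, CR, ih, CR, List.append_assoc]; congr 3; omega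

theorem cL_trans {x y z : ℕ} (h1 : x ≤ y) (h2 : y ≤ z) : D.cL x z = D.cL y z ++ D.cL x y := by
  unfold cL
  rw [show z - x = (y - x) + (z - y) by omega, CL_add, show x + (y - x) = y by omega]

theorem cR_trans {x y z : ℕ} (h1 : x ≤ y) (h2 : y ≤ z) : D.cR x z = D.cR x y ++ D.cR y z := by
  unfold cR
  rw [show z - x = (y - x) + (z - y) by omega, CR_add, show x + (y - x) = y by omega]

theorem cL_self (x : ℕ) : D.cL x x = [] := by simp [cL, CL]
theorem cR_self (x : ℕ) : D.cR x x = [] := by simp [cR, CR]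
theorem cL_succ (x : ℕ) : D.cL x (x + 1) = D.itL (x + 1) := by simp [cL, CL]
theorem cR_succ (x : ℕ) : D.cR x (x + 1) = D.itR (x + 1) := by simp [cR, CR]

theorem log_half {h : ℕ} (h2 : 2 ≤ h) : Nat.log 2 h = Nat.log 2 (h / 2) + 1 :=
  Nat.log_of_one_lt_of_le (by omega) h2

variable {D}

theorem log_le_K {h : ℕ} (h1 : 1 ≤ h) (h2 : h < 2 * 2 ^ D.K) : Nat.log 2 h ≤ D.K := by
  rw [← pow_succ'] at h2
  exact Nat.lt_succ_iff.1 (Nat.log_lt_of_lt_pow (by omega) h2)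

theorem lev_half {h : ℕ} (h2 : 2 ≤ h) (h3 : h < 2 * 2 ^ D.K) : D.lev (h / 2) = D.lev h + 1 := by
  have h4 := log_le_K (D := D) (by omega) h3
  have := log_half h2
  unfold lev
  omega

theorem pow_K_le {h : ℕ} (h1 : 1 ≤ h) (h2 : h < 2 * 2 ^ D.K) : 2 ^ D.K ≤ h * 2 ^ D.lev h := by
  have h4 := log_le_K (D := D) h1 h2
  have h5 : 2 ^ Nat.log 2 h ≤ h := Nat.pow_log_le_self 2 (by omega)
  calc 2 ^ D.K = 2 ^ Nat.log 2 h * 2 ^ D.lev h := by rw [← pow_add]; congr 1; unfold lev; omega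
    _ ≤ _ := Nat.mul_le_mul_right _ h5

theorem lo_even {h : ℕ} (h1 : 1 ≤ h) (h2 : h < 2 ^ D.K) : D.lo (2 * h) = D.lo h := by
  have := lev_half (D := D) (h := 2 * h) (by omega) (by omega)
  rw [show 2 * h / 2 = h by omega] at this
  unfold lo
  rw [this, pow_succ]
  congr 1
  ring

theorem lev_even {h : ℕ} (h1 : 1 ≤ h) (h2 : h < 2 ^ D.K) : D.lev (2 * h) + 1 = D.lev h := by
  have := lev_half (D := D) (h := 2 * h) (by omega) (by omega)
  rw [show 2 * h / 2 = h by omega] at this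
  exact this.symm

theorem lev_odd {h : ℕ} (h1 : 1 ≤ h) (h2 : h < 2 ^ D.K) : D.lev (2 * h + 1) + 1 = D.lev h := by
  have := lev_half (D := D) (h := 2 * h + 1) (by omega) (by omega)
  rw [show (2 * h + 1) / 2 = h by omega] at this
  exact this.symm

theorem lo_odd {h : ℕ} (h1 : 1 ≤ h) (h2 : h < 2 ^ D.K) : D.lo (2 * h + 1) = D.hi (2 * h) := by
  have h3 := lev_odd (D := D) h1 h2
  have h4 := lev_even (D := D) h1 h2
  have h5 : D.lev (2 * h + 1) = D.lev (2 * h) := by omega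
  have h6 := pow_K_le (D := D) (h := 2 * h) (by omega) (by omega)
  unfold hi lo
  rw [h5, Nat.add_mul, one_mul]
  exact Nat.sub_add_comm h6

theorem hi_odd {h : ℕ} (h1 : 1 ≤ h) (h2 : h < 2 ^ D.K) : D.hi (2 * h + 1) = D.hi h := by
  have h3 := lev_odd (D := D) h1 h2
  have h4 := lev_even (D := D) h1 h2
  have h5 : D.lev (2 * h + 1) = D.lev (2 * h) := by omega
  unfold hi
  rw [lo_odd h1 h2, hi, lo_even h1 h2, ← h4, h5, pow_succ]
  omega

theorem lev_leaf {h : ℕ} (h1 : 2 ^ D.K ≤ h) : D.lev h = 0 := by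
  have : D.K ≤ Nat.log 2 h := Nat.le_log_of_pow_le (by omega) h1
  unfold lev; omega

theorem lo_leaf {h : ℕ} (h1 : 2 ^ D.K ≤ h) : D.lo h = h - 2 ^ D.K := by
  simp [lo, lev_leaf h1]

theorem hi_leaf {h : ℕ} (h1 : 2 ^ D.K ≤ h) : D.hi h = h - 2 ^ D.K + 1 := by
  simp [hi, lo_leaf h1, lev_leaf h1]

theorem hi_eq {h : ℕ} (h1 : 1 ≤ h) (h2 : h < 2 * 2 ^ D.K) :
    D.hi h + 2 ^ D.K = (h + 1) * 2 ^ D.lev h := by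
  have := pow_K_le (D := D) h1 h2
  unfold hi lo
  rw [Nat.add_mul]
  omega

theorem hi_le {h : ℕ} (h1 : 1 ≤ h) (h2 : h < 2 * 2 ^ D.K) : D.hi h ≤ 2 ^ D.K := by
  have h3 := hi_eq (D := D) h1 h2
  have h4 : h + 1 ≤ 2 ^ (Nat.log 2 h + 1) := Nat.lt_pow_succ_log_self (by omega) h
  have h5 : (h + 1) * 2 ^ D.lev h ≤ 2 ^ (Nat.log 2 h + 1) * 2 ^ D.lev h := Nat.mul_le_mul_right _ h4
  have h6 := log_le_K (D := D) h1 h2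
  rw [← pow_add, show Nat.log 2 h + 1 + D.lev h = D.K + 1 by unfold lev; omega, pow_succ] at h5
  omega

theorem lo_lt_hi (h : ℕ) : D.lo h < D.hi h := Nat.lt_add_of_pos_right (by positivity)

/-- The first node of each level is a power of 2 and starts at position 0. Any other node has its
left neighbour on the same level. -/
theorem prev_of_lo_pos {h : ℕ} (h1 : 1 ≤ h) (h2 : h < 2 * 2 ^ D.K) (hl : 0 < D.lo h) :
    1 ≤ h - 1 ∧ D.lev (h - 1) = D.lev h ∧ D.hi (h - 1) = D.lo h := by
  have h4 := log_le_K (D := D) h1 h2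
  have h5 : 2 ^ Nat.log 2 h ≤ h := Nat.pow_log_le_self 2 (by omega)
  have h6 : 2 ^ Nat.log 2 h ≠ h := by
    intro he
    have e1 : 2 ^ Nat.log 2 h * 2 ^ (D.K - Nat.log 2 h) = 2 ^ D.K := by
      rw [← pow_add]; congr 1; omega
    have : 2 ^ D.K = h * 2 ^ D.lev h := by
      rw [← e1, he]; rfl
    unfold lo at hl
    omega
  have h0 : 1 ≤ 2 ^ Nat.log 2 h := Nat.one_le_two_pow
  have h7 : Nat.log 2 (h - 1) = Nat.log 2 h := by
    refine le_antisymm (Nat.log_mono_right (by omega)) (Nat.le_log_of_pow_le (by omega) (by omega))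
  have h8 : D.lev (h - 1) = D.lev h := by unfold lev; rw [h7]
  refine ⟨by omega, h8, ?_⟩
  have h9 := hi_eq (D := D) (h := h - 1) (by omega) (by omega)
  rw [h8, show h - 1 + 1 = h by omega] at h9
  unfold lo
  omega

/-! ### Uncut blocks, grid cells, and the last cut -/

namespace Ok

variable (H : D.Ok)
include H

theorem range_of_pid {x : ℕ} (h : D.pid x ≠ 0) : 1 ≤ x ∧ x ≤ D.cnt := by
  by_contra hc
  exact h (H.pid_out x (by omega))

/-- Position 0 belongs to no path. So the first block of every level is cut, and the search for the
last cut never leaves its level. -/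
theorem cut_of_lo {h : ℕ} (hl : D.lo h = 0) : D.cut h := by
  by_cases h0 : D.pid (D.hi h) = 0
  · exact Or.inl h0
  · refine Or.inr (Or.inl ?_)
    rw [hl, H.pid_out 0 (Or.inl rfl)]
    exact fun e => h0 e.symm

theorem lo_pos {h : ℕ} (hn : ¬ D.cut h) : 0 < D.lo h :=
  Nat.pos_of_ne_zero fun hl => hn (H.cut_of_lo hl)

theorem prev {h : ℕ} (h1 : 1 ≤ h) (h2 : h < 2 * 2 ^ D.K) (hn : ¬ D.cut h) :
    1 ≤ h - 1 ∧ D.lev (h - 1) = D.lev h ∧ D.hi (h - 1) = D.lo h :=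
  prev_of_lo_pos h1 h2 (H.lo_pos hn)

theorem chain {y : ℕ} (hy : D.pid y ≠ 0) : ∀ k, D.pid y + k ≤ y → D.pid (y - k) = D.pid y := by
  intro k
  induction k with
  | zero => intro _; rfl
  | succ k ih =>
    intro hk
    have h1 := ih (by omega)
    have h2 := H.range_of_pid (x := y - k) (by rw [h1]; exact hy)
    have h3 := (H.sc (y - k) h2.1 h2.2 (by omega)).2
    rw [← h1, ← h3]
    congr 1

theorem pid_mid {x y : ℕ} (hy : D.pid y ≠ 0) (h1 : D.pid y ≤ x) (h2 : x ≤ y) :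
    D.pid x = D.pid y := by
  have := H.chain hy (y - x) (by omega)
  rwa [show y - (y - x) = x by omega] at this

/-- Two positions of one path. -/
theorem pid_between {x y z : ℕ} (hx : D.pid x ≠ 0) (hxy : D.pid x = D.pid y) (h1 : x ≤ z)
    (h2 : z ≤ y) : D.pid z = D.pid y := by
  have := H.range_of_pid hx
  have := H.pid_pos x this.1 this.2
  exact H.pid_mid (hxy ▸ hx) (by omega) h2

theorem sc_between {x y z : ℕ} (hx : D.pid x ≠ 0) (hxy : D.pid x = D.pid y) (h1 : x < z)
    (h2 : z ≤ y) : D.G.SC D.l (D.va z) (D.va (z - 1)) ∧ D.va z ∈ D.l := by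
  have hz := H.pid_between hx hxy h1.le h2
  have hr := H.range_of_pid (x := z) (by rw [hz, ← hxy]; exact hx)
  have hx' := H.range_of_pid hx
  have := H.pid_pos x hx'.1 hx'.2
  exact ⟨(H.sc z hr.1 hr.2 (by omega)).1, H.mem z hr.1 hr.2⟩

/-- Each step up a path is one symmetric centroid edge: the length grows by at least 1, while its
logarithm and the potential stay. -/
theorem path_mono {x : ℕ} (hx : D.pid x ≠ 0) : ∀ k, D.pid x = D.pid (x + k) →
    D.G.len (D.va x) + k ≤ D.G.len (D.va (x + k)) ∧
    Nat.log 2 (D.G.len (D.va x)) = Nat.log 2 (D.G.len (D.va (x + k))) ∧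
    D.G.pot D.l (D.va x) = D.G.pot D.l (D.va (x + k)) := by
  intro k
  induction k with
  | zero => intro _; exact ⟨le_rfl, rfl, rfl⟩
  | succ k ih =>
    intro hk
    have h1 := H.pid_between hx hk (z := x + k) (by omega) (by omega)
    obtain ⟨i1, i2, i3⟩ := ih (hk.trans h1.symm)
    obtain ⟨s1, s2⟩ := H.sc_between hx hk (z := x + (k + 1)) (by omega) le_rfl
    rw [show x + (k + 1) - 1 = x + k by omega] at s1
    have := s1.1.len_lt (H.ord.lt s2)
    exact ⟨by omega, i2.trans s1.2.1.symm, i3.trans (Gram.pot_sc s1).symm⟩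

theorem len_le {x y : ℕ} (hx : D.pid x ≠ 0) (hxy : D.pid x = D.pid y) (h : x ≤ y) :
    D.G.len (D.va x) + (y - x) ≤ D.G.len (D.va y) := by
  have := (H.path_mono hx (y - x) (by rwa [show x + (y - x) = y by omega])).1
  rwa [show x + (y - x) = y by omega] at this

theorem log_eq {x y : ℕ} (hx : D.pid x ≠ 0) (hxy : D.pid x = D.pid y) (h : x ≤ y) :
    Nat.log 2 (D.G.len (D.va x)) = Nat.log 2 (D.G.len (D.va y)) := by
  have := (H.path_mono hx (y - x) (by rwa [show x + (y - x) = y by omega])).2.1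
  rwa [show x + (y - x) = y by omega] at this

theorem pot_eq {x y : ℕ} (hx : D.pid x ≠ 0) (hxy : D.pid x = D.pid y) (h : x ≤ y) :
    D.G.pot D.l (D.va x) = D.G.pot D.l (D.va y) := by
  have := (H.path_mono hx (y - x) (by rwa [show x + (y - x) = y by omega])).2.2
  rwa [show x + (y - x) = y by omega] at this

theorem str_item {x : ℕ} (h : D.G.SC D.l (D.va x) (D.va (x - 1))) (hm : D.va x ∈ D.l) :
    D.G.str (D.va x) = D.itL x ++ D.G.str (D.va (x - 1)) ++ D.itR x := by
  have hk := H.ord.sc_kd hm h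
  have hp := (D.G.pair _ (H.ord.lt hm) hk.1).2.2
  unfold itL itR
  split_ifs with he
  · rw [hp, he]; simp
  · have : D.va (x - 1) = D.G.a2 (D.va x) := by
      rcases h.1 with ⟨_, h | h⟩ | ⟨h, _⟩
      · exact absurd h.symm he
      · exact h
      · omega
    rw [hp, this]; simp

/-- Going up a path wraps one item around the string at each step. With `x` the lowest position, all
siblings of the path between `x` and `y` are gathered in two context strings. -/
theorem str_chain {x y : ℕ} (hx : D.pid x ≠ 0) (hxy : D.pid x = D.pid y) (h : x ≤ y) :
    D.G.str (D.va y) = D.cL x y ++ D.G.str (D.va x) ++ D.cR x y := by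
  obtain ⟨k, rfl⟩ := Nat.exists_eq_add_of_le h
  clear h
  induction k with
  | zero => simp [cL_self, cR_self]
  | succ k ih =>
    have h1 := H.pid_between hx hxy (z := x + k) (by omega) (by omega)
    obtain ⟨s1, s2⟩ := H.sc_between hx hxy (z := x + (k + 1)) (by omega) le_rfl
    rw [H.str_item s1 s2, show x + (k + 1) - 1 = x + k by omega, ih (hxy.trans h1.symm),
      D.cL_trans (y := x + k) (by omega) (by omega : x + k ≤ x + (k + 1)),
      D.cR_trans (y := x + k) (by omega) (by omega : x + k ≤ x + (k + 1)),
      ← add_assoc, cL_succ, cR_succ]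
    simp

omit H in
theorem noncut_pid {h : ℕ} (hn : ¬ D.cut h) :
    D.pid (D.lo h) ≠ 0 ∧ D.pid (D.lo h) = D.pid (D.hi h) ∧
    D.cell (D.lev h) (D.lo h) = D.cell (D.lev h) (D.hi h) := by
  unfold cut at hn
  push Not at hn
  exact ⟨by rw [hn.2.1]; exact hn.1, hn.2.1, hn.2.2⟩

omit H in
-- The grids are nested: each cell splits into two on the next level, and the parity of the finer
-- index tells which half contains `x`.
theorem cell_half (e x : ℕ) : D.cell (e + 1) x / 2 = D.cell e x := by
  unfold cell
  rw [Nat.div_div_eq_div_mul, pow_succ, ← mul_assoc, Nat.mul_div_mul_right _ _ (by norm_num)]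

/-- On one path all positions share the same grid, as the logarithm of the length is constant there.
-/
theorem cell_mono {x y : ℕ} (e : ℕ) (hx : D.pid x ≠ 0) (hxy : D.pid x = D.pid y) (h : x ≤ y) :
    D.cell e x ≤ D.cell e y := by
  unfold cell
  rw [H.log_eq hx hxy h]
  have := H.len_le hx hxy h
  exact Nat.div_le_div_right (Nat.mul_le_mul_right _ (by omega))

/-- A block that respects a grid is short. -/
theorem diff_lt {x y e : ℕ} (hx : D.pid x ≠ 0) (hxy : D.pid x = D.pid y) (h : x ≤ y)
    (hc : D.cell e x = D.cell e y) :
    (D.G.len (D.va y) - D.G.len (D.va x)) * 2 ^ e < 2 ^ Nat.log 2 (D.G.len (D.va y)) := by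
  unfold cell at hc
  rw [H.log_eq hx hxy h] at hc
  set g := 2 ^ Nat.log 2 (D.G.len (D.va y)) with hg
  have hg0 : 0 < g := by positivity
  have h1 := Nat.div_add_mod (D.G.len (D.va x) * 2 ^ e) g
  have h2 := Nat.div_add_mod (D.G.len (D.va y) * 2 ^ e) g
  have h3 := Nat.mod_lt (D.G.len (D.va y) * 2 ^ e) hg0
  rw [hc] at h1
  rw [Nat.sub_mul]
  omega

/-- A child covers a part of the same stretch of path and is tested against a coarser grid. Hence
the whole subtree of an uncut block is uncut. -/
theorem noncut_odd {h : ℕ} (h1 : 1 ≤ h) (h2 : h < 2 ^ D.K) (hn : ¬ D.cut h) :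
    ¬ D.cut (2 * h + 1) := by
  obtain ⟨n1, n2, n3⟩ := noncut_pid hn
  have e1 := lo_odd (D := D) h1 h2
  have e2 := hi_odd (D := D) h1 h2
  have e3 := lo_even (D := D) h1 h2
  have e4 := lev_odd (D := D) h1 h2
  have l1 := lo_lt_hi (D := D) (2 * h)
  have l2 := lo_lt_hi (D := D) (2 * h + 1)
  have p := H.pid_between n1 n2 (z := D.lo (2 * h + 1)) (by omega) (by omega)
  have p0 : D.pid (D.lo (2 * h + 1)) ≠ 0 := by rw [p, ← n2]; exact n1
  unfold cut
  rw [e2]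
  push Not
  refine ⟨by rw [← n2]; exact n1, p, ?_⟩
  have m1 := H.cell_mono (D.lev h) p0 p (by omega)
  have m2 := H.cell_mono (D.lev h) n1 (n2.trans p.symm) (by omega)
  have m3 : D.cell (D.lev h) (D.lo (2 * h + 1)) = D.cell (D.lev h) (D.hi h) := by omega
  rw [← e4] at m3
  rw [← cell_half _ (D.lo (2 * h + 1)), ← cell_half _ (D.hi h), m3]

theorem noncut_even {h : ℕ} (h1 : 1 ≤ h) (h2 : h < 2 ^ D.K) (hn : ¬ D.cut h) :
    ¬ D.cut (2 * h) := by
  obtain ⟨n1, n2, n3⟩ := noncut_pid hn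
  have e1 := lo_odd (D := D) h1 h2
  have e2 := hi_odd (D := D) h1 h2
  have e3 := lo_even (D := D) h1 h2
  have e4 := lev_even (D := D) h1 h2
  have l1 := lo_lt_hi (D := D) (2 * h)
  have l2 := lo_lt_hi (D := D) (2 * h + 1)
  have p := H.pid_between n1 n2 (z := D.hi (2 * h)) (by omega) (by omega)
  have p0 : D.pid (D.hi (2 * h)) ≠ 0 := by rw [p, ← n2]; exact n1
  unfold cut
  rw [e3]
  push Not
  refine ⟨p0, n2.trans p.symm, ?_⟩
  have m1 := H.cell_mono (D.lev h) p0 p (by omega)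
  have m2 := H.cell_mono (D.lev h) n1 (n2.trans p.symm) (by omega)
  have m3 : D.cell (D.lev h) (D.lo h) = D.cell (D.lev h) (D.hi (2 * h)) := by omega
  rw [← e4] at m3
  rw [← cell_half _ (D.lo h), ← cell_half _ (D.hi (2 * h)), m3]

omit H in
theorem q_cut {h : ℕ} (hc : D.cut h) : D.q h = h := by
  cases h with
  | zero => rfl
  | succ h => simp [q, hc]

omit H in
theorem q_noncut {h : ℕ} (h1 : 1 ≤ h) (hc : ¬ D.cut h) : D.q h = D.q (h - 1) := by
  cases h with
  | zero => omega
  | succ h => simp [q, hc]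

/-- Between the last cut and `h` all blocks are uncut, and each of them ties its two ends to one
path and one cell. So the right end of the last cut shares path and cell with `hi h`. -/
theorem q_spec {h : ℕ} (h1 : 1 ≤ h) (h2 : h < 2 * 2 ^ D.K) :
    1 ≤ D.q h ∧ D.q h ≤ h ∧ D.lev (D.q h) = D.lev h ∧ D.cut (D.q h) ∧
    D.hi (D.q h) ≤ D.hi h ∧
    (¬ D.cut h → D.q h < h ∧ D.pid (D.hi (D.q h)) ≠ 0 ∧
      D.pid (D.hi (D.q h)) = D.pid (D.hi h) ∧ D.hi (D.q h) ≤ D.lo h ∧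
      D.cell (D.lev h) (D.hi (D.q h)) = D.cell (D.lev h) (D.hi h)) := by
  induction h using Nat.strong_induction_on with
  | _ h ih =>
    by_cases hc : D.cut h
    · rw [q_cut hc]
      exact ⟨h1, le_rfl, rfl, hc, le_rfl, fun h => absurd hc h⟩
    · obtain ⟨p1, p2, p3⟩ := H.prev h1 h2 hc
      obtain ⟨n1, n2, n3⟩ := noncut_pid hc
      obtain ⟨i1, i2, i3, i4, i5, i6⟩ := ih (h - 1) (by omega) p1 (by omega)
      rw [q_noncut h1 hc]
      have hl := lo_lt_hi (D := D) h
      refine ⟨i1, by omega, i3.trans p2, i4, by omega, fun _ => ?_⟩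
      by_cases hc' : D.cut (h - 1)
      · rw [q_cut hc', p3]
        exact ⟨by omega, n1, n2, le_rfl, n3⟩
      · obtain ⟨j1, j2, j3, j4, j5⟩ := i6 hc'
        rw [p2, p3] at j5
        rw [p3] at j3 i5
        exact ⟨by omega, j2, j3.trans n2, i5, j5.trans n3⟩

omit H in
theorem q_eq_of_noncut {a h : ℕ} (hah : a ≤ h) (hn : ∀ g, a < g → g ≤ h → ¬ D.cut g) :
    D.q h = D.q a := by
  induction h with
  | zero => rw [Nat.le_zero.1 hah]
  | succ h ih =>
    rcases Nat.lt_or_ge h a with h1 | h1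
    · rw [show a = h + 1 by omega]
    · rw [q_noncut (by omega) (hn (h + 1) (by omega) le_rfl)]
      exact ih h1 fun g g1 g2 => hn g g1 (by omega)

omit H in
theorem noncut_of_q {g : ℕ} : ∀ {h : ℕ}, D.q h < g → g ≤ h → ¬ D.cut g := by
  intro h
  induction h with
  | zero => intro h1 h2; omega
  | succ h ih =>
    intro h1 h2 hc
    by_cases hc' : D.cut (h + 1)
    · rw [q_cut hc'] at h1; omega
    · rw [q_noncut (by omega) hc'] at h1
      rcases Nat.lt_or_ge h g with h3 | h3
      · rw [show g = h + 1 by omega] at hc; exact hc' hc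
      · exact ih h1 h3 hc

/-- The suffix of an odd block continues after the suffix of its parent. -/
theorem q_half {h : ℕ} (h1 : 1 ≤ h) (h2 : h < 2 ^ D.K) (hn : ¬ D.cut h) :
    D.q (2 * h + 1) = D.q (2 * D.q h + 1) := by
  have hq := (H.q_spec h1 (by omega)).2.1
  -- The blocks after `2 * q h + 1` up to `2 * h + 1` are children of the blocks after `q h` up to
  -- `h`, all of them uncut.
  refine q_eq_of_noncut (by omega) fun g g1 g2 => ?_
  have hh : ¬ D.cut (g / 2) := noncut_of_q (h := h) (by omega) (by omega)
  rcases Nat.mod_two_eq_zero_or_one g with hg | hg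
  · rw [show g = 2 * (g / 2) by omega]
    exact H.noncut_even (by omega) (by omega) hh
  · rw [show g = 2 * (g / 2) + 1 by omega]
    exact H.noncut_odd (by omega) (by omega) hh

/-- On level 0 only the path boundaries cut, so the last cut before `x` is the edge that enters the
lowest position of its path. The context stored at a leaf therefore covers the whole path below `x`.
-/
theorem leaf_hi_q {x : ℕ} (h1 : 1 ≤ x) (h2 : x ≤ D.cnt) :
    D.hi (D.q (2 ^ D.K + x - 1)) = D.pid x := by
  induction x with
  | zero => omega
  | succ x ih =>
    have hK := H.cnt_le
    have hh : D.hi (2 ^ D.K + (x + 1) - 1) = x + 1 := by rw [hi_leaf (by omega)]; omega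
    have hl : D.lo (2 ^ D.K + (x + 1) - 1) = x := by rw [lo_leaf (by omega)]; omega
    have hv : D.lev (2 ^ D.K + (x + 1) - 1) = 0 := lev_leaf (by omega)
    by_cases hp : D.pid (x + 1) = x + 1
    · have hc : D.cut (2 ^ D.K + (x + 1) - 1) := by
        refine Or.inr (Or.inl ?_)
        rw [hh, hl, hp]
        rcases Nat.eq_zero_or_pos x with rfl | h0
        · rw [H.pid_out 0 (Or.inl rfl)]; omega
        · have := H.pid_pos x h0 (by omega); omega
      rw [q_cut hc, hh, hp]
    · obtain ⟨s1, s2⟩ := H.sc (x + 1) h1 h2 hp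
      have p1 := H.pid_pos (x + 1) h1 h2
      rw [Nat.add_sub_cancel] at s1 s2
      have hx : 1 ≤ x := (H.range_of_pid (x := x) (by omega)).1
      have hc : ¬ D.cut (2 ^ D.K + (x + 1) - 1) := by
        -- The grid of level 0 has width `2^m`, and all lengths lie between `2^m` and `2^(m+1)`.
        have cell0 : ∀ y, 1 ≤ y → y ≤ D.cnt → D.cell 0 y = 1 := by
          intro y y1 y2
          have hlen := H.ord.len_pos (H.mem y y1 y2)
          have a1 : 2 ^ Nat.log 2 (D.G.len (D.va y)) ≤ D.G.len (D.va y) :=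
            Nat.pow_log_le_self 2 (by omega)
          have a2 : D.G.len (D.va y) < 2 ^ (Nat.log 2 (D.G.len (D.va y)) + 1) :=
            Nat.lt_pow_succ_log_self (by omega) _
          unfold cell
          rw [pow_zero, mul_one]
          rw [pow_succ] at a2
          exact Nat.div_eq_of_lt_le (by omega) (by omega)
        unfold cut
        rw [hh, hl, hv, cell0 x hx (by omega), cell0 (x + 1) h1 h2]
        push Not
        exact ⟨by omega, s2, rfl⟩
      rw [q_noncut (by omega) hc, show 2 ^ D.K + (x + 1) - 1 - 1 = 2 ^ D.K + x - 1 by omega,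
        ih hx (by omega), s2]

end Ok

end Dat

end WhileLang

/-! ### Balanced nodes in memory -/

namespace WhileLang

/-- The record at `a` describes the string `X`: length, fingerprint, and power of the base. -/
def Rec (μ c : ℕ) (M : ℕ → ℕ) (a : ℕ) (X : List ℕ) : Prop :=
  M (a + 3) = X.length ∧ M (a + 4) = kap μ c X 0 ∧ M (a + 5) = c ^ X.length % μ

/-- The record at `a` is a pair of the records at `l` and `r`. -/
def PairAt (M : ℕ → ℕ) (a l r : ℕ) : Prop := M a = 1 ∧ M (a + 1) = l ∧ M (a + 2) = r

/-- The record at `a` in the first `S` words is the root of a well-formed structure for the string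
`X` in which every position is found at cost at most `d`. -/
inductive Node (μ c : ℕ) (M : ℕ → ℕ) (S : ℕ) : ℕ → List ℕ → ℕ → Prop
  | term {a s d : ℕ} : a + 5 < S → M a = 0 → Rec μ c M a [s] → Node μ c M S a [s] d
  -- No tag is prescribed, because a search for a position never enters the empty string.
  | empty {a d : ℕ} : a + 5 < S → Rec μ c M a [] → Node μ c M S a [] d
  | pair {a l r d e : ℕ} {X Y : List ℕ} : a + 5 < S → PairAt M a l r → Node μ c M S l X d →
      Node μ c M S r Y d → Rec μ c M a (X ++ Y) → d + 1 ≤ e → Node μ c M S a (X ++ Y) e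
  | run {a b t d e : ℕ} {X : List ℕ} : a + 5 < S → M a = 2 → M (a + 1) = b → M (a + 2) = t →
      Node μ c M S b X d → Rec μ c M a (List.replicate t X).flatten →
      d + (Nat.log 2 t + 1) ≤ e → Node μ c M S a (List.replicate t X).flatten e

theorem Node.rec_at {μ c S a d : ℕ} {M : ℕ → ℕ} {X : List ℕ} (h : Node μ c M S a X d) :
    Rec μ c M a X ∧ a + 5 < S := by
  cases h <;> exact ⟨by assumption, by assumption⟩

theorem Node.mono {μ c S a d e : ℕ} {M : ℕ → ℕ} {X : List ℕ} (h : Node μ c M S a X d)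
    (hd : d ≤ e) : Node μ c M S a X e := by
  cases h with
  | term h1 h2 h3 => exact .term h1 h2 h3
  | empty h1 h2 => exact .empty h1 h2
  | pair h1 h2 h3 h4 h5 h6 => exact .pair h1 h2 h3 h4 h5 (h6.trans hd)
  | run h1 h2 h3 h4 h5 h6 h7 => exact .run h1 h2 h3 h4 h5 h6 (h7.trans hd)

theorem Node.congr {μ c S a d : ℕ} {M M' : ℕ → ℕ} {X : List ℕ} (h : Node μ c M S a X d)
    (hM : ∀ x < S, M' x = M x) : Node μ c M' S a X d := by
  have hr : ∀ {a X}, a + 5 < S → Rec μ c M a X → Rec μ c M' a X := fun {a X} ha h =>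
    ⟨(hM _ (by omega)).trans h.1, (hM _ (by omega)).trans h.2.1, (hM _ (by omega)).trans h.2.2⟩
  induction h with
  | term h1 h2 h3 => exact .term h1 ((hM _ (by omega)).trans h2) (hr h1 h3)
  | empty h1 h3 => exact .empty h1 (hr h1 h3)
  | pair h1 h2 _ _ h5 h6 ih1 ih2 =>
    exact .pair h1 ⟨(hM _ (by omega)).trans h2.1, (hM _ (by omega)).trans h2.2.1,
      (hM _ (by omega)).trans h2.2.2⟩ ih1 ih2 (hr h1 h5) h6
  | run h1 h2 h3 h4 _ h5 h6 ih =>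
    exact .run h1 ((hM _ (by omega)).trans h2) ((hM _ (by omega)).trans h3)
      ((hM _ (by omega)).trans h4) ih (hr h1 h5) h6

/-! ### Contents of the records -/

namespace Dat

variable (D : Dat)

/-- Addresses of the record of a variable, of its auxiliary record, and of the two pairs of records of
a heap node, for its block and for the blocks after the last cut. -/
def vr (v : ℕ) : ℕ := D.VB + 64 * v
def ax (v : ℕ) : ℕ := D.VB + 64 * v + 6
def bk (h : ℕ) : ℕ := D.VB + 64 * h + 32
def sk (h : ℕ) : ℕ := D.VB + 64 * h + 44

/-- Heap nodes are numbered from 1, so the block fields of record 0 are free; they hold the empty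
string. -/
def adL (x : ℕ) : ℕ := if D.G.a1 (D.va x) = D.va (x - 1) then D.bk 0 else D.vr (D.G.a1 (D.va x))
def adR (x : ℕ) : ℕ := if D.G.a1 (D.va x) = D.va (x - 1) then D.vr (D.G.a2 (D.va x)) else D.bk 0

/-- A pair of records combines two others. -/
def CPair (M : ℕ → ℕ) (a x y : ℕ) : Prop := PairAt M a x y ∧ PairAt M (a + 6) (y + 6) (x + 6)

/-- A pair of records for the context between two positions. -/
def CRec (μ c : ℕ) (M : ℕ → ℕ) (a x y : ℕ) : Prop :=
  Rec μ c M a (D.cL x y) ∧ Rec μ c M (a + 6) (D.cR x y)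

/-- The memory contains the records for the block of `h`. -/
def BFact (μ c : ℕ) (M : ℕ → ℕ) (h : ℕ) : Prop :=
  ¬ D.cut h → CRec D μ c M (D.bk h) (D.lo h) (D.hi h) ∧
    (2 ^ D.K ≤ h → PairAt M (D.bk h) (D.adL (D.hi h)) (D.bk 0) ∧
      PairAt M (D.bk h + 6) (D.adR (D.hi h)) (D.bk 0)) ∧
    (h < 2 ^ D.K → CPair M (D.bk h) (D.bk (2 * h + 1)) (D.bk (2 * h)))

/-- Operands that build the record for the blocks after the last cut. -/
def opx (h : ℕ) : ℕ := if D.cut h then D.bk 0 else if h % 2 = 1 ∧ ¬ D.cut (h / 2) then D.sk (h / 2)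
  else D.bk h
def opy (h : ℕ) : ℕ := if D.cut h then D.bk 0 else if h % 2 = 1 ∧ ¬ D.cut (h / 2) then
  D.sk (2 * D.q (h / 2) + 1) else D.sk (h - 1)

def SFact (μ c : ℕ) (M : ℕ → ℕ) (h : ℕ) : Prop :=
  CRec D μ c M (D.sk h) (D.hi (D.q h)) (D.hi h) ∧ CPair M (D.sk h) (D.opx h) (D.opy h)

/-- Fields of the record of a variable `v` that is placed at position `x`. -/
def VFact (μ c : ℕ) (M : ℕ → ℕ) (x : ℕ) : Prop :=
  if D.pid x = x then
    (D.G.kd (D.va x) = 0 → M (D.vr (D.va x)) = 0) ∧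
    (D.G.kd (D.va x) = 1 → PairAt M (D.vr (D.va x)) (D.vr (D.G.a1 (D.va x))) (D.vr (D.G.a2 (D.va x)))) ∧
    (D.G.kd (D.va x) = 2 → M (D.vr (D.va x)) = 2 ∧ M (D.vr (D.va x) + 1) = D.vr (D.G.a1 (D.va x)) ∧
      M (D.vr (D.va x) + 2) = D.G.a2 (D.va x))
  else
    PairAt M (D.vr (D.va x)) (D.sk (2 ^ D.K + x - 1)) (D.ax (D.va x)) ∧
    PairAt M (D.ax (D.va x)) (D.vr (D.va (D.pid x))) (D.sk (2 ^ D.K + x - 1) + 6) ∧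
    Rec μ c M (D.ax (D.va x)) (D.G.str (D.va (D.pid x)) ++ D.cR (D.pid x) x)

/-- The memory after the construction. -/
structure Built (μ c : ℕ) (M : ℕ → ℕ) (S : ℕ) : Prop where
  bnd : ∀ i, i < 2 * 2 ^ D.K ∨ i < D.G.m → D.VB + 64 * i + 64 ≤ S
  rec_v : ∀ v ∈ D.l, Rec μ c M (D.vr v) (D.G.str v)
  emp : CRec D μ c M (D.bk 0) 0 0
  blk : ∀ h, 1 ≤ h → h < 2 * 2 ^ D.K → D.BFact μ c M h
  suf : ∀ h, 1 ≤ h → h < 2 * 2 ^ D.K → D.SFact μ c M h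
  var : ∀ x, 1 ≤ x → x ≤ D.cnt → D.VFact μ c M x

variable {D}

namespace Built

variable {μ c : ℕ} {M : ℕ → ℕ} {S : ℕ} (H : D.Ok) (U : D.Built μ c M S)
include U

theorem bk_lt {h : ℕ} (h2 : h < 2 * 2 ^ D.K) : D.bk h + 11 < S := by
  have := U.bnd h (Or.inl h2); unfold bk; omega
theorem sk_lt {h : ℕ} (h2 : h < 2 * 2 ^ D.K) : D.sk h + 11 < S := by
  have := U.bnd h (Or.inl h2); unfold sk; omega
theorem vr_lt {v : ℕ} (h2 : v < D.G.m) : D.vr v + 11 < S := by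
  have := U.bnd v (Or.inr h2); unfold vr; omega

theorem node_emp (d : ℕ) : Node μ c M S (D.bk 0) [] d ∧ Node μ c M S (D.bk 0 + 6) [] d := by
  have h1 := U.bk_lt (h := 0) (by positivity)
  have h2 := U.emp
  rw [CRec, cL_self, cR_self] at h2
  exact ⟨.empty (by omega) h2.1, .empty (by omega) h2.2⟩

end Built

/-- A pair of nodes for the context between two positions. -/
def CNode (D : Dat) (μ c : ℕ) (M : ℕ → ℕ) (S a x y d : ℕ) : Prop :=
  Node μ c M S a (D.cL x y) d ∧ Node μ c M S (a + 6) (D.cR x y) d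

/-- Contexts compose outwards: on the left the outer part comes first, on the right the inner part.
This is why `CPair` swaps its operands in the second record. -/
theorem CNode.comp {μ c S a b b' x y z d e : ℕ} {M : ℕ → ℕ} (ha : a + 11 < S) (h1 : x ≤ y)
    (h2 : y ≤ z) (hr : CRec D μ c M a x z) (hp : CPair M a b b') (n1 : CNode D μ c M S b y z d)
    (n2 : CNode D μ c M S b' x y d) (he : d + 1 ≤ e) : CNode D μ c M S a x z e := by
  unfold CRec at hr
  unfold CNode
  rw [D.cL_trans h1 h2, D.cR_trans h1 h2] at hr ⊢
  exact ⟨.pair (by omega) hp.1 n1.1 n2.1 hr.1 he, .pair (by omega) hp.2 n2.2 n1.2 hr.2 he⟩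

/-! ### Costs of the contexts on one path -/

namespace Built

variable {μ c : ℕ} {M : ℕ → ℕ} {S : ℕ} (H : D.Ok) (U : D.Built μ c M S)
include H U

omit H in
theorem node_cut {h : ℕ} (h1 : 1 ≤ h) (h2 : h < 2 * 2 ^ D.K) (hc : D.cut h) (d : ℕ) :
    CNode D μ c M S (D.sk h) (D.hi (D.q h)) (D.hi h) d := by
  have h3 := (U.suf h h1 h2).1
  have h4 := U.sk_lt h2
  unfold CNode
  unfold CRec at h3
  rw [Ok.q_cut hc, cL_self, cR_self] at h3 ⊢
  exact ⟨.empty (by omega) h3.1, .empty (by omega) h3.2⟩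

variable {t m B : ℕ} (ht : t ≠ 0) (hm : m = Nat.log 2 (D.G.len (D.va t)))
  (hit : ∀ x e, D.pid x = t → x ≠ t →
    8 * Nat.log 2 (D.G.len (D.va x) - D.G.len (D.va (x - 1))) + B ≤ e →
    Node μ c M S (D.adL x) (D.itL x) e ∧ Node μ c M S (D.adR x) (D.itR x) e)
include ht hm hit

omit U hit in
theorem log_path {x : ℕ} (hx : D.pid x = t) : Nat.log 2 (D.G.len (D.va x)) = m := by
  rw [hm]
  have h0 := H.range_of_pid (x := x) (by omega)
  have h1 := H.pid_pos x h0.1 h0.2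
  have h2 := H.pid_mid (y := x) (x := t) (by omega) (by omega) (by omega)
  exact (H.log_eq (by omega) h2 (by omega)).symm

/-- By `hit`, a sibling of length `s` on the path ending at `t` costs `8 * log s + B`. Here `L` is
the level of an enclosing uncut block, so all siblings together are shorter than `2^(m-L)`, and each
costs at most `8 * (m - L - 1) + B`. The `n` levels below `h` add `n`, and the leaf, which pairs the
sibling with the empty string, adds 1. -/
theorem node_blk {L : ℕ} (hL : L < m) : ∀ n h d, 1 ≤ h → h < 2 * 2 ^ D.K → D.lev h = n →
    ¬ D.cut h → D.pid (D.hi h) = t →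
    (D.G.len (D.va (D.hi h)) - D.G.len (D.va (D.lo h))) * 2 ^ L < 2 ^ m →
    n + 8 * m + B ≤ d + 7 + 8 * L → CNode D μ c M S (D.bk h) (D.lo h) (D.hi h) d := by
  intro n
  induction n with
  | zero =>
    intro h d h1 h2 hl hn hp hlen hd
    obtain ⟨b1, b2, b3⟩ := U.blk h h1 h2 hn
    obtain ⟨n1, n2, n3⟩ := Ok.noncut_pid hn
    have hleaf : 2 ^ D.K ≤ h := by
      have := log_le_K (D := D) h1 h2
      rw [show D.K = Nat.log 2 h by unfold lev at hl; omega]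
      exact Nat.pow_log_le_self 2 (by omega)
    obtain ⟨p1, p2⟩ := b2 hleaf
    have hhi : D.hi h = D.lo h + 1 := by rw [hi, hl]; rfl
    have hlow := H.range_of_pid n1
    have htlo := H.pid_pos (D.lo h) hlow.1 hlow.2
    have hw : 8 * Nat.log 2 (D.G.len (D.va (D.hi h)) - D.G.len (D.va (D.hi h - 1))) + B ≤ d - 1 := by
      rw [hhi, Nat.add_sub_cancel, ← hhi]
      set w := D.G.len (D.va (D.hi h)) - D.G.len (D.va (D.lo h)) with hwdef
      have hw0 : w ≠ 0 := by
        have := H.len_le n1 n2 (by omega)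
        omega
      have h3 : w < 2 ^ (m - L) := by
        have : 2 ^ m = 2 ^ (m - L) * 2 ^ L := by rw [← pow_add]; congr 1; omega
        rw [this] at hlen
        exact lt_of_mul_lt_mul_right hlen (Nat.zero_le _)
      have := Nat.log_lt_of_lt_pow hw0 h3
      omega
    obtain ⟨i1, i2⟩ := hit (D.hi h) (d - 1) hp (by omega) hw
    have hS := U.bk_lt h2
    have hE := U.node_emp (d - 1)
    have hd1 : d - 1 + 1 ≤ d := by omega
    unfold CNode
    unfold CRec at b1
    rw [hhi, cL_succ, cR_succ, ← hhi] at b1 ⊢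
    have e1 := Node.pair (X := D.itL (D.hi h)) (Y := []) (by omega) p1 i1 hE.1
      (by rw [List.append_nil]; exact b1.1) hd1
    have e2 := Node.pair (X := D.itR (D.hi h)) (Y := []) (by omega) p2 i2 hE.1
      (by rw [List.append_nil]; exact b1.2) hd1
    rw [List.append_nil] at e1 e2
    exact ⟨e1, e2⟩
  | succ n ih =>
    intro h d h1 h2 hl hn hp hlen hd
    have hin : h < 2 ^ D.K := by
      by_contra hc
      rw [lev_leaf (by omega)] at hl
      omega
    obtain ⟨b1, b2, b3⟩ := U.blk h h1 h2 hn
    obtain ⟨n1, n2, n3⟩ := Ok.noncut_pid hn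
    have l1 := lo_even (D := D) h1 hin
    have l2 := lo_odd (D := D) h1 hin
    have l3 := hi_odd (D := D) h1 hin
    have l4 := lev_even (D := D) h1 hin
    have l5 := lev_odd (D := D) h1 hin
    have l6 := lo_lt_hi (D := D) (2 * h)
    have l7 := lo_lt_hi (D := D) (2 * h + 1)
    have p := H.pid_between n1 n2 (z := D.hi (2 * h)) (by omega) (by omega)
    have q1 := H.len_le n1 (n2.trans p.symm) (by omega)
    have q2 := H.len_le (x := D.hi (2 * h)) (by rw [p, ← n2]; exact n1) p (by omega)
    refine CNode.comp (U.bk_lt h2) (y := D.hi (2 * h)) (by omega) (by omega) b1 (b3 hin)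
      (d := d - 1) ?_ ?_ (by omega)
    · have := ih (2 * h + 1) (d - 1) (by omega) (by omega) (by omega) (H.noncut_odd h1 hin hn)
        (by rw [l3]; exact hp) (lt_of_le_of_lt (Nat.mul_le_mul_right _ (by rw [l3, l2]; omega)) hlen)
        (by omega)
      rwa [l3, l2] at this
    · have := ih (2 * h) (d - 1) (by omega) (by omega) (by omega) (H.noncut_even h1 hin hn)
        (by rw [p]; exact hp) (lt_of_le_of_lt (Nat.mul_le_mul_right _ (by rw [l1]; omega)) hlen)
        (by omega)
      rwa [l1] at this

omit U hit in
-- An uncut block has positive weight, but less than `2^m / 2^lev`. So the subtractions in the cost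
-- bounds are genuine.
theorem lev_lt {h : ℕ} (hn : ¬ D.cut h) (hp : D.pid (D.hi h) = t) : D.lev h < m := by
  obtain ⟨n1, n2, n3⟩ := Ok.noncut_pid hn
  have hl := lo_lt_hi (D := D) h
  have h3 := H.diff_lt n1 n2 hl.le n3
  have h4 := H.len_le n1 n2 hl.le
  rw [log_path H ht hm hp] at h3
  by_contra hc
  have h7 : 2 ^ m ≤ 2 ^ D.lev h := Nat.pow_le_pow_right (by omega) (by omega)
  have h8 : 1 * 2 ^ D.lev h ≤
    (D.G.len (D.va (D.hi h)) - D.G.len (D.va (D.lo h))) * 2 ^ D.lev h :=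
    Nat.mul_le_mul_right _ (by omega)
  omega

/-- The case `L = lev h`: one level up costs 7 less, since the height grows by 1 while the bound for
a sibling drops by 8. -/
theorem node_blk' {h d : ℕ} (h1 : 1 ≤ h) (h2 : h < 2 * 2 ^ D.K) (hn : ¬ D.cut h)
    (hp : D.pid (D.hi h) = t) (hd : 8 * m + B ≤ d + 7 * D.lev h + 7) :
    CNode D μ c M S (D.bk h) (D.lo h) (D.hi h) d := by
  obtain ⟨n1, n2, n3⟩ := Ok.noncut_pid hn
  have hl := lo_lt_hi (D := D) h
  have h3 := H.diff_lt n1 n2 hl.le n3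
  have h4 := H.len_le n1 n2 hl.le
  have h5 := log_path H ht hm hp
  rw [h5] at h3
  have h6 := lev_lt H ht hm hn hp
  exact node_blk H U ht hm hit h6 (D.lev h) h d h1 h2 rfl hn hp h3 (by omega)

/-- Excess of the cost of a heap node over that of the blocks it is made of. -/
theorem node_suf : ∀ h d, 1 ≤ h → h < 2 * 2 ^ D.K → D.pid (D.hi h) = t →
    8 * m + B + 1 + (4 * (D.cell (D.lev h + 1) (D.hi h) % 2) +
      (if h % 2 = 0 then 3 else if D.cut (h / 2) then 1 else 2)) ≤ d + 7 * D.lev h + 7 →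
    CNode D μ c M S (D.sk h) (D.hi (D.q h)) (D.hi h) d := by
  intro h
  -- Beyond the cost that falls by 7 per level, the excess is 4 if `hi h` lies in the upper half of
  -- its cell, plus 3 for an even `h`, 1 for an odd `h` with cut parent, and 2 otherwise. It is at
  -- most 7, exactly what one level frees. The order of these ranks follows the order in which the
  -- cases call each other.
  induction h using Nat.strong_induction_on with
  | _ h ih =>
    intro d h1 h2 hp hd
    by_cases hc : D.cut h
    · exact node_cut U h1 h2 hc d
    obtain ⟨n1, n2, n3⟩ := Ok.noncut_pid hc
    obtain ⟨r1, r2, r3⟩ := H.prev h1 h2 hc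
    obtain ⟨sr, sp⟩ := U.suf h h1 h2
    have hS := U.sk_lt h2
    have hlt := lo_lt_hi (D := D) h
    have hqh := H.q_spec h1 h2
    have hqn := hqh.2.2.2.2.2 hc
    simp only [opx, opy, if_neg hc] at sp
    have h6 := lev_lt H ht hm hc hp
    have hd1 : d - 1 + 1 ≤ d := by split_ifs at hd <;> omega
    by_cases hodd : h % 2 = 1 ∧ ¬ D.cut (h / 2)
    · rw [if_pos hodd, if_pos hodd] at sp
      obtain ⟨ho, hc2⟩ := hodd
      rw [if_neg (by omega), if_neg hc2] at hd
      set g := h / 2 with hg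
      have hg1 : 1 ≤ g := by
        rcases Nat.eq_zero_or_pos g with h0 | h0
        · have : h = 1 := by omega
          rw [this] at r1; omega
        · exact h0
      have hgK : g < 2 ^ D.K := by omega
      have hh : h = 2 * g + 1 := by omega
      have e1 : D.hi h = D.hi g := by rw [hh]; exact hi_odd hg1 hgK
      have e2 : D.lev h + 1 = D.lev g := by rw [hh]; exact lev_odd hg1 hgK
      obtain ⟨s1, s2, s3, s4, s5, s6⟩ := H.q_spec hg1 (by omega : g < 2 * 2 ^ D.K)
      obtain ⟨t1, t2, t3, t4, t5⟩ := s6 hc2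
      have e3 : D.q h = D.q (2 * D.q g + 1) := by rw [hh]; exact H.q_half hg1 hgK hc2
      have e4 : D.hi (2 * D.q g + 1) = D.hi (D.q g) := hi_odd s1 (by omega)
      have e5 : D.lev (2 * D.q g + 1) + 1 = D.lev (D.q g) := lev_odd s1 (by omega)
      -- The parent is one level up, so its whole excess of at most 7 is covered.
      have c1 := ih g (by omega) (d - 1) hg1 (by omega) (by rw [← e1]; exact hp) (by
        have : D.cell (D.lev g + 1) (D.hi g) % 2 < 2 := Nat.mod_lt _ (by omega)
        split_ifs <;> omega)
      -- The remainder stays on the level of `h`, in the same cell of the finer grid, so its parity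
      -- is that of `h`. Its parent is the last cut `q g`, so its rank is 1 instead of 2.
      have c2 := ih (2 * D.q g + 1) (by omega) (d - 1) (by omega) (by omega)
        (by rw [e4, t3, ← e1]; exact hp) (by
        rw [if_neg (by omega), if_pos (by rw [show (2 * D.q g + 1) / 2 = D.q g by omega]; exact s4),
          e5, e4, s3, t5, ← e2, ← e1]
        have e6 : D.lev (2 * D.q g + 1) = D.lev h := by omega
        rw [e6]
        omega)
      rw [← e1] at c1 s5
      rw [← e3, e4] at c2
      have le1 : D.hi (D.q h) ≤ D.hi (D.q g) := by
        rw [e3, ← e4]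
        exact (H.q_spec (by omega) (by omega)).2.2.2.2.1
      exact CNode.comp hS le1 s5 sr sp c1 c2 hd1
    · rw [if_neg hodd, if_neg hodd] at sp
      have hq1 : D.q h = D.q (h - 1) := Ok.q_noncut h1 hc
      have hb : ∀ e, d ≤ e + 1 → CNode D μ c M S (D.bk h) (D.lo h) (D.hi h) e := fun e he =>
        node_blk' H U ht hm hit h1 h2 hc hp (by split_ifs at hd <;> omega)
      suffices c2 : CNode D μ c M S (D.sk (h - 1)) (D.hi (D.q (h - 1))) (D.hi (h - 1)) (d - 1) by
        rw [← hq1, r3] at c2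
        exact CNode.comp hS hqn.2.2.2.1 hlt.le sr sp (hb _ (by omega)) c2 hd1
      by_cases hc1 : D.cut (h - 1)
      · exact node_cut U r1 (by omega) hc1 _
      have hpr : D.pid (D.hi (h - 1)) = t := by rw [r3, n2]; exact hp
      by_cases he : h % 2 = 0
      -- For even `h` the neighbour is odd and has rank at most 2 instead of 3. The parity cannot
      -- grow to the left within the cell that the uncut block `h` stays in.
      · refine ih (h - 1) (by omega) (d - 1) r1 (by omega) hpr ?_
        rw [if_pos he] at hd
        rw [r2, r3]
        have m1 := H.cell_mono (D.lev h + 1) n1 n2 hlt.le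
        have m2 := Ok.cell_half (D := D) (D.lev h) (D.lo h)
        have m3 := Ok.cell_half (D := D) (D.lev h) (D.hi h)
        split_ifs <;> omega
      · have hcg : D.cut (h / 2) := by
          by_contra hcc; exact hodd ⟨by omega, hcc⟩
        set g := h / 2 with hg
        have hh : h = 2 * g + 1 := by omega
        have hg1 : 1 ≤ g := by omega
        have hgK : g < 2 ^ D.K := by omega
        have e1 : D.hi h = D.hi g := by rw [hh]; exact hi_odd hg1 hgK
        have e2 : D.lev h + 1 = D.lev g := by rw [hh]; exact lev_odd hg1 hgK
        have e3 : D.lo (h - 1) = D.lo g := by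
          rw [show h - 1 = 2 * g by omega]; exact lo_even hg1 hgK
        obtain ⟨k1, k2, k3⟩ := Ok.noncut_pid hc1
        rw [r3] at k2
        rw [r2, r3] at k3
        have hlt1 := lo_lt_hi (D := D) (h - 1)
        rw [r3] at hlt1
        -- Both halves of the parent are uncut but the parent is cut; the path does not change, so
        -- only the finer grid can separate its ends. Within one cell this means a step from the
        -- lower to the upper half.
        have par : D.cell (D.lev h + 1) (D.hi h) % 2 = 1 ∧
            D.cell (D.lev h + 1) (D.lo (h - 1)) % 2 = 0 := by
          have x1 : D.cell (D.lev g) (D.lo g) ≠ D.cell (D.lev g) (D.hi g) := by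
            rcases hcg with y | y | y
            · exact absurd y (by rw [← e1, ← n2]; exact n1)
            · exact absurd (k2.trans n2) (by rw [e3, e1]; exact y)
            · exact y
          rw [← e1, ← e2, ← e3] at x1
          have m1 := H.cell_mono (D.lev h + 1) k1 (k2.trans n2) (by omega)
          have m2 := Ok.cell_half (D := D) (D.lev h) (D.lo (h - 1))
          have m3 := Ok.cell_half (D := D) (D.lev h) (D.hi h)
          omega
        rw [if_neg he, if_pos hcg, par.1] at hd
        obtain ⟨w1, w2, w3⟩ := H.prev r1 (by omega) hc1
        obtain ⟨sr', sp'⟩ := U.suf (h - 1) r1 (by omega)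
        have hne : ¬ ((h - 1) % 2 = 1 ∧ ¬ D.cut ((h - 1) / 2)) := fun hx => by omega
        simp only [opx, opy, if_neg hc1, if_neg hne] at sp'
        have hq2 : D.q (h - 1) = D.q (h - 1 - 1) := Ok.q_noncut r1 hc1
        have hqn1 := (H.q_spec r1 (by omega)).2.2.2.2.2 hc1
        -- Here two blocks are peeled off. The parity falls to 0, so the excess goes from 5 to at
        -- most 2, which pays for both compositions.
        have b1 := node_blk' H U ht hm hit (h := h - 1) (d := d - 2) r1 (by omega) hc1 hpr
          (by rw [r2]; omega)
        have c3 : CNode D μ c M S (D.sk (h - 1 - 1)) (D.hi (D.q (h - 1 - 1))) (D.hi (h - 1 - 1))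
            (d - 2) := by
          by_cases hc3 : D.cut (h - 1 - 1)
          · exact node_cut U w1 (by omega) hc3 _
          · refine ih (h - 1 - 1) (by omega) (d - 2) w1 (by omega)
              (by rw [w3, k2, n2]; exact hp) ?_
            rw [w2, w3, r2, par.2]
            split_ifs <;> omega
        rw [← hq2, w3] at c3
        exact CNode.comp (U.sk_lt (by omega)) hqn1.2.2.2.1 (lo_lt_hi _).le sr' sp' b1 c3 (by omega)

end Built

namespace Built

variable {μ c : ℕ} {M : ℕ → ℕ} {S : ℕ} (H : D.Ok) (U : D.Built μ c M S)
include H U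

/-- All variables have nodes of small cost. -/
theorem node_var : ∀ n v, v ∈ D.l → D.G.pot D.l v = n →
    ∀ d, 8 * Nat.log 2 (D.G.len v) + 3 * D.G.pot D.l v + 1 ≤ d →
      Node μ c M S (D.vr v) (D.G.str v) d := by
  intro n
  induction n using Nat.strong_induction_on with
  | _ n ih =>
    -- variables at the end of their path
    have ends : ∀ v x, v ∈ D.l → D.G.pot D.l v ≤ n → 1 ≤ x → x ≤ D.cnt → D.va x = v → D.pid x = x →
        ∀ d, 8 * Nat.log 2 (D.G.len v) + 3 * (D.G.pot D.l v - 1) + 2 ≤ d ∨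
          (8 * Nat.log 2 (D.G.len v) + 3 * D.G.pot D.l v + 1 ≤ d) →
        Node μ c M S (D.vr v) (D.G.str v) d := by
      intro v x hv hn h1 h2 hx hp d hd
      have hvm := H.ord.lt hv
      have hf := U.var x h1 h2
      have hr := U.rec_v v hv
      have hS := U.vr_lt hvm
      have hch : ∀ X, D.G.Ch v X → X ∈ D.l ∧ D.G.pot D.l X < n ∧ D.G.pot D.l X < D.G.pot D.l v := by
        intro X hc
        have hlt := H.ord.pot_lt hv hc (by rw [← hx]; exact H.bot x h1 h2 hp X)
        exact ⟨H.ord.ch_mem hv hc, by omega, hlt⟩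
      rw [VFact, if_pos hp, hx] at hf
      have hk := D.G.kd_le v hvm
      interval_cases hkd : D.G.kd v
      · have hs := D.G.term v hvm hkd
        rw [hs] at hr ⊢
        exact .term (by omega) (hf.1 rfl) hr
      · obtain ⟨-, -, hs⟩ := D.G.pair v hvm hkd
        obtain ⟨b1, b2, b3⟩ := hch (D.G.a1 v) (Or.inl ⟨hkd, Or.inl rfl⟩)
        obtain ⟨c1, c2, c3⟩ := hch (D.G.a2 v) (Or.inl ⟨hkd, Or.inr rfl⟩)
        have hl := Gram.len_pair hvm hkd
        have l1 : Nat.log 2 (D.G.len (D.G.a1 v)) ≤ Nat.log 2 (D.G.len v) :=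
          Nat.log_mono_right (by omega)
        have l2 : Nat.log 2 (D.G.len (D.G.a2 v)) ≤ Nat.log 2 (D.G.len v) :=
          Nat.log_mono_right (by omega)
        rw [hs] at hr ⊢
        exact .pair (by omega) (hf.2.1 rfl) (ih _ b2 _ b1 rfl (d - 1) (by omega))
          (ih _ c2 _ c1 rfl (d - 1) (by omega)) hr (by omega)
      · obtain ⟨-, ht3, hs⟩ := D.G.run v hvm hkd
        obtain ⟨b1, b2, b3⟩ := hch (D.G.a1 v) (Or.inr ⟨hkd, rfl⟩)
        have hl := Gram.len_run hvm hkd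
        have hl1 := H.ord.len_pos b1
        -- The length is multiplied by the exponent, so the cost `log t` of a run node is paid by
        -- the drop of `8 * log len`.
        have l1 : Nat.log 2 (D.G.len (D.G.a1 v)) + Nat.log 2 (D.G.a2 v) ≤ Nat.log 2 (D.G.len v) := by
          refine Nat.le_log_of_pow_le (by omega) ?_
          rw [pow_add, hl, mul_comm]
          exact Nat.mul_le_mul (Nat.pow_log_le_self 2 (by omega)) (Nat.pow_log_le_self 2 (by omega))
        rw [hs] at hr ⊢
        obtain ⟨f1, f2, f3⟩ := hf.2.2 rfl
        exact .run (by omega) f1 f2 f3 (ih _ b2 _ b1 rfl (d - (Nat.log 2 (D.G.a2 v) + 1)) (by omega))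
          hr (by omega)
    intro v hv hn d hd
    obtain ⟨x, h1, h2, hx⟩ := H.surj v hv
    by_cases hp : D.pid x = x
    · exact ends v x hv hn.le h1 h2 hx hp d (Or.inr hd)
    have hpp := H.pid_pos x h1 h2
    set t := D.pid x with ht
    have ht0 : t ≠ 0 := by omega
    have hK := H.cnt_le
    have hpt : D.pid t = t := H.pid_mid (y := x) (by omega) (by omega) (by omega)
    have hlt := H.len_le (x := t) (y := x) (by omega) (by omega) (by omega)
    have hlog := H.log_eq (x := t) (y := x) (by omega) (by omega) (by omega)
    have hpot := H.pot_eq (x := t) (y := x) (by omega) (by omega) (by omega)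
    rw [hx] at hlt hlog hpot
    -- the potential on this path is positive
    have hpos : 1 ≤ D.G.pot D.l v ∧ 1 ≤ Nat.log 2 (D.G.len v) := by
      have h3 : 2 ≤ D.G.len v := by
        have := H.ord.len_pos (H.mem t (by omega) (by omega))
        omega
      have : 1 ≤ Nat.log 2 (D.G.len v) := Nat.le_log_of_pow_le (by omega) (by omega)
      unfold Gram.pot
      omega
    -- A sibling leaves the path along an edge that is not symmetric centroid, so it has smaller
    -- potential and the induction hypothesis gives its cost, with `B = 3 * (pot - 1) + 1`.
    have hit : ∀ y e, D.pid y = t → y ≠ t →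
        8 * Nat.log 2 (D.G.len (D.va y) - D.G.len (D.va (y - 1))) +
          (3 * (D.G.pot D.l v - 1) + 1) ≤ e →
        Node μ c M S (D.adL y) (D.itL y) e ∧ Node μ c M S (D.adR y) (D.itR y) e := by
      intro y e hy hyt he
      have hyr := H.range_of_pid (x := y) (by omega)
      have hyp := H.pid_pos y hyr.1 hyr.2
      obtain ⟨s1, s2⟩ := H.sc y hyr.1 hyr.2 (by omega)
      have hym := H.mem y hyr.1 hyr.2
      have hylt := H.ord.lt hym
      have hkk := H.ord.sc_kd hym s1
      have hypot := H.pot_eq (x := t) (y := y) (by omega) (by omega) (by omega)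
      have hl := Gram.len_pair hylt hkk.1
      have sib : ∀ X, (X = D.G.a1 (D.va y) ∨ X = D.G.a2 (D.va y)) → X ≠ D.va (y - 1) →
          D.G.len X = D.G.len (D.va y) - D.G.len (D.va (y - 1)) →
          Node μ c M S (D.vr X) (D.G.str X) e := by
        intro X hX hne hlX
        have hc : D.G.Ch (D.va y) X := Or.inl ⟨hkk.1, hX⟩
        have hpl := H.ord.pot_lt hym hc fun hsc => hne (H.ord.sc_child_unique hym hsc s1)
        refine ih _ (by omega) X (H.ord.ch_mem hym hc) rfl e ?_
        rw [hlX]; omega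
      have hn1 := hkk.2
      unfold adL adR itL itR
      by_cases hh : D.G.a1 (D.va y) = D.va (y - 1)
      · rw [if_pos hh, if_pos hh, if_pos hh, if_pos hh]
        rw [hh] at hl
        exact ⟨(U.node_emp e).1, sib _ (Or.inr rfl) (by rw [← hh]; exact fun h => hn1 h.symm)
          (by omega)⟩
      · rw [if_neg hh, if_neg hh, if_neg hh, if_neg hh]
        have h2' : D.va (y - 1) = D.G.a2 (D.va y) := by
          rcases s1.1 with ⟨_, h | h⟩ | ⟨h, _⟩
          · exact absurd h.symm hh
          · exact h
          · omega
        rw [← h2'] at hl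
        exact ⟨sib _ (Or.inl rfl) hh (by omega), (U.node_emp e).1⟩
    have hh : D.hi (2 ^ D.K + x - 1) = x := by rw [hi_leaf (by omega)]; omega
    have hleaf := H.leaf_hi_q h1 h2
    have hlv : D.lev (2 ^ D.K + x - 1) = 0 := lev_leaf (by omega)
    -- On level 0 with excess at most 7, the contexts cost at most `8 * log len + 3 * pot - 1`. The
    -- missing 2 are for the two pair nodes that join the left context, the string of the path's
    -- end, and the right context.
    have hsuf := node_suf H U ht0 hlog.symm hit (2 ^ D.K + x - 1) (d - 2) (by omega) (by omega)
      (by rw [hh]) (by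
        rw [hlv]
        have := Nat.mod_lt (D.cell (0 + 1) (D.hi (2 ^ D.K + x - 1))) (show 2 > 0 by omega)
        split_ifs <;> omega)
    rw [hleaf, hh, ← ht] at hsuf
    have hend := ends (D.va t) t (H.mem t (by omega) (by omega)) (by omega) (by omega) (by omega) rfl
      hpt (d - 2) (Or.inl (by omega))
    have hf := U.var x h1 h2
    rw [VFact, if_neg hp, hx, ← ht] at hf
    obtain ⟨f1, f2, f3⟩ := hf
    have hr := U.rec_v v hv
    have hS := U.vr_lt (H.ord.lt hv)
    have hstr := H.str_chain (x := t) (y := x) (by omega) (by omega) (by omega)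
    rw [hx, List.append_assoc] at hstr
    rw [hstr] at hr ⊢
    have hS' : D.ax v + 5 < S := by unfold vr at hS; unfold ax; omega
    exact .pair (by omega) f1 (hsuf.1.mono (by omega))
      (.pair hS' f2 hend hsuf.2 f3 (by omega : d - 2 + 1 ≤ d - 1)) hr (by omega)

end Built

end Dat

end WhileLang

/-! ### Queries -/

namespace WhileLang

open Ex St

/-- Residue of the base. -/
def cres (μ sg ca : ℕ) : ℕ := if sg = 1 then (μ - ca % μ) % μ else ca % μ

/-- Load the modulus, the residue of the base, and the address of the records. -/
def hdr : St := .asg 2 (ld 0) ;;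
  .ite (.eq (ld 1) 1) (.asg 3 ((r 2 - ld 2 % r 2) % r 2)) (.asg 3 (ld 2 % r 2)) ;;
  .asg 4 (3 * ld 3 + 5)

theorem hdr_spec {w μ sg ca m : ℕ} {Q : ℕ → HS → Prop} {h : HS} (hμ : 2 ≤ μ) (hB : μ * μ ≤ 2 ^ w)
    (hm : 3 * m + 5 < 2 ^ w) (h0 : h.m 0 = μ) (h1 : h.m 1 = sg) (h2 : h.m 2 = ca) (h3 : h.m 3 = m)
    (hQ : ∀ t v, (∀ x, x < 2 ∨ 4 < x → v x = h.v x) → v 2 = μ → v 3 = cres μ sg ca →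
      v 4 = 5 + 3 * m → t ≤ 40 → Q t ⟨v, h.m⟩) : WP w hdr Q h := by
  have b4 : ∀ x, x % μ < μ := fun x => Nat.mod_lt _ (by omega)
  have b5 : μ < 2 ^ w := by nlinarith
  have b6 := fun x => (b4 x).trans b5
  refine sym.sound _ ?_
  simp only [hdr, sym, tst_simps, ok_simps, ex_simps, cost_simps, reduceIte, Nat.reduceEqDiff, h0,
    h1, h2, h3]
  refine ⟨by omega, by omega, ⟨by omega, by omega⟩, fun hs => ⟨by omega, ⟨by have := b6 ca; omega, by omega, b6 _⟩,
    by omega, ⟨by omega, by omega, by omega⟩, ?_⟩, fun hs => ⟨by omega, ⟨by omega, by omega, b6 _⟩,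
    by omega, ⟨by omega, by omega, by omega⟩, ?_⟩⟩
  all_goals
    refine hQ _ _ (fun x hx => ?_) ?_ ?_ ?_ ?_
    · simp only [HS.set, show x ≠ 2 by omega, show x ≠ 3 by omega, show x ≠ 4 by omega, reduceIte]
    · simp [HS.set]
    · simp [HS.set, cres, hs]
    · simp [HS.set, add_comm]
    · norm_num

/-- Move from the node `r10` to a leaf, and collect in `r12` the fingerprint of the suffix that starts
at offset `r11`, followed by a string with fingerprint `r12`. -/
def desc : St := .asg 13 (ld (r 10)) ;;
  .loop (.lt 0 (r 13))
    (.ite (.eq (r 13) 1)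
      (.asg 14 (ld (r 10 + 1)) ;; .asg 15 (ld (r 10 + 2)) ;;
        .ite (.lt (r 11) (ld (r 14 + 3)))
          (.asg 12 ((ld (r 15 + 4) + ld (r 15 + 5) * r 12) % r 2) ;; .asg 10 (r 14))
          (.asg 11 (r 11 - ld (r 14 + 3)) ;; .asg 10 (r 15)))
      (.asg 14 (ld (r 10 + 1)) ;; .asg 40 (ld (r 14 + 4)) ;; .asg 41 (ld (r 14 + 5)) ;;
        .asg 42 (ld (r 10 + 2) - 1 - r 11 / ld (r 14 + 3)) ;; .asg 43 (r 12) ;; .call affpow ;;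
        .asg 12 (r 43) ;; .asg 11 (r 11 % ld (r 14 + 3)) ;; .asg 10 (r 14)) ;;
    .asg 13 (ld (r 10))) ;;
  .asg 12 ((ld (r 10 + 4) + ld (r 10 + 5) * r 12) % r 2)

/-- A suffix of a run is a suffix of one copy followed by whole copies: the descent enters a single
copy, and `affpow` treats the rest. -/
theorem drop_replicate (Y : List ℕ) (hY : 0 < Y.length) : ∀ t x, x < t * Y.length →
    ((List.replicate t Y).flatten).drop x =
      Y.drop (x % Y.length) ++ (List.replicate (t - 1 - x / Y.length) Y).flatten := by
  intro t
  induction t with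
  | zero => intro x hx; omega
  | succ t ih =>
    intro x hx
    rw [List.replicate_succ, List.flatten_cons]
    rcases Nat.lt_or_ge x Y.length with h | h
    · rw [List.drop_append_of_le_length h.le, Nat.mod_eq_of_lt h, Nat.div_eq_of_lt h]
      simp
    · rw [Nat.succ_mul] at hx
      obtain ⟨y, rfl⟩ := Nat.exists_eq_add_of_le h
      rw [List.drop_append, List.drop_eq_nil_of_le (by omega), List.nil_append,
        show Y.length + y - Y.length = y by omega, ih y (by omega),
        Nat.add_mod_left, Nat.add_div_left y hY]
      rw [show t + 1 - 1 - (y / Y.length + 1) = t - 1 - y / Y.length by omega]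

theorem kap_term (μ c a y : ℕ) : kap μ c [a] y = (kap μ c [a] 0 + c ^ [a].length % μ * y) % μ := by
  simp [kap, Nat.add_mod, Nat.mul_mod]

/-- Invariant: the suffix of the current node from the current offset, followed by the string
accumulated so far, has the wanted fingerprint. Entering a left part prepends the right part to that
string by its affine map; entering a right part forgets the left one; a run prepends the later
copies. A unit of cost pays for 200 steps, and a run has `log t + 1` units for `affpow`. -/
theorem desc_spec {w μ c S d : ℕ} {X : List ℕ} {Q : ℕ → HS → Prop} {h : HS} (hμ : 2 ≤ μ)
    (hB : μ * μ ≤ 2 ^ w) (hS : S ≤ 2 ^ w) (hX : X.length < 2 ^ w) (h2 : h.v 2 = μ)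
    (hn : Node μ c h.m S (h.v 10) X d) (hx : h.v 11 < X.length) (hF : h.v 12 < μ)
    (hQ : ∀ t v, (∀ x < 10, v x = h.v x) → v 12 = kap μ c (X.drop (h.v 11)) (h.v 12) →
      t ≤ 300 * (d + 1) → Q t ⟨v, h.m⟩) : WP w desc Q h := by
  have b4 : ∀ x, x % μ < μ := fun x => Nat.mod_lt _ (by omega)
  have b5 : μ < 2 ^ w := by nlinarith
  have b6 := fun x => (b4 x).trans b5
  have b7 : ∀ {a Y}, Rec μ c h.m a Y → h.m (a + 4) < μ ∧ h.m (a + 5) < μ := fun {a Y} hr => by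
    rw [hr.2.1, hr.2.2]; exact ⟨kap_lt _ _ (by omega), b4 _⟩
  refine sym.sound _ ?_
  simp only [desc, sym, ok_simps, ex_simps, cost_simps]
  refine ⟨by omega, by omega, ?_⟩
  refine WP.loop (fun t g => g.m = h.m ∧ (∀ x < 10, g.v x = h.v x) ∧ g.v 13 = h.m (g.v 10) ∧
    g.v 12 < μ ∧ ∃ Y e, Node μ c h.m S (g.v 10) Y e ∧ g.v 11 < Y.length ∧ Y.length ≤ X.length ∧
      kap μ c (Y.drop (g.v 11)) (g.v 12) = kap μ c (X.drop (h.v 11)) (h.v 12) ∧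
      t + 200 * e ≤ 200 * d) (200 * d) ?_ ?_ ?_ ?_ ?_
  · intro t g _
    simp only [tst_simps, ok_simps]; omega
  · rintro t g ⟨-, -, -, -, Y, e, -, -, -, -, ht⟩
    omega
  · rintro t g ⟨gm, gx, g13, g12, Y, e, hY, g11, hYX, hk, ht⟩ hb
    have g2 : g.v 2 = μ := (gx 2 (by omega)).trans h2
    simp only [tst_simps, ex_simps] at hb
    refine sym.sound _ ?_
    generalize ha : g.v 10 = a at *
    cases hY with
    | term q1 q2 q3 => omega
    | empty q1 q2 => simp at g11
    | @pair _ lf rt e' _ X' Y' q1 q2 q3 q4 q5 q6 =>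
      obtain ⟨p0, p1, p2⟩ := q2
      have r3 := q3.rec_at
      have r4 := q4.rec_at
      have r5 := b7 r4.1
      have hl : h.m (lf + 3) = X'.length := r3.1.1
      have r6 := add_mul_lt_sq r5.1 r5.2 g12
      rw [List.length_append] at g11 hYX
      simp only [sym, tst_simps, ok_simps, ex_simps, cost_simps, reduceIte, Nat.reduceEqDiff, g13, p0,
        gm, ha, p1, p2, hl, g2]
      refine ⟨⟨by omega, by omega⟩, fun _ => ⟨by omega, by omega, by omega, by omega,
        ⟨by omega, by omega, by omega, by omega⟩, fun hlt => ⟨by omega, ⟨by omega, by omega, b6 _⟩,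
        by omega, by omega, by omega, by omega, ?_⟩, fun hge => ⟨by omega, ⟨by omega, by omega, by omega⟩,
        by omega, by omega, by omega, by omega, ?_⟩⟩, fun hf => absurd trivial hf⟩
      · refine ⟨trivial, fun x hx' => ?_, trivial, b4 _, X', e', q3, hlt, by omega, ?_, by omega⟩
        · simp only [HS.set, show x ≠ 10 by omega, show x ≠ 12 by omega, show x ≠ 13 by omega,
            show x ≠ 14 by omega, show x ≠ 15 by omega, reduceIte, gx x hx']
        · rw [← hk, List.drop_append_of_le_length hlt.le, kap_append, kap_eq_aff c Y' g12, aff,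
            ← r4.1.2.1, ← r4.1.2.2]
      · refine ⟨trivial, fun x hx' => ?_, trivial, g12, Y', e', q4, by omega, by omega, ?_, by omega⟩
        · simp only [HS.set, show x ≠ 10 by omega, show x ≠ 11 by omega, show x ≠ 13 by omega,
            show x ≠ 14 by omega, show x ≠ 15 by omega, reduceIte, gx x hx']
        · rw [← hk, List.drop_append, List.drop_eq_nil_of_le (as := X') (by omega), List.nil_append]
    | @run _ b tt e' _ X' q1 q2 q3 q4 q5 q6 q7 =>
      have r3 := q5.rec_at
      have r5 := b7 r3.1
      have hl : h.m (b + 3) = X'.length := r3.1.1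
      have hlen : (List.replicate tt X').flatten.length = tt * X'.length := by simp
      rw [hlen] at g11 hYX
      have hX0 : 0 < X'.length := Nat.pos_of_ne_zero fun h0 => by rw [h0] at g11; omega
      have ht0 : 0 < tt := Nat.pos_of_ne_zero fun h0 => by rw [h0] at g11; omega
      have ht1 : tt ≤ tt * X'.length := Nat.le_mul_of_pos_right _ hX0
      have ht2 : X'.length ≤ tt * X'.length := Nat.le_mul_of_pos_left _ ht0
      have hdiv : g.v 11 / X'.length ≤ g.v 11 := Nat.div_le_self _ _
      have hmod : g.v 11 % X'.length < X'.length := Nat.mod_lt _ hX0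
      obtain ⟨qq, hqq⟩ : ∃ qq, g.v 11 / X'.length = qq := ⟨_, rfl⟩
      obtain ⟨rr, hrr⟩ : ∃ rr, g.v 11 % X'.length = rr := ⟨_, rfl⟩
      rw [hqq] at hdiv
      rw [hrr] at hmod
      have hlog : Nat.log 2 (tt - 1 - qq) ≤ Nat.log 2 tt :=
        Nat.log_mono_right (by omega)
      simp only [sym, tst_simps, ok_simps, ex_simps, cost_simps, reduceIte, Nat.reduceEqDiff, g13,
        gm, ha, q2, q3, q4, hl, hqq]
      refine ⟨⟨by omega, by omega⟩, fun hf => hf.elim, fun _ => ⟨by omega, by omega, by omega,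
        by omega, by omega, by omega, by omega, ⟨⟨by omega, by omega, by omega⟩,
        ⟨by omega, by omega, by omega⟩, by omega⟩, by omega, by omega, ?_⟩⟩
      refine affpow_spec hμ hB (by simp [HS.set, g2]) (by simpa [HS.set] using r5.1)
        (by simpa [HS.set] using r5.2) (by simpa [HS.set] using g12) (lt_of_le_of_lt (show _ ≤ tt from by simp [HS.set]; omega) (by omega)) ?_
      intro u v hv1 hv2 hu
      have hv10 := hv1 10 (by omega)
      have hv11 := hv1 11 (by omega)
      have hv14 := hv1 14 (by omega)
      simp only [HS.set, reduceIte, Nat.reduceEqDiff] at hv10 hv11 hv14 hv2 hu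
      simp only [HS.set, reduceIte, Nat.reduceEqDiff, hv10, hv11, hv14, gm, hl, hrr]
      refine ⟨by omega, by omega, by omega, ⟨by omega, by omega, by omega⟩, by omega, by omega, by omega,
        by omega, ?_⟩
      refine ⟨by simp [gm], fun x hx' => ?_, by simp [gm], ?_, X', e', q5, hmod, by omega, ?_, by omega⟩
      · have := hv1 x (by omega)
        simp only [HS.set, show x ≠ 10 by omega, show x ≠ 11 by omega, show x ≠ 12 by omega,
          show x ≠ 13 by omega, show x ≠ 14 by omega, show x ≠ 40 by omega, show x ≠ 41 by omega,
          show x ≠ 42 by omega, show x ≠ 43 by omega, reduceIte] at this ⊢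
        rw [this, gx x hx']
      · rw [hv2, r3.1.2.1, r3.1.2.2, ← kap_replicate c X' _ g12]
        exact kap_lt _ _ g12
      · rw [hv2, r3.1.2.1, r3.1.2.2, ← kap_replicate c X' _ g12, ← kap_append, ← hk,
          drop_replicate X' hX0 tt _ g11, hqq, hrr]
  · rintro t g ⟨gm, gx, g13, g12, Y, e, hY, g11, hYX, hk, ht⟩ hb
    have g2 : g.v 2 = μ := (gx 2 (by omega)).trans h2
    simp only [tst_simps, ex_simps] at hb
    have h13 : h.m (g.v 10) = 0 := by omega
    generalize ha : g.v 10 = a at *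
    cases hY with
    | @term _ s _ q1 q2 q3 =>
      have r5 := b7 q3
      have r6 := add_mul_lt_sq r5.1 r5.2 g12
      simp only [tst_simps, ok_simps, ex_simps, cost_simps, gm, ha, g2]
      refine ⟨by omega, ⟨by omega, by omega, b6 _⟩, ?_⟩
      have h11 : g.v 11 = 0 := by simpa using g11
      refine Eq.subst (motive := fun mm => Q _ ⟨_, mm⟩) gm.symm (hQ _ _ (fun x hx' => ?_) ?_ ?_)
      · simp only [HS.set, show x ≠ 12 by omega, reduceIte, gx x hx']
      · simp only [HS.set, reduceIte]
        rw [← hk, h11, List.drop_zero, kap_term, ← q3.2.1, ← q3.2.2]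
      · omega
    | empty q1 q2 => simp at g11
    | pair q1 q2 q3 q4 q5 q6 => have := q2.1; omega
    | run q1 q2 q3 q4 q5 q6 q7 => omega
  · refine ⟨rfl, fun x hx' => ?_, ?_, ?_, X, d, ?_, ?_, le_rfl, ?_, by omega⟩
    · simp only [HS.set, show x ≠ 13 by omega, reduceIte]
    · simp [HS.set]
    · simpa [HS.set] using hF
    · simpa [HS.set] using hn
    · simpa [HS.set] using hx
    · simp [HS.set]

/-- Combine the fingerprints of two suffixes. -/
def queryEnd : St := .asg 40 0 ;; .asg 41 (r 3) ;; .asg 42 (r 1 + 1 - r 0) ;; .call affpow ;;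
  .asg 0 ((r 6 + (r 2 - r 43)) % r 2)

/-- Fingerprint of the substring between positions `r0` and `r1`. -/
def query : St := .call hdr ;; .asg 10 (r 4 + 64 * ld 4) ;; .asg 5 (r 10) ;; .asg 11 (r 0 - 1) ;;
  -- The suffix after position `j` is empty when `j` is the text length. Then no second descent is
  -- made, and its fingerprint is the 0 preset in register 43.
  .asg 12 0 ;; .call desc ;; .asg 6 (r 12) ;; .asg 43 0 ;;
  .ite (.lt (r 1) (ld (r 5 + 3)))
    (.asg 10 (r 5) ;; .asg 11 (r 1) ;; .asg 12 0 ;; .call desc ;; .asg 43 (r 12)) .skip ;;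
  .call queryEnd

theorem substr_append_drop (X : List ℕ) {i j : ℕ} (hi : 1 ≤ i) (hij : i ≤ j) :
    substr X i j ++ X.drop j = X.drop (i - 1) := by
  have : X.drop j = (X.drop (i - 1)).drop (j + 1 - i) := by
    rw [List.drop_drop]; congr 1; omega
  rw [this, substr, List.take_append_drop]

/-- The suffix from `i` is the substring followed by the suffix after `j`, whose contribution is
shifted by `c ^ (j + 1 - i)`. As powers start at the left end, no inverse of `c` is needed; `μ - ·`
avoids truncated subtraction. -/
theorem kap_substr {μ : ℕ} (hμ : 0 < μ) (c : ℕ) (X : List ℕ) {i j : ℕ} (hi : 1 ≤ i) (hij : i ≤ j)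
    (hj : j ≤ X.length) :
    (kap μ c (X.drop (i - 1)) 0 +
      (μ - (aff μ 0 (c % μ))^[j + 1 - i] (kap μ c (X.drop j) 0))) % μ = kap μ c (substr X i j) 0 := by
  have hF := kap_lt c (X.drop j) hμ
  have hlen : (substr X i j).length = j + 1 - i := by
    simp only [substr, List.length_take, List.length_drop]; omega
  rw [← substr_append_drop X hi hij, kap_append, kap_eq_aff _ _ hF, hlen, aff_zero_pow _ hF, aff]
  have h1 := kap_lt c (substr X i j) (y := 0) hμ
  have h2 : (c ^ (j + 1 - i) * kap μ c (X.drop j) 0) % μ < μ := Nat.mod_lt _ hμ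
  rw [Nat.add_mod (kap μ c (substr X i j) 0), Nat.mod_mul_mod]
  generalize (c ^ (j + 1 - i) * kap μ c (X.drop j) 0) % μ = b at *
  generalize kap μ c (substr X i j) 0 = a at *
  rw [Nat.mod_eq_of_lt h1]
  rcases Nat.lt_or_ge (a + b) μ with h | h
  · rw [Nat.mod_eq_of_lt h, show a + b + (μ - b) = a + μ by omega, Nat.add_mod_right,
      Nat.mod_eq_of_lt h1]
  · rw [Nat.mod_eq_sub_mod h, Nat.mod_eq_of_lt (a := a + b - μ) (by omega), show a + b - μ + (μ - b) = a by omega,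
      Nat.mod_eq_of_lt h1]

theorem cres_lt {μ : ℕ} (hμ : 0 < μ) (sg ca : ℕ) : cres μ sg ca < μ := by
  unfold cres; split_ifs <;> exact Nat.mod_lt _ hμ

theorem queryEnd_spec {w μ c i j : ℕ} {X : List ℕ} {Q : ℕ → HS → Prop} {g : HS}
    (hμ : 2 ≤ μ) (hB : μ * μ ≤ 2 ^ w) (hX : X.length + 1 < 2 ^ w) (hc : c < μ) (hi : 1 ≤ i)
    (hij : i ≤ j) (hj : j ≤ X.length) (g0 : g.v 0 = i) (g1 : g.v 1 = j) (g2 : g.v 2 = μ)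
    (g3 : g.v 3 = c) (g6 : g.v 6 = kap μ c (X.drop (i - 1)) 0) (g43 : g.v 43 = kap μ c (X.drop j) 0)
    (hQ : ∀ t v, v 0 = kap μ c (substr X i j) 0 → t ≤ 60 * Nat.log 2 X.length + 150 → Q t ⟨v, g.m⟩) :
    WP w queryEnd Q g := by
  have b5 : 2 * μ ≤ 2 ^ w := (Nat.mul_le_mul_right μ hμ).trans hB
  have hcm : c % μ = c := Nat.mod_eq_of_lt hc
  have key := kap_substr (show 0 < μ by omega) c X hi hij hj
  rw [hcm] at key
  have k1 := kap_lt c (X.drop (i - 1)) (show 0 < μ by omega)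
  have k2 := kap_lt c (X.drop j) (show 0 < μ by omega)
  have hlog : Nat.log 2 (j + 1 - i) ≤ Nat.log 2 X.length := Nat.log_mono_right (by omega)
  refine sym.sound _ ?_
  simp only [queryEnd, sym, ok_simps, ex_simps, cost_simps, reduceIte, Nat.reduceEqDiff, g0, g1, g3]
  refine ⟨by omega, by omega, by omega, by omega, by omega, ⟨⟨by omega, by omega, by omega⟩, by omega,
    by omega⟩, ?_⟩
  refine affpow_spec hμ hB (by simpa [HS.set] using g2) (by simp [HS.set]; omega)
    (by simpa [HS.set] using hc) (by simpa [HS.set, g43] using k2)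
    (by simp [HS.set]; omega) fun u v z1 z2 hu => ?_
  have z6 := z1 6 (by omega)
  have z3 := z1 2 (by omega)
  simp only [HS.set, reduceIte, Nat.reduceEqDiff, g43, g6, g2] at z2 z6 z3 hu
  simp only [z6, z3, z2]
  rw [key]
  have := Nat.mod_lt (kap μ c (X.drop (i - 1)) 0 +
    (μ - (aff μ 0 c)^[j + 1 - i] (kap μ c (X.drop j) 0))) (show 0 < μ by omega)
  rw [key] at this
  refine ⟨by omega, ⟨⟨by omega, ⟨by omega, by omega, by omega⟩, by omega⟩, by omega, by omega⟩, ?_⟩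
  exact hQ _ _ (by simp [HS.set]) (by omega)

theorem query_spec {w μ sg ca m st S d i j : ℕ} {X : List ℕ} {Q : ℕ → HS → Prop} {h : HS}
    (hμ : 2 ≤ μ) (hB : μ * μ ≤ 2 ^ w) (hm : 3 * m + 5 < 2 ^ w) (hS : S ≤ 2 ^ w) (hK : 64 < 2 ^ w)
    (hX : X.length + 1 < 2 ^ w) (h0 : h.m 0 = μ) (h1 : h.m 1 = sg) (h2 : h.m 2 = ca) (h3 : h.m 3 = m)
    (h4 : h.m 4 = st) (hn : Node μ (cres μ sg ca) h.m S (5 + 3 * m + 64 * st) X d) (hi : 1 ≤ i)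
    (hij : i ≤ j) (hj : j ≤ X.length) (hvi : h.v 0 = i) (hvj : h.v 1 = j)
    (hQ : ∀ t v, v 0 = kap μ (cres μ sg ca) (substr X i j) 0 →
      t ≤ 600 * (d + 1) + 60 * Nat.log 2 X.length + 300 → Q t ⟨v, h.m⟩) : WP w query Q h := by
  have hc := cres_lt (show 0 < μ by omega) sg ca
  have hr := hn.rec_at
  have hl : h.m (5 + 3 * m + 64 * st + 3) = X.length := hr.1.1
  have hs := hr.2
  refine sym.sound _ ?_
  simp only [query, sym, ok_simps, ex_simps, cost_simps, tst_simps]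
  refine hdr_spec hμ hB hm h0 h1 h2 h3 fun t1 v1 e1 e2 e3 e4 ht1 => ?_
  have x0 := e1 0 (by omega)
  have x1 := e1 1 (by omega)
  simp only [e4, h4, reduceIte, Nat.reduceEqDiff, x0, hvi, HS.set]
  refine ⟨by omega, ⟨by omega, by omega, by omega⟩, by omega, by omega, by omega, ⟨by omega, by omega,
    by omega⟩, by omega, by omega, ?_⟩
  refine desc_spec hμ hB hS (by omega) (d := d) (X := X) (by simpa using e2) (by simpa using hn)
    (by simp; omega) (by simp; omega) fun t2 v2 f1 f2 ht2 => ?_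
  have y0 := f1 0 (by omega)
  have y1 := f1 1 (by omega)
  have y2 := f1 2 (by omega)
  have y3 := f1 3 (by omega)
  have y5 := f1 5 (by omega)
  simp only [reduceIte, Nat.reduceEqDiff] at y0 y1 y2 y3 y5 f2
  simp only [reduceIte, Nat.reduceEqDiff, y5, y1, x1, hl, hvj]
  refine ⟨by omega, by omega, by omega, by omega, ⟨by omega, by omega, by omega, by omega⟩,
    fun hlt => ?_, fun hge => ?_⟩
  · refine ⟨by omega, by omega, by omega, by omega, by omega, by omega, ?_⟩
    refine desc_spec hμ hB hS (by omega) (d := d) (X := X) (by simpa [y2] using e2)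
      (by simpa using hn) (by simpa [HS.set] using hlt) (by simp [HS.set]; omega)
      fun t3 v3 g1 g2 ht3 => ?_
    have z0 := g1 0 (by omega)
    have z1 := g1 1 (by omega)
    have z2 := g1 2 (by omega)
    have z3 := g1 3 (by omega)
    have z6 := g1 6 (by omega)
    simp only [HS.set, reduceIte, Nat.reduceEqDiff] at z0 z1 z2 z3 z6 g2
    simp only [HS.set]
    refine ⟨by omega, by omega, ?_⟩
    exact queryEnd_spec hμ hB hX hc hi hij hj (by simp [z0, y0, x0, hvi]) (by simp [z1, y1, x1, hvj])
      (by simp [z2, y2, e2]) (by simp [z3, y3, e3]) (by simp [z6, f2, hvi]) (by simp [g2, hvj])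
      fun t v k1 k2 => hQ _ v k1 (by omega)
  · exact queryEnd_spec hμ hB hX hc hi hij hj (by simp [y0, x0, hvi]) (by simp [y1, x1, hvj])
      (by simp [y2, e2]) (by simp [y3, e3]) (by simp [f2, hvi])
      (by simp; rw [List.drop_eq_nil_of_le (by omega)]; rfl)
      fun t v k1 k2 => hQ _ v k1 (by omega)

end WhileLang

/-! ### Records in memory -/

namespace WhileLang

open Ex St

/-- The words are long enough. -/
structure Env (w μ c N : ℕ) (G : Gram) : Prop where
  two_le : 2 ≤ μ
  mod_le : μ ≤ N
  base_lt : c < μ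
  m_le : G.m ≤ N
  len_le : G.len G.st ≤ N
  big : 2000 * ((N + 2) * (N + 2)) ≤ 2 ^ w
  m_pos : 1 ≤ G.m
  a1_le : ∀ A < G.m, G.a1 A ≤ N
  a2_le : ∀ A < G.m, G.a2 A ≤ N

namespace Env

variable {w μ c N : ℕ} {G : Gram} (E : Env w μ c N G)
include E

theorem lin : 2000 * (N + 2) ≤ 2 ^ w := by
  have := E.big; nlinarith

/-- The product is at most `900 * (N + 1)²`, below `big`. It serves for products of residues and for
a length times the size of a block. -/
theorem mul_lt {a b : ℕ} (ha : a ≤ 30 * (N + 1)) (hb : b ≤ 30 * (N + 1)) : a * b < 2 ^ w := by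
  have := E.big
  have := Nat.mul_le_mul ha hb
  nlinarith

theorem sq_le : μ * μ ≤ 2 ^ w :=
  (E.mul_lt (by have := E.mod_le; omega) (by have := E.mod_le; omega)).le

end Env

/-- Only the offsets from `lo` to `hi` of the 64-word records from `VB` on have changed. -/
def Fr (VB lo hi : ℕ) (M M' : ℕ → ℕ) : Prop :=
  ∀ a, (a < VB ∨ (a - VB) % 64 < lo ∨ hi ≤ (a - VB) % 64) → M' a = M a

namespace Fr

variable {VB lo hi lo' hi' : ℕ} {M M' M'' : ℕ → ℕ}

theorem refl : Fr VB lo hi M M := fun _ _ => rfl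

theorem trans (h1 : Fr VB lo hi M M') (h2 : Fr VB lo hi M' M'') : Fr VB lo hi M M'' :=
  fun a ha => (h2 a ha).trans (h1 a ha)

theorem mono (h1 : Fr VB lo hi M M') (hl : lo' ≤ lo) (hh : hi ≤ hi') : Fr VB lo' hi' M M' :=
  fun a ha => h1 a (by omega)

theorem low (h : Fr VB lo hi M M') {a : ℕ} (ha : a < VB) : M' a = M a := h a (Or.inl ha)

theorem fld (h : Fr VB lo hi M M') (i f : ℕ) (hf : f < 64) (hf' : f < lo ∨ hi ≤ f) :
    M' (VB + 64 * i + f) = M (VB + 64 * i + f) := h _ (by omega)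

theorem wr (i f x : ℕ) (hf : f < 64) (hl : lo ≤ f) (hh : f < hi) (g : HS) {M : ℕ → ℕ}
    (h : Fr VB lo hi M g.m) : Fr VB lo hi M (g.wr (VB + 64 * i + f) x).m := by
  intro a ha
  rw [wr_ne _ _ (by omega)]
  exact h a ha

end Fr

/-- The memory contains the grammar. -/
structure Inp (G : Gram) (M : ℕ → ℕ) : Prop where
  m : M 3 = G.m
  st : M 4 = G.st
  kd : ∀ A < G.m, M (5 + 3 * A) = G.kd A
  a1 : ∀ A < G.m, M (5 + 3 * A + 1) = G.a1 A
  a2 : ∀ A < G.m, M (5 + 3 * A + 2) = G.a2 A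

theorem Inp.congr {G : Gram} {M M' : ℕ → ℕ} {lo hi : ℕ} (I : Inp G M)
    (h : Fr (5 + 3 * G.m) lo hi M M') : Inp G M' :=
  ⟨(h.low (by omega)).trans I.m, (h.low (by omega)).trans I.st,
    fun A hA => (h.low (by omega)).trans (I.kd A hA),
    fun A hA => (h.low (by omega)).trans (I.a1 A hA),
    fun A hA => (h.low (by omega)).trans (I.a2 A hA)⟩

/-- The registers that hold global values. -/
def Glob (μ c : ℕ) (G : Gram) (h : HS) : Prop :=
  h.v 2 = μ ∧ h.v 3 = c ∧ h.v 4 = 5 + 3 * G.m ∧ h.v 5 = G.m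

theorem Glob.congr {μ c : ℕ} {G : Gram} {h h' : HS} (H : Glob μ c G h)
    (e : ∀ x, x < 6 → h'.v x = h.v x) : Glob μ c G h' :=
  ⟨(e 2 (by omega)).trans H.1, (e 3 (by omega)).trans H.2.1, (e 4 (by omega)).trans H.2.2.1,
    (e 5 (by omega)).trans H.2.2.2⟩

/-- Write at `r30` the record of the concatenation of the strings of the records `r31` and `r32`. -/
def mk : St := .asg 33 (ld (r 31 + 3) + ld (r 32 + 3)) ;;
  .asg 34 ((ld (r 31 + 4) + ld (r 31 + 5) * ld (r 32 + 4)) % r 2) ;;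
  .asg 35 ((ld (r 31 + 5) * ld (r 32 + 5)) % r 2) ;;
  .sto (r 30) 1 ;; .sto (r 30 + 1) (r 31) ;; .sto (r 30 + 2) (r 32) ;; .sto (r 30 + 3) (r 33) ;;
  .sto (r 30 + 4) (r 34) ;; .sto (r 30 + 5) (r 35)

theorem mk_spec {w μ c N : ℕ} {G : Gram} (E : Env w μ c N G) {X Y : List ℕ} {Q : ℕ → HS → Prop}
    {h : HS} (h2 : h.v 2 = μ) (h30 : h.v 30 + 6 < 2 ^ w) (h31 : h.v 31 + 6 < 2 ^ w)
    (h32 : h.v 32 + 6 < 2 ^ w) (hX : Rec μ c h.m (h.v 31) X) (hY : Rec μ c h.m (h.v 32) Y)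
    (hl : (X ++ Y).length ≤ N)
    (hQ : ∀ t v M', (∀ x, x < 33 ∨ 35 < x → v x = h.v x) →
      (∀ a, a < h.v 30 ∨ h.v 30 + 6 ≤ a → M' a = h.m a) → Rec μ c M' (h.v 30) (X ++ Y) →
      PairAt M' (h.v 30) (h.v 31) (h.v 32) → t ≤ 100 → Q t ⟨v, M'⟩) : WP w mk Q h := by
  have hμ := E.two_le
  have hB := E.sq_le
  have hlin := E.lin
  have b4 : ∀ x, x % μ < μ := fun x => Nat.mod_lt _ (by omega)
  have b5 : μ < 2 ^ w := by nlinarith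
  have b6 := fun x => (b4 x).trans b5
  have b7 : ∀ {a Y}, Rec μ c h.m a Y → h.m (a + 4) < μ ∧ h.m (a + 5) < μ := fun {a Y} hr => by
    rw [hr.2.1, hr.2.2]; exact ⟨kap_lt _ _ (by omega), b4 _⟩
  have hX' := b7 hX
  have hY' := b7 hY
  have e1 := add_mul_lt_sq hX'.1 hX'.2 hY'.1
  have e2 := add_mul_lt_sq (show 0 < μ by omega) hX'.2 hY'.2
  have hXl := hX.1
  have hYl := hY.1
  rw [List.length_append] at hl
  refine sym.sound _ ?_
  simp only [mk, sym, ok_simps, ex_simps, cost_simps, reduceIte, Nat.reduceEqDiff, h2]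
  refine ⟨by omega, by omega, by omega, ⟨⟨by omega, by omega, by omega⟩, by omega, b6 _⟩, by omega,
    ⟨⟨by omega, by omega, by omega⟩, by omega, b6 _⟩, by omega, by omega, by omega, by omega, by omega,
    by omega, by omega, by omega, by omega, by omega, by omega, by omega, ?_⟩
  refine hQ _ _ _ (fun x hx => ?_) (fun a ha => ?_) ⟨?_, ?_, ?_⟩ ⟨?_, ?_, ?_⟩ (by norm_num)
  · simp only [HS.set, HS.wr, show x ≠ 33 by omega, show x ≠ 34 by omega, show x ≠ 35 by omega,
      reduceIte]
  · simp only [wr_m, HS.set, show a ≠ h.v 30 by omega, show a ≠ h.v 30 + 1 by omega,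
      show a ≠ h.v 30 + 2 by omega, show a ≠ h.v 30 + 3 by omega, show a ≠ h.v 30 + 4 by omega,
      show a ≠ h.v 30 + 5 by omega, reduceIte]
  · simp [wr_m, hXl, hYl]
  · simp only [wr_m, Nat.add_right_inj, Nat.add_left_inj, Nat.reduceEqDiff, reduceIte]
    rw [kap_append, kap_eq_aff c X (kap_lt c Y (by omega)), aff, ← hX.2.1, ← hX.2.2, ← hY.2.1]
  · simp only [wr_m, reduceIte]
    rw [hX.2.2, hY.2.2, List.length_append, pow_add, ← Nat.mul_mod]
  all_goals simp [wr_m]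

/-- Combine the pairs of records at `r31` and `r32` into one at `r30`. -/
def ccat : St := .call mk ;; .asg 30 (r 30 + 6) ;; .asg 33 (r 31 + 6) ;; .asg 31 (r 32 + 6) ;;
  .asg 32 (r 33) ;; .call mk

/-- The second call of `mk` reads its operands after the first has written; the target is therefore
required to be disjoint from both operands, while these may coincide. -/
theorem ccat_spec {w μ c N : ℕ} {D : Dat} (E : Env w μ c N D.G) {x y z a b b' : ℕ}
    {Q : ℕ → HS → Prop} {h : HS} (h2 : h.v 2 = μ) (h30 : h.v 30 = a) (h31 : h.v 31 = b)
    (h32 : h.v 32 = b') (ha : a + 12 < 2 ^ w) (hb : b + 12 < 2 ^ w) (hb' : b' + 12 < 2 ^ w)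
    (hab : a + 12 ≤ b ∨ b + 12 ≤ a) (hab' : a + 12 ≤ b' ∨ b' + 12 ≤ a) (hxy : x ≤ y) (hyz : y ≤ z)
    (hX : D.CRec μ c h.m b y z) (hY : D.CRec μ c h.m b' x y)
    (hl : (D.cL x z).length ≤ N) (hl' : (D.cR x z).length ≤ N)
    (hQ : ∀ t v M', (∀ x, x < 30 ∨ 35 < x → v x = h.v x) →
      (∀ e, e < a ∨ a + 12 ≤ e → M' e = h.m e) → D.CRec μ c M' a x z →
      Dat.CPair M' a b b' → t ≤ 250 → Q t ⟨v, M'⟩) : WP w ccat Q h := by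
  subst h30 h31 h32
  have hlin := E.lin
  rw [D.cL_trans hxy hyz] at hl
  rw [D.cR_trans hxy hyz] at hl'
  refine sym.sound _ ?_
  simp only [ccat, sym, ok_simps, ex_simps, cost_simps]
  refine mk_spec E h2 (by omega) (by omega) (by omega) hX.1 hY.1 hl fun t1 v1 M1 e1 e2 e3 e4 ht1 => ?_
  have x30 := e1 30 (by omega)
  have x31 := e1 31 (by omega)
  have x32 := e1 32 (by omega)
  have x2 := e1 2 (by omega)
  simp only [reduceIte, Nat.reduceEqDiff, x30, x31, x32]
  refine ⟨by omega, by omega, by omega, by omega, by omega, by omega, by omega, by omega, ?_⟩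
  have tr : ∀ {p Z}, (p + 5 < h.v 30 ∨ h.v 30 + 6 ≤ p) → Rec μ c h.m p Z → Rec μ c M1 p Z :=
    fun {p Z} hp H => ⟨(e2 _ (by omega)).trans H.1, (e2 _ (by omega)).trans H.2.1,
      (e2 _ (by omega)).trans H.2.2⟩
  refine mk_spec E (by simp [HS.set, x2, h2]) (by simp [HS.set]; omega) (by simp [HS.set]; omega)
    (by simp [HS.set]; omega) (X := D.cR x y) (Y := D.cR y z) ?_ ?_ hl' ?_
  · simpa [HS.set] using tr (by omega) hY.2
  · simpa [HS.set] using tr (by omega) hX.2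
  · intro t2 v2 M2 f1 f2 f3 f4 ht2
    simp only [ex_simps, reduceIte, Nat.reduceEqDiff] at f1 f2 f3 f4
    refine hQ _ _ _ (fun x hx => ?_) (fun e he => ?_) ⟨?_, ?_⟩ ⟨?_, f4⟩ (by omega)
    · have := f1 x (by omega)
      simp only [show x ≠ 30 by omega, show x ≠ 31 by omega, show x ≠ 32 by omega,
        show x ≠ 33 by omega, reduceIte] at this
      rw [this, e1 x (by omega)]
    · rw [f2 e (by omega), e2 e (by omega)]
    · rw [D.cL_trans hxy hyz]
      exact ⟨(f2 _ (by omega)).trans e3.1, (f2 _ (by omega)).trans e3.2.1,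
        (f2 _ (by omega)).trans e3.2.2⟩
    · rw [D.cR_trans hxy hyz]; exact f3
    · exact ⟨(f2 _ (by omega)).trans e4.1, (f2 _ (by omega)).trans e4.2.1,
        (f2 _ (by omega)).trans e4.2.2⟩

end WhileLang

/-! ### Depth-first search -/

namespace WhileLang

open Ex St

/-- Set `r19` to `X + 1` for an unfinished child `X` of the variable at hand, or to 0. -/
def dfsNext : St := .asg 19 0 ;;
  .ite (.eq (r 14) 0) .skip
    (.ite (.eq (ld (r 17 + 3)) 0) (.asg 19 (r 15 + 1))
      (.ite (.eq (r 14) 1) (.ite (.eq (ld (r 18 + 3)) 0) (.asg 19 (r 16 + 1)) .skip) .skip))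

/-- Write the record of a variable whose children are finished. -/
def dfsFin : St := .ite (.eq (r 14) 0)
  (.sto (r 13 + 3) 1 ;; .sto (r 13 + 4) (r 15 % r 2) ;; .sto (r 13 + 5) (r 3 % r 2))
  (.ite (.eq (r 14) 1) (.asg 30 (r 13) ;; .asg 31 (r 17) ;; .asg 32 (r 18) ;; .call mk)
    (.asg 40 (ld (r 17 + 4)) ;; .asg 41 (ld (r 17 + 5)) ;; .asg 42 (r 16) ;; .asg 43 0 ;;
      .call affpow ;; .asg 20 (r 43) ;; .asg 40 0 ;; .asg 41 (ld (r 17 + 5)) ;; .asg 42 (r 16) ;;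
      .asg 43 1 ;; .call affpow ;; .sto (r 13 + 3) (r 16 * ld (r 17 + 3)) ;;
      .sto (r 13 + 4) (r 20) ;; .sto (r 13 + 5) (r 43)))

/-- Registers that describe the variable `u`. -/
structure VReg (G : Gram) (u : ℕ) (h : HS) : Prop where
  r11 : h.v 11 = u
  r13 : h.v 13 = 5 + 3 * G.m + 64 * u
  r14 : h.v 14 = G.kd u
  r15 : h.v 15 = G.a1 u
  r16 : h.v 16 = G.a2 u
  r17 : h.v 17 = 5 + 3 * G.m + 64 * G.a1 u
  r18 : h.v 18 = 5 + 3 * G.m + 64 * G.a2 u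

/-- The length field doubles as the mark of finished variables: it starts as 0, and all lengths are
positive. -/
theorem dfsNext_spec {w μ c N u : ℕ} {G : Gram} (E : Env w μ c N G) {Q : ℕ → HS → Prop}
    {h : HS} (hu : u < G.m) (hv : VReg G u h)
    (hQ : ∀ t v, (∀ x, x ≠ 19 → v x = h.v x) → t ≤ 30 →
      ((∃ X, v 19 = X + 1 ∧ G.Ch u X ∧ h.m (5 + 3 * G.m + 64 * X + 3) = 0) ∨
        (v 19 = 0 ∧ ∀ X, G.Ch u X → h.m (5 + 3 * G.m + 64 * X + 3) ≠ 0)) → Q t ⟨v, h.m⟩) :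
    WP w dfsNext Q h := by
  have hlin := E.lin
  have h1 := E.a1_le u hu
  have h2 := E.a2_le u hu
  have h3 := E.m_le
  have h4 := G.kd_le u hu
  refine sym.sound _ ?_
  simp only [dfsNext, sym, tst_simps, ok_simps, ex_simps, cost_simps, reduceIte, Nat.reduceEqDiff,
    hv.r14, hv.r15, hv.r16, hv.r17, hv.r18]
  refine ⟨by omega, by omega, ⟨by omega, by omega⟩, fun k0 => ?_, fun k0 => ⟨⟨⟨by omega, by omega,
    by omega⟩, by omega⟩, fun z1 => ⟨by omega, ⟨by omega, by omega, by omega⟩, ?_⟩, fun z1 => ⟨⟨by omega,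
    by omega⟩, fun k1 => ⟨⟨⟨by omega, by omega, by omega⟩, by omega⟩, fun z2 => ⟨by omega, ⟨by omega,
    by omega, by omega⟩, ?_⟩, fun z2 => ?_⟩, fun k1 => ?_⟩⟩⟩
  all_goals refine hQ _ _ (fun x hx => by simp [HS.set, hx]) (by norm_num) ?_
  · refine Or.inr ⟨by simp [HS.set], fun X hX => ?_⟩
    rcases hX with ⟨hk, -⟩ | ⟨hk, -⟩ <;> omega
  · refine Or.inl ⟨G.a1 u, by simp [HS.set], ?_, z1⟩
    by_cases k : G.kd u = 1
    · exact Or.inl ⟨k, Or.inl rfl⟩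
    · exact Or.inr ⟨by omega, rfl⟩
  · exact Or.inl ⟨G.a2 u, by simp [HS.set], Or.inl ⟨k1, Or.inr rfl⟩, z2⟩
  · refine Or.inr ⟨by simp [HS.set], fun X hX => ?_⟩
    rcases hX with ⟨hk, rfl | rfl⟩ | ⟨hk, rfl⟩
    · exact z1
    · exact z2
    · exact z1
  · refine Or.inr ⟨by simp [HS.set], fun X hX => ?_⟩
    rcases hX with ⟨hk, rfl | rfl⟩ | ⟨hk, rfl⟩
    · exact z1
    · exact absurd hk k1
    · exact z1

theorem Rec.of_ne {μ c a b k : ℕ} {M M' : ℕ → ℕ} {X : List ℕ} (h : Rec μ c M b X)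
    (hM : ∀ x, x < a ∨ a + k ≤ x → M' x = M x) (hab : b + 6 ≤ a ∨ a + k ≤ b + 3) :
    Rec μ c M' b X :=
  ⟨(hM _ (by omega)).trans h.1, (hM _ (by omega)).trans h.2.1, (hM _ (by omega)).trans h.2.2⟩

set_option maxHeartbeats 1000000 in
theorem dfsFin_spec {w μ c N u : ℕ} {G : Gram} (E : Env w μ c N G) {Q : ℕ → HS → Prop}
    {h : HS} (hr : G.Rch u) (hv : VReg G u h) (hg : Glob μ c G h)
    (hch : ∀ X, G.Ch u X → Rec μ c h.m (5 + 3 * G.m + 64 * X) (G.str X))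
    (hQ : ∀ t v M', (∀ x, x < 20 → v x = h.v x) →
      (∀ a, a < 5 + 3 * G.m + 64 * u ∨ 5 + 3 * G.m + 64 * u + 6 ≤ a → M' a = h.m a) →
      Rec μ c M' (5 + 3 * G.m + 64 * u) (G.str u) →
      t ≤ 400 * (Nat.log 2 (G.len G.st) + 1) → Q t ⟨v, M'⟩) :
    WP w dfsFin Q h := by
  have hu := hr.lt
  have hlin := E.lin
  have h1 := E.a1_le u hu
  have h2 := E.a2_le u hu
  have h3 := E.m_le
  have h4 := G.kd_le u hu
  have hμ := E.two_le
  have hμN := E.mod_le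
  have hcμ := E.base_lt
  have hB := E.sq_le
  have hlen := hr.len_le.trans E.len_le
  have b4 : ∀ x, x % μ < μ := fun x => Nat.mod_lt _ (by omega)
  have b5 : μ < 2 ^ w := by omega
  have b6 := fun x => (b4 x).trans b5
  obtain ⟨g2, g3, g4, g5⟩ := hg
  refine sym.sound _ ?_
  simp only [dfsFin, sym, tst_simps, ok_simps, ex_simps, cost_simps, reduceIte, Nat.reduceEqDiff,
    hv.r13, hv.r14, hv.r15, hv.r16, hv.r17, hv.r18, g2, g3, g4, g5]
  refine ⟨⟨by omega, by omega⟩, fun k0 => ?_, fun k0 => ⟨⟨by omega, by omega⟩, fun k1 => ?_, fun k1 => ?_⟩⟩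
  · refine ⟨⟨by omega, by omega, by omega⟩, by omega, ⟨by omega, by omega, by omega⟩, ⟨by omega, by omega, b6 _⟩,
      ⟨by omega, by omega, by omega⟩, ⟨by omega, by omega, b6 _⟩, ?_⟩
    refine hQ _ _ _ (fun x hx => rfl) (fun a ha => ?_) ?_ (by omega)
    · simp only [wr_m, show a ≠ 5 + 3 * G.m + 64 * u + 3 by omega,
        show a ≠ 5 + 3 * G.m + 64 * u + 4 by omega, show a ≠ 5 + 3 * G.m + 64 * u + 5 by omega,
        reduceIte]
    · rw [G.term u hu k0]
      exact ⟨by simp [wr_m], by simp [wr_m, kap], by simp [wr_m]⟩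
  · obtain ⟨l1, l2, hs⟩ := G.pair u hu k1
    refine ⟨by omega, by omega, by omega, by omega, by omega, by omega, ?_⟩
    refine mk_spec E (X := G.str (G.a1 u)) (Y := G.str (G.a2 u)) (by simp [HS.set, g2]) (by simp [HS.set]; omega) (by simp [HS.set]; omega)
      (by simp [HS.set]; omega) (by simpa [HS.set] using hch _ (Or.inl ⟨k1, Or.inl rfl⟩))
      (by simpa [HS.set] using hch _ (Or.inl ⟨k1, Or.inr rfl⟩)) (by rw [← hs]; exact hlen)
      fun t v M' e1 e2 e3 _ ht => ?_
    simp only [HS.set, reduceIte, Nat.reduceEqDiff] at e1 e2 e3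
    refine hQ _ _ _ (fun x hx => ?_) e2 (by rw [hs]; exact e3) (by omega)
    rw [e1 x (by omega), if_neg (by omega), if_neg (by omega), if_neg (by omega)]
  · have k2 : G.kd u = 2 := by omega
    obtain ⟨l1, l2, hs⟩ := G.run u hu k2
    have hR := hch _ (Or.inr ⟨k2, rfl⟩)
    have hl := Gram.len_run hu k2
    have c1 := Gram.len_pos l1
    have c2 : G.a2 u ≤ G.a2 u * G.len (G.a1 u) := Nat.le_mul_of_pos_right _ c1
    have c3 : G.len u ≤ N := hlen
    have c4 : h.m (5 + 3 * G.m + 64 * G.a1 u + 3) = G.len (G.a1 u) := hR.1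
    have c5 : h.m (5 + 3 * G.m + 64 * G.a1 u + 4) < μ := by rw [hR.2.1]; exact kap_lt _ _ (by omega)
    have c6 : h.m (5 + 3 * G.m + 64 * G.a1 u + 5) < μ := by rw [hR.2.2]; exact b4 _
    have c7 : Nat.log 2 (G.a2 u) ≤ Nat.log 2 (G.len G.st) :=
      Nat.log_mono_right ((c2.trans hl.ge).trans hr.len_le)
    refine ⟨by omega, ⟨by omega, by omega, by omega⟩, by omega, ⟨by omega, by omega, by omega⟩, by omega, by omega,
      by omega, by omega, ?_⟩
    -- Iterating the affine map of the child on 0 gives the fingerprint of the run.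
    refine affpow_spec hμ hB (by simp [HS.set, g2]) (by simpa [HS.set] using c5)
      (by simpa [HS.set] using c6) (by simp [HS.set]; omega) (by simp [HS.set]; omega)
      fun t1 v1 e1 e2 ht1 => ?_
    have x2 := e1 2 (by omega)
    have x13 := e1 13 (by omega)
    have x16 := e1 16 (by omega)
    have x17 := e1 17 (by omega)
    simp only [HS.set, reduceIte, Nat.reduceEqDiff, hv.r13, hv.r16, hv.r17, g2]
      at x2 x13 x16 x17 e2 ht1
    simp only [HS.set, reduceIte, Nat.reduceEqDiff, x13, x16, x17]
    refine ⟨by omega, by omega, by omega, by omega, by omega, ⟨by omega, by omega, by omega⟩, by omega, by omega,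
      by omega, by omega, ?_⟩
    -- Iterating its linear part on 1 gives the power of the base, by `aff_pow`.
    refine affpow_spec hμ hB (by simp [x2]) (by simp; omega)
      (by simpa using c6) (by simp; omega) (by simp; omega)
      fun t2 v2 f1 f2 ht2 => ?_
    have y13 := f1 13 (by omega)
    have y16 := f1 16 (by omega)
    have y17 := f1 17 (by omega)
    have y20 := f1 20 (by omega)
    simp only [reduceIte, Nat.reduceEqDiff, x13, x16, x17] at y13 y16 y17 y20 f2 ht2
    simp only [y13, y16, y17, y20, c4, ← hl]
    have hp : 64 * G.a1 u + 5 < 64 * u + 3 ∨ 64 * u + 5 < 64 * G.a1 u + 3 := by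
      rcases Nat.lt_trichotomy (G.a1 u) u with hlt | heq | hlt
      · omega
      · have := Gram.Ch.len_lt hu (X := G.a1 u) (Or.inr ⟨k2, rfl⟩)
        rw [heq] at this; omega
      · omega
    refine ⟨⟨by omega, by omega, by omega⟩, ⟨by omega, by omega, by omega⟩,
      ⟨by omega, by omega, by omega⟩, by omega, ⟨by omega, by omega, by omega⟩, by omega, ?_⟩
    refine hQ _ _ _ (fun x hx => ?_) (fun a ha => ?_) ?_ (by omega)
    · have e1x := e1 x (by omega)
      have f1x := f1 x (by omega)
      simp only [HS.set, show x ≠ 40 by omega, show x ≠ 41 by omega, show x ≠ 42 by omega,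
        show x ≠ 43 by omega, show x ≠ 20 by omega, reduceIte] at e1x f1x
      exact f1x.trans e1x
    · simp only [wr_m, show a ≠ 5 + 3 * G.m + 64 * u + 3 by omega,
        show a ≠ 5 + 3 * G.m + 64 * u + 4 by omega, show a ≠ 5 + 3 * G.m + 64 * u + 5 by omega,
        reduceIte]
    · refine ⟨?_, ?_, ?_⟩
      · simp only [wr_m, Nat.add_right_inj, Nat.reduceEqDiff, reduceIte]; rfl
      · simp only [wr_m, Nat.add_right_inj, Nat.reduceEqDiff, reduceIte]
        rw [hs, kap_replicate _ _ _ (by omega), e2, hR.2.1, hR.2.2]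
      · simp only [wr_m, reduceIte]
        have := aff_pow μ c (G.str (G.a1 u)).length (G.a2 u)
        rw [Nat.mod_eq_of_lt (show 1 < μ by omega)] at this
        rw [f2, hR.2.2, this, hs]
        simp

/-- State of the search: `l` lists the finished variables, and `s` is the stack. -/
structure DInv (μ c : ℕ) (G : Gram) (M0 : ℕ → ℕ) (l s : List ℕ) (M : ℕ → ℕ) : Prop where
  fr : Fr (5 + 3 * G.m) 0 8 M0 M
  ordr : ∀ i (hi : i < l.length), M (5 + 3 * G.m + 64 * i + 7) = l[i]
  stk : ∀ i (hi : i < s.length), M (5 + 3 * G.m + 64 * i + 6) = s[i]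
  nodup : l.Nodup
  rch : ∀ v ∈ l, G.Rch v
  rcd : ∀ v ∈ l, Rec μ c M (5 + 3 * G.m + 64 * v) (G.str v)
  zero : ∀ v < G.m, v ∉ l → M (5 + 3 * G.m + 64 * v + 3) = 0
  topo : ∀ a u b, l = a ++ u :: b → ∀ X, G.Ch u X → X ∈ a
  srch : ∀ v ∈ s, G.Rch v ∧ v ∉ l
  dec : s.Pairwise (fun a b => G.len b < G.len a)
  root : G.st ∈ l ∨ G.st ∈ s

namespace DInv

variable {μ c : ℕ} {G : Gram} {M0 M : ℕ → ℕ} {l s : List ℕ} (I : DInv μ c G M0 l s M)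
include I

/-- Lengths decrease strictly along the stack, so it holds distinct variables, all different from
the finished ones. -/
theorem count : l.length + s.length ≤ G.m := by
  have h1 : (l ++ s).Nodup := by
    rw [List.nodup_append]
    refine ⟨I.nodup, ?_, fun a ha b hb hab => (I.srch b hb).2 (hab ▸ ha)⟩
    exact I.dec.imp fun h e => absurd (e ▸ h) (lt_irrefl _)
  have h2 : (l ++ s).toFinset ⊆ Finset.range G.m := by
    intro x hx
    rw [List.mem_toFinset, List.mem_append] at hx
    rw [Finset.mem_range]
    rcases hx with hx | hx
    · exact (I.rch x hx).lt
    · exact (I.srch x hx).1.lt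
  have h3 := Finset.card_le_card h2
  rwa [List.toFinset_card_of_nodup h1, Finset.card_range, List.length_append] at h3

theorem mem_iff {v : ℕ} (hv : v < G.m) : M (5 + 3 * G.m + 64 * v + 3) = 0 ↔ v ∉ l := by
  refine ⟨fun h hl => ?_, I.zero v hv⟩
  have h1 := (I.rcd v hl).1
  have := Gram.len_pos hv
  unfold Gram.len at this
  omega

theorem push {X u : ℕ} {s0 : List ℕ} {M' : ℕ → ℕ} (hs : s = s0 ++ [u]) (hc : G.Ch u X)
    (hX : X ∉ l) (hM : ∀ a, a ≠ 5 + 3 * G.m + 64 * s.length + 6 → M' a = M a)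
    (hM' : M' (5 + 3 * G.m + 64 * s.length + 6) = X) : DInv μ c G M0 l (s ++ [X]) M' := by
  have hu := (I.srch u (by simp [hs])).1
  refine ⟨fun a ha => (hM _ (by omega)).trans (I.fr a ha), fun i hi => (hM _ (by omega)).trans (I.ordr i hi),
    fun i hi => ?_, I.nodup, I.rch, fun v hv => ?_, fun v h1 h2 => (hM _ (by omega)).trans (I.zero v h1 h2),
    I.topo, fun v hv => ?_, ?_, I.root.imp_right fun h => by simp [h]⟩
  · rw [List.length_append, List.length_singleton] at hi
    by_cases h : i = s.length
    · subst h; simp [hM']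
    · rw [hM _ (by omega), I.stk i (by omega), List.getElem_append_left]
  · have := I.rcd v hv
    exact ⟨(hM _ (by omega)).trans this.1, (hM _ (by omega)).trans this.2.1,
      (hM _ (by omega)).trans this.2.2⟩
  · rw [List.mem_append, List.mem_singleton] at hv
    rcases hv with hv | rfl
    · exact I.srch v hv
    · exact ⟨.step hu hc, hX⟩
  · rw [List.pairwise_append]
    refine ⟨I.dec, by simp, fun a ha b hb => ?_⟩
    rw [List.mem_singleton] at hb
    subst hb
    have h1 := hc.len_lt hu.lt
    have h2 := I.dec
    rw [hs] at ha h2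
    rw [List.pairwise_append] at h2
    rw [List.mem_append, List.mem_singleton] at ha
    rcases ha with ha | rfl
    · exact h1.trans (h2.2.2 a ha u (by simp))
    · exact h1

theorem pop {u : ℕ} {s0 : List ℕ} {M' : ℕ → ℕ} (hs : s = s0 ++ [u])
    (hch : ∀ X, G.Ch u X → X ∈ l)
    (hM : ∀ a, (a < 5 + 3 * G.m + 64 * u ∨ 5 + 3 * G.m + 64 * u + 6 ≤ a) →
      a ≠ 5 + 3 * G.m + 64 * l.length + 7 → M' a = M a)
    (hR : Rec μ c M' (5 + 3 * G.m + 64 * u) (G.str u))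
    (hM' : M' (5 + 3 * G.m + 64 * l.length + 7) = u) : DInv μ c G M0 (l ++ [u]) s0 M' := by
  have hu := I.srch u (by simp [hs])
  have hd := I.dec
  rw [hs, List.pairwise_append] at hd
  refine ⟨fun a ha => (hM _ (by omega) (by omega)).trans (I.fr a ha), fun i hi => ?_, fun i hi => ?_,
    ?_, fun v hv => ?_, fun v hv => ?_, fun v h1 h2 => ?_, fun a x b hab X hX => ?_,
    fun v hv => ⟨(I.srch v (by simp [hs, hv])).1, fun h => ?_⟩, hd.1, ?_⟩
  · rw [List.length_append, List.length_singleton] at hi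
    by_cases h : i = l.length
    · subst h; simp [hM']
    · rw [hM _ (by omega) (by omega), I.ordr i (by omega), List.getElem_append_left]
  · rw [hM _ (by omega) (by omega), I.stk i (by simp [hs]; omega)]
    simp only [hs]
    rw [List.getElem_append_left]
  · rw [List.nodup_append]
    refine ⟨I.nodup, by simp, fun a ha b hb hab => hu.2 ?_⟩
    rw [List.mem_singleton] at hb
    rw [← hb, ← hab]; exact ha
  · rw [List.mem_append, List.mem_singleton] at hv
    rcases hv with hv | rfl
    · exact I.rch v hv
    · exact hu.1
  · rw [List.mem_append, List.mem_singleton] at hv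
    rcases hv with hv | rfl
    · have h1 := I.rcd v hv
      have h2 : v ≠ u := fun h => hu.2 (h ▸ hv)
      exact ⟨(hM _ (by omega) (by omega)).trans h1.1, (hM _ (by omega) (by omega)).trans h1.2.1,
        (hM _ (by omega) (by omega)).trans h1.2.2⟩
    · exact hR
  · rw [List.mem_append, List.mem_singleton, not_or] at h2
    rw [hM _ (by omega) (by omega)]
    exact I.zero v h1 h2.1
  · rcases List.eq_nil_or_concat b with rfl | ⟨b', y, rfl⟩
    · obtain ⟨rfl, h⟩ := List.append_inj' hab rfl
      simp only [List.cons.injEq, and_true] at h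
      subst h
      exact hch X hX
    · have h1 : l ++ [u] = (a ++ x :: b') ++ [y] := by simpa using hab
      obtain ⟨h2, -⟩ := List.append_inj' h1 rfl
      exact I.topo a x b' h2 X hX
  · rw [List.mem_append, List.mem_singleton] at h
    rcases h with h | rfl
    · exact (I.srch v (by simp [hs, hv])).2 h
    · exact lt_irrefl _ (hd.2.2 v hv v (by simp))
  · rcases I.root with h | h
    · exact Or.inl (by simp [h])
    · rw [hs, List.mem_append, List.mem_singleton] at h
      rcases h with h | h
      · exact Or.inr h
      · exact Or.inl (by simp [h])

end DInv

/-- Load the description of the variable on top of the stack. -/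
def dfsTop : St := .asg 11 (ld (r 4 + 64 * (r 10 - 1) + 6)) ;; .asg 12 (5 + 3 * r 11) ;;
  .asg 13 (r 4 + 64 * r 11) ;; .asg 14 (ld (r 12)) ;; .asg 15 (ld (r 12 + 1)) ;;
  .asg 16 (ld (r 12 + 2)) ;; .asg 17 (r 4 + 64 * r 15) ;; .asg 18 (r 4 + 64 * r 16)

/-- Compute the records of the reachable variables, and list these in topological order. -/
def dfs : St := .sto (r 4 + 6) (ld 4) ;; .asg 10 1 ;; .asg 6 0 ;;
  .loop (.lt 0 (r 10)) (.call dfsTop ;; .call dfsNext ;;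
    .ite (.lt 0 (r 19)) (.sto (r 4 + 64 * r 10 + 6) (r 19 - 1) ;; .asg 10 (r 10 + 1))
      (.call dfsFin ;; .sto (r 4 + 64 * r 6 + 7) (r 11) ;; .asg 6 (r 6 + 1) ;; .asg 10 (r 10 - 1)))

theorem dfsTop_spec {w μ c N u k : ℕ} {G : Gram} (E : Env w μ c N G) {Q : ℕ → HS → Prop}
    {h : HS} (hu : u < G.m) (hk : k < G.m) (h10 : h.v 10 = k + 1) (hg : Glob μ c G h)
    (hI : Inp G h.m) (htop : h.m (5 + 3 * G.m + 64 * k + 6) = u)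
    (hQ : ∀ t v, (∀ x, x < 11 → v x = h.v x) → VReg G u ⟨v, h.m⟩ → t ≤ 60 → Q t ⟨v, h.m⟩) :
    WP w dfsTop Q h := by
  have hlin := E.lin
  have h1 := E.a1_le u hu
  have h2 := E.a2_le u hu
  have h3 := E.m_le
  obtain ⟨g2, g3, g4, g5⟩ := hg
  have i1 := hI.kd u hu
  have i2 := hI.a1 u hu
  have i3 := hI.a2 u hu
  refine sym.sound _ ?_
  simp only [dfsTop, sym, ok_simps, ex_simps, cost_simps, reduceIte, Nat.reduceEqDiff, g4, h10,
    Nat.add_sub_cancel, htop, i1, i2, i3]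
  refine ⟨by omega, ⟨⟨by omega, ⟨by omega, by omega, by omega⟩, by omega⟩, by omega, by omega⟩, by omega,
    ⟨by omega, ⟨by omega, by omega, by omega⟩, by omega⟩, by omega, ⟨by omega, ⟨by omega, by omega, by omega⟩,
    by omega⟩, by omega, by omega, by omega, ⟨by omega, by omega, by omega⟩, by omega, ⟨by omega, by omega,
    by omega⟩, by omega, ⟨by omega, ⟨by omega, by omega, by omega⟩, by omega⟩, by omega,
    ⟨by omega, ⟨by omega, by omega, by omega⟩, by omega⟩, ?_⟩
  refine hQ _ _ (fun x hx => ?_) ⟨?_, ?_, ?_, ?_, ?_, ?_, ?_⟩ (by norm_num)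
  · simp only [HS.set, show x ≠ 11 by omega, show x ≠ 12 by omega, show x ≠ 13 by omega,
      show x ≠ 14 by omega, show x ≠ 15 by omega, show x ≠ 16 by omega, show x ≠ 17 by omega,
      show x ≠ 18 by omega, reduceIte]
  all_goals simp [HS.set]

/-- A push, as well as moving a variable from the stack to the list, raises `2 * l.length +
s.length` by one. By `count` it stays at most `2 * m`, which bounds the passes. A pass takes `O(log
n)` steps because of the powers for a run. -/
theorem dfs_spec {w μ c N : ℕ} {G : Gram} (E : Env w μ c N G) {Q : ℕ → HS → Prop}
    {h : HS} (hg : Glob μ c G h) (hI : Inp G h.m)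
    (hz : ∀ v < G.m, h.m (5 + 3 * G.m + 64 * v + 3) = 0)
    (hQ : ∀ t v M' l, (∀ x, x < 6 → v x = h.v x) → v 6 = l.length → G.Ord l → l.length ≤ G.m →
      Fr (5 + 3 * G.m) 0 8 h.m M' →
      (∀ i (hi : i < l.length), M' (5 + 3 * G.m + 64 * i + 7) = l[i]) →
      (∀ v ∈ l, Rec μ c M' (5 + 3 * G.m + 64 * v) (G.str v)) →
      t ≤ 1300 * (Nat.log 2 (G.len G.st) + 1) * G.m → Q t ⟨v, M'⟩) :
    WP w dfs Q h := by
  have hlin := E.lin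
  have h3 := E.m_le
  have hst := G.st_lt
  have hg' := hg
  obtain ⟨g2, g3, g4, g5⟩ := hg
  set L := Nat.log 2 (G.len G.st) + 1 with hL
  have hL1 : 1 ≤ L := by omega
  refine sym.sound _ ?_
  simp only [dfs, sym, ok_simps, ex_simps, cost_simps, g4, hI.st]
  refine ⟨⟨by omega, by omega, by omega⟩, by omega, by omega, by omega, by omega, by omega, ?_⟩
  refine WP.loop (fun t g => ∃ l s, (∀ x, x < 6 → g.v x = h.v x) ∧ g.v 6 = l.length ∧
    g.v 10 = s.length ∧ DInv μ c G h.m l s g.m ∧ t ≤ 600 * L * (2 * l.length + s.length))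
    (600 * L * (2 * G.m)) ?_ ?_ ?_ ?_ ?_
  · rintro t g -
    simp only [tst_simps, ok_simps]; omega
  · rintro t g ⟨l, s, -, -, -, I, ht⟩
    have := I.count
    exact ht.trans (Nat.mul_le_mul_left _ (by omega))
  · rintro t g ⟨l, s, gx, g6, g10, I, ht⟩ hb
    have hcnt := I.count
    simp only [tst_simps, ex_simps] at hb
    rcases List.eq_nil_or_concat s with hs | ⟨s0, u, hs⟩
    · rw [hs] at g10; simp at g10; omega
    rw [List.concat_eq_append] at hs
    have hsl : s.length = s0.length + 1 := by rw [hs]; simp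
    have hu := I.srch u (by simp [hs])
    have hg1 : Glob μ c G g := hg'.congr gx
    have htop := I.stk s0.length (by omega)
    simp only [hs, List.getElem_append_right le_rfl, Nat.sub_self, List.getElem_cons_zero] at htop
    refine sym.sound _ ?_
    simp only [sym, tst_simps, ok_simps, ex_simps, cost_simps]
    refine dfsTop_spec E hu.1.lt (k := s0.length) (by omega) (by omega) hg1 (hI.congr I.fr) htop
      fun t1 v1 e1 V1 ht1 => ?_
    refine dfsNext_spec E hu.1.lt V1 fun t2 v2 e2 ht2 hn => ?_
    simp only at e2 hn
    have x4 : v2 4 = 5 + 3 * G.m := by rw [e2 4 (by omega), e1 4 (by omega)]; exact hg1.2.2.1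
    have x6 : v2 6 = l.length := by rw [e2 6 (by omega), e1 6 (by omega), g6]
    have x10 : v2 10 = s.length := by rw [e2 10 (by omega), e1 10 (by omega), g10]
    refine ⟨by omega, fun hp => ?_, fun hp => ?_⟩
    · rcases hn with ⟨X, hX, hc, hXz⟩ | ⟨h0, -⟩
      swap
      · simp only [h0] at hp; omega
      have hXm := hc.lt hu.1.lt
      rw [I.mem_iff hXm] at hXz
      have I' := I.push hs hc hXz (M' := (g.wr (5 + 3 * G.m + 64 * s.length + 6) X).m)
        (fun a ha => wr_ne _ _ ha) (wr_self _ _ rfl)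
      have hcnt' := I'.count
      rw [List.length_append, List.length_singleton] at hcnt'
      simp only [x4, x10, hX, Nat.add_sub_cancel]
      refine ⟨⟨⟨by omega, ⟨by omega, by omega, by omega⟩, by omega⟩, by omega, by omega⟩,
        ⟨by omega, by omega, by omega⟩, by omega, ⟨by omega, by omega, by omega⟩, ?_⟩
      refine ⟨l, s ++ [X], fun x hx => ?_, ?_, ?_, I', ?_⟩
      · simp only [HS.set, HS.wr, show x ≠ 10 by omega, reduceIte]
        rw [e2 x (by omega), e1 x (by omega), gx x hx]
      · simpa [HS.set, HS.wr] using x6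
      · simp [HS.set]
      · rw [List.length_append, List.length_singleton, show 2 * l.length + (s.length + 1) =
          (2 * l.length + s.length) + 1 by omega, Nat.mul_add _ _ 1]
        omega
    · rcases hn with ⟨X, hX, -⟩ | ⟨h0, hc⟩
      · simp only [hX] at hp; omega
      have hcl : ∀ X, G.Ch u X → X ∈ l := fun X hX => by
        by_contra hcon
        exact hc X hX ((I.mem_iff (hX.lt hu.1.lt)).2 hcon)
      have V2 : VReg G u ⟨v2, g.m⟩ := by
        obtain ⟨y1, y2, y3, y4, y5, y6, y7⟩ := V1
        exact ⟨(e2 _ (by omega)).trans y1, (e2 _ (by omega)).trans y2, (e2 _ (by omega)).trans y3,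
          (e2 _ (by omega)).trans y4, (e2 _ (by omega)).trans y5, (e2 _ (by omega)).trans y6,
          (e2 _ (by omega)).trans y7⟩
      have hg2 : Glob μ c G ⟨v2, g.m⟩ := hg1.congr fun x hx => by
        show v2 x = g.v x
        rw [e2 x (by omega), e1 x (by omega)]
      refine dfsFin_spec E hu.1 V2 hg2 (fun X hX => I.rcd X (hcl X hX)) fun t3 v3 M3 f1 f2 f3 ht3 => ?_
      have y4 : v3 4 = 5 + 3 * G.m := by rw [f1 4 (by omega), ← x4]
      have y6 : v3 6 = l.length := by rw [f1 6 (by omega), ← x6]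
      have y10 : v3 10 = s.length := by rw [f1 10 (by omega), ← x10]
      have y11 : v3 11 = u := by rw [f1 11 (by omega)]; exact V2.r11
      have I' := I.pop hs hcl (M' := (HS.wr ⟨v3, M3⟩ (5 + 3 * G.m + 64 * l.length + 7) u).m)
        (fun a ha ha' => (wr_ne _ _ ha').trans (f2 a ha))
        ⟨(wr_ne _ _ (by omega)).trans f3.1, (wr_ne _ _ (by omega)).trans f3.2.1,
          (wr_ne _ _ (by omega)).trans f3.2.2⟩ (wr_self _ _ rfl)
      have hcnt' := I'.count
      rw [List.length_append, List.length_singleton] at hcnt'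
      simp only [reduceIte, Nat.reduceEqDiff, y4, y6, y10, y11]
      refine ⟨⟨⟨by omega, ⟨by omega, by omega, by omega⟩, by omega⟩, by omega, by omega⟩, by omega,
        by omega, ⟨by omega, by omega, by omega⟩, by omega, ⟨by omega, by omega, by omega⟩, ?_⟩
      refine ⟨l ++ [u], s0, fun x hx => ?_, ?_, ?_, I', ?_⟩
      · simp only [HS.set, HS.wr, show x ≠ 10 by omega, show x ≠ 6 by omega, reduceIte]
        rw [f1 x (by omega)]
        show v2 x = _
        rw [e2 x (by omega), e1 x (by omega), gx x hx]
      · simp [HS.set]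
      · simp [HS.set, hsl]
      · rw [List.length_append, List.length_singleton, show 2 * (l.length + 1) + s0.length =
          (2 * l.length + s.length) + 1 by omega, Nat.mul_add _ _ 1]
        omega
  · rintro t g ⟨l, s, gx, g6, g10, I, ht⟩ hb
    have hcnt := I.count
    simp only [tst_simps, ex_simps] at hb
    have hs : s = [] := List.eq_nil_of_length_eq_zero (by omega)
    subst hs
    refine hQ _ _ _ l gx g6 ⟨I.nodup, I.rch, ?_, I.topo⟩ (by simpa using hcnt) I.fr I.ordr I.rcd ?_
    · simpa using I.root
    · have hm := E.m_pos
      have h5 : 600 * L * (2 * l.length + ([] : List ℕ).length) ≤ 600 * L * (2 * G.m) :=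
        Nat.mul_le_mul_left _ (by simp at hcnt ⊢; omega)
      have h6 : 100 ≤ 100 * L * G.m := by nlinarith
      simp only [tst_simps, cost_simps]
      have h7 : 600 * L * (2 * G.m) + 100 * L * G.m = 1300 * L * G.m := by ring
      omega
  · refine ⟨[], [G.st], fun x hx => ?_, ?_, ?_, ⟨?_, ?_, ?_, ?_, ?_, ?_, ?_, ?_, ?_, ?_, ?_⟩, ?_⟩
    · simp only [HS.set, HS.wr, show x ≠ 10 by omega, show x ≠ 6 by omega, reduceIte]
    · simp [HS.set]
    · simp [HS.set]
    · simp only [HS.set]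
      exact fun a ha => wr_ne _ _ (by omega)
    · simp
    · intro i hi
      simp only [List.length_singleton] at hi
      have : i = 0 := by omega
      subst this
      simp [HS.set, wr_m]
    · simp
    · simp
    · simp
    · intro v hv _
      simp only [HS.set]
      rw [wr_ne _ _ (by omega)]
      exact hz v hv
    · simp
    · simpa using .st
    · simp
    · simp
    · omega

end WhileLang

/-! ### Numbers of occurrences, and symmetric centroid edges -/

namespace WhileLang

open Ex St

/-- The memory lists the variables of `l`. -/
def Lst (VB : ℕ) (l : List ℕ) (M : ℕ → ℕ) : Prop :=
  ∀ i (hi : i < l.length), M (VB + 64 * i + 7) = l[i]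

theorem Lst.congr {VB lo hi : ℕ} {l : List ℕ} {M M' : ℕ → ℕ} (L : Lst VB l M)
    (h : Fr VB lo hi M M') (hlo : 7 < lo) : Lst VB l M' := fun i hi' =>
  (h.fld i 7 (by omega) (Or.inl hlo)).trans (L i hi')

/-- Accumulate the numbers of occurrences. -/
def occP : St := .sto (r 4 + 64 * ld 4 + 12) 1 ;; .asg 10 (r 6) ;;
  .loop (.lt 0 (r 10)) (.asg 10 (r 10 - 1) ;; .asg 11 (ld (r 4 + 64 * r 10 + 7)) ;;
    .asg 12 (5 + 3 * r 11) ;; .asg 13 (ld (r 4 + 64 * r 11 + 12)) ;;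
    .asg 14 (r 4 + 64 * ld (r 12 + 1) + 12) ;;
    .ite (.eq (ld (r 12)) 1) (.sto (r 14) (ld (r 14) + r 13) ;;
        .asg 14 (r 4 + 64 * ld (r 12 + 2) + 12) ;; .sto (r 14) (ld (r 14) + r 13))
      (.ite (.eq (ld (r 12)) 2) (.sto (r 14) (ld (r 14) + r 13 * ld (r 12 + 2))) .skip))

/-- Partial counts never exceed the final ones, so they fit into a word throughout the accumulation.
-/
theorem Gram.occ_append_le (G : Gram) (a b : List ℕ) (v : ℕ) : G.occ b v ≤ G.occ (a ++ b) v := by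
  induction a with
  | nil => exact le_rfl
  | cons x a ih => rw [List.cons_append, occ_cons]; omega

set_option maxHeartbeats 1000000 in
theorem occP_spec {w μ c N : ℕ} {G : Gram} (E : Env w μ c N G) {Q : ℕ → HS → Prop} {l : List ℕ}
    {h : HS} (hg : Glob μ c G h) (h6 : h.v 6 = l.length) (O : G.Ord l) (hlm : l.length ≤ G.m)
    (hI : Inp G h.m) (hL : Lst (5 + 3 * G.m) l h.m)
    (hz : ∀ v < G.m, h.m (5 + 3 * G.m + 64 * v + 12) = 0)
    (hQ : ∀ t v M', (∀ x, x < 10 → v x = h.v x) → Fr (5 + 3 * G.m) 12 13 h.m M' →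
      (∀ v < G.m, M' (5 + 3 * G.m + 64 * v + 12) = G.occ l v) → t ≤ 200 * G.m → Q t ⟨v, M'⟩) :
    WP w occP Q h := by
  have hlin := E.lin
  have h3 := E.m_le
  have hst := G.st_lt
  have hm1 := E.m_pos
  have hg' := hg
  obtain ⟨g2, g3, g4, g5⟩ := hg
  refine sym.sound _ ?_
  simp only [occP, sym, ok_simps, ex_simps, cost_simps, g4, hI.st, h6]
  refine ⟨⟨⟨by omega, ⟨by omega, by omega, by omega⟩, by omega⟩, by omega, by omega⟩, by omega, by omega,
    by omega, ?_⟩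
  refine WP.for l.length 150 (fun i g => (∀ x, x < 10 → g.v x = h.v x) ∧ g.v 10 = l.length - i ∧
    Fr (5 + 3 * G.m) 12 13 h.m g.m ∧
    ∀ v < G.m, g.m (5 + 3 * G.m + 64 * v + 12) = G.occ (l.drop (l.length - i)) v) ?_ ?_ ?_ ?_ ?_
  · rintro i g - -
    simp only [tst_simps, ok_simps]; omega
  · rintro i g hi ⟨-, h10, -⟩
    simp only [tst_simps, ex_simps, h10]; omega
  · rintro i g hi ⟨gx, g10, hF, hocc⟩
    obtain ⟨k, hk⟩ : ∃ k, k = l.length - (i + 1) := ⟨_, rfl⟩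
    have hkl : k < l.length := by omega
    have hu : l[k] ∈ l := List.getElem_mem _
    have hdrop : l.drop k = l[k] :: l.drop (k + 1) := List.drop_eq_getElem_cons hkl
    obtain ⟨u, hue⟩ : ∃ u, l[k] = u := ⟨_, rfl⟩
    rw [hue] at hu hdrop
    have hum := O.lt hu
    rw [show l.length - i = k + 1 by omega] at g10 hocc
    have hI' := hI.congr hF
    have i1 := hI'.kd u hum
    have i2 := hI'.a1 u hum
    have i3 := hI'.a2 u hum
    have b1 := E.a1_le u hum
    have b2 := E.a2_le u hum
    have hord := (hL.congr hF (by omega)) k hkl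
    rw [hue] at hord
    have x4 : g.v 4 = 5 + 3 * G.m := by rw [gx 4 (by omega), g4]
    have hbd : ∀ X, G.Ch u X → G.occ (l.drop (k + 1)) X + G.mul u X * G.occ (l.drop (k + 1)) u ≤ N := by
      intro X hX
      have e1 := G.occ_append_le (l.take k) (l.drop k) X
      rw [List.take_append_drop, hdrop, Gram.occ_cons] at e1
      have e2 := O.occ_le (O.ch_mem hu hX)
      have e3 := E.len_le
      omega
    refine sym.sound _ ?_
    simp only [sym, tst_simps, ok_simps, ex_simps, cost_simps, reduceIte, Nat.reduceEqDiff, x4, g10,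
      Nat.add_sub_cancel, hord, i1, i2, i3, hocc u hum]
    refine ⟨by omega, ⟨by omega, by omega, by omega⟩, by omega, ⟨⟨by omega, ⟨by omega, by omega, by omega⟩,
      by omega⟩, by omega, by omega⟩, by omega, ⟨by omega, ⟨by omega, by omega, by omega⟩, by omega⟩, by omega,
      ⟨⟨by omega, ⟨by omega, by omega, by omega⟩, by omega⟩, by omega, by omega⟩, by omega,
      ⟨⟨by omega, ⟨by omega, ⟨by omega, by omega, by omega⟩, by omega⟩, by omega⟩, by omega, by omega⟩,
      ⟨by omega, by omega⟩, fun k1 => ?_, fun k1 => ⟨⟨by omega, by omega⟩, fun k2 => ?_, fun k2 => ?_⟩⟩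
    · obtain ⟨l1, l2, hs⟩ := G.pair u hum k1
      have m1 := hbd _ (Or.inl ⟨k1, Or.inl rfl⟩)
      have m2 := hbd _ (Or.inl ⟨k1, Or.inr rfl⟩)
      simp only [Gram.mul, k1, reduceIte] at m1 m2
      have hw : ∀ f, f ≤ 2 → 5 + 3 * u + f ≠ 5 + 3 * G.m + 64 * G.a1 u + 12 := fun f hf => by omega
      -- If both children coincide, the second addition reads what the first has just written, and
      -- the count is added twice, as it must be.
      have hw' : (g.wr (5 + 3 * G.m + 64 * G.a1 u + 12)
          (G.occ (l.drop (k + 1)) (G.a1 u) + G.occ (l.drop (k + 1)) u)).m (5 + 3 * G.m + 64 * G.a2 u + 12) =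
          G.occ (l.drop (k + 1)) (G.a2 u) +
            (if G.a1 u = G.a2 u then G.occ (l.drop (k + 1)) u else 0) := by
        rw [wr_m]
        split_ifs with q1 q2 q2
        · rw [← q2]
        · omega
        · omega
        · exact hocc _ l2
      simp only [HS.set, hocc _ l1]
      simp only [HS.wr] at hw' ⊢
      simp only [hw 2 le_rfl, if_neg, i3, hw', not_false_eq_true]
      have hsum : G.occ (l.drop (k + 1)) (G.a2 u) +
          (if G.a1 u = G.a2 u then G.occ (l.drop (k + 1)) u else 0) + G.occ (l.drop (k + 1)) u ≤ N := by
        refine le_trans (le_of_eq ?_) m2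
        split_ifs <;> ring
      have hsum1 : G.occ (l.drop (k + 1)) (G.a1 u) + G.occ (l.drop (k + 1)) u ≤ N := by
        refine le_trans ?_ m1
        split_ifs <;> nlinarith
      refine ⟨by omega, ⟨by omega, by omega, by omega⟩, by omega, ⟨⟨by omega, ⟨by omega, ⟨by omega, by omega,
        by omega⟩, by omega⟩, by omega⟩, by omega, by omega⟩, by omega, ⟨by omega, by omega, by omega⟩,
        ⟨fun x hx => ?_, ?_, ?_, ?_⟩, by omega⟩
      · rw [if_neg (by omega), if_neg (by omega), if_neg (by omega), if_neg (by omega),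
          if_neg (by omega), if_neg (by omega)]
        exact gx x hx
      · simp [hk]
      · intro a ha
        simp only [show a ≠ 5 + 3 * G.m + 64 * G.a1 u + 12 by omega,
          show a ≠ 5 + 3 * G.m + 64 * G.a2 u + 12 by omega, reduceIte]
        exact hF a ha
      · intro v hv
        rw [← hk, hdrop, Gram.occ_cons, Gram.mul, if_pos k1]
        by_cases v2 : v = G.a2 u
        · subst v2
          simp only [reduceIte]
          split_ifs <;> ring
        · have n2 : 5 + 3 * G.m + 64 * v + 12 ≠ 5 + 3 * G.m + 64 * G.a2 u + 12 := by omega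
          simp only [n2, reduceIte, if_neg (Ne.symm v2)]
          by_cases v1 : v = G.a1 u
          · subst v1
            simp
          · have n1 : 5 + 3 * G.m + 64 * v + 12 ≠ 5 + 3 * G.m + 64 * G.a1 u + 12 := by omega
            simp only [n1, reduceIte, if_neg (Ne.symm v1), hocc v hv]
            omega
    · obtain ⟨l1, l2, hs⟩ := G.run u hum k2
      have m1 := hbd _ (Or.inr ⟨k2, rfl⟩)
      simp only [Gram.mul, k2, reduceIte, Nat.reduceEqDiff] at m1
      simp only [HS.set, hocc _ l1]
      rw [mul_comm (G.a2 u)] at m1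
      refine ⟨by omega, ⟨by omega, ⟨by omega, ⟨by omega, by omega, by omega⟩, by omega⟩, by omega⟩,
        ⟨fun x hx => ?_, ?_, ?_, ?_⟩, by omega⟩
      · rw [if_neg (by omega), if_neg (by omega), if_neg (by omega), if_neg (by omega),
          if_neg (by omega)]
        exact gx x hx
      · simp [HS.wr, hk]
      · intro a ha
        simp only [wr_m, show a ≠ 5 + 3 * G.m + 64 * G.a1 u + 12 by omega, reduceIte]
        exact hF a ha
      · intro v hv
        rw [← hk, hdrop, Gram.occ_cons, Gram.mul, if_neg (by omega), if_pos k2, wr_m]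
        by_cases v1 : v = G.a1 u
        · subst v1
          simp only [reduceIte]
          ring
        · have n1 : 5 + 3 * G.m + 64 * v + 12 ≠ 5 + 3 * G.m + 64 * G.a1 u + 12 := by omega
          simp only [n1, reduceIte, if_neg (Ne.symm v1), hocc v hv]
          omega
    · refine ⟨⟨fun x hx => ?_, ?_, hF, ?_⟩, by omega⟩
      · rw [if_neg (by omega), if_neg (by omega), if_neg (by omega), if_neg (by omega),
          if_neg (by omega)]
        exact gx x hx
      · simp [HS.set, hk]
      · intro v hv
        rw [← hk, hdrop, Gram.occ_cons, Gram.mul, if_neg k1, if_neg k2]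
        rw [hocc v hv]; omega
  · rintro t g ⟨gx, g10, hF, hocc⟩ ht
    rw [Nat.sub_self, List.drop_zero] at hocc
    refine hQ _ _ _ gx hF hocc ?_
    simp only [tst_simps, cost_simps] at ht ⊢
    omega
  · refine ⟨fun x hx => ?_, ?_, ?_, fun v hv => ?_⟩
    · simp only [HS.set, HS.wr, show x ≠ 10 by omega, reduceIte]
    · simp [HS.set]
    · exact Fr.wr _ _ _ (by omega) (by omega) (by omega) _ Fr.refl
    · simp only [HS.set, wr_m, Nat.sub_zero, List.drop_length]
      by_cases hvs : v = G.st
      · subst hvs; simp [Gram.occ]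
      · have : 5 + 3 * G.m + 64 * v + 12 ≠ 5 + 3 * G.m + 64 * G.st + 12 := by omega
        rw [if_neg this, hz v hv]
        simp [Gram.occ, hvs]

/-- Compute the largest powers of 2 below the lengths and the numbers of occurrences. -/
def powP : St := .asg 10 0 ;; .loop (.lt (r 10) (r 6)) (.asg 11 (r 4 + 64 * ld (r 4 + 64 * r 10 + 7)) ;;
  .asg 40 (ld (r 11 + 3)) ;; .call flog ;; .sto (r 11 + 13) (r 41) ;; .asg 40 (ld (r 11 + 12)) ;;
  .call flog ;; .sto (r 11 + 14) (r 41) ;; .asg 10 (r 10 + 1))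

theorem powP_spec {w μ c N : ℕ} {G : Gram} (E : Env w μ c N G) {Q : ℕ → HS → Prop} {l : List ℕ}
    {h : HS} (hg : Glob μ c G h) (h6 : h.v 6 = l.length) (O : G.Ord l) (hlm : l.length ≤ G.m)
    (hL : Lst (5 + 3 * G.m) l h.m) (hl : ∀ v ∈ l, h.m (5 + 3 * G.m + 64 * v + 3) = G.len v)
    (ho : ∀ v ∈ l, h.m (5 + 3 * G.m + 64 * v + 12) = G.occ l v)
    (hQ : ∀ t v M', (∀ x, x < 10 → v x = h.v x) → Fr (5 + 3 * G.m) 13 15 h.m M' →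
      (∀ v ∈ l, M' (5 + 3 * G.m + 64 * v + 13) = 2 ^ Nat.log 2 (G.len v) ∧
        M' (5 + 3 * G.m + 64 * v + 14) = 2 ^ Nat.log 2 (G.occ l v)) →
      t ≤ 200 * (Nat.log 2 (G.len G.st) + 1) * G.m → Q t ⟨v, M'⟩) :
    WP w powP Q h := by
  have hlin := E.lin
  have h3 := E.m_le
  have hN := E.len_le
  have hm1 := E.m_pos
  obtain ⟨g2, g3, g4, g5⟩ := hg
  set L := Nat.log 2 (G.len G.st) + 1 with hLdef
  refine sym.sound _ ?_
  simp only [powP, sym, ok_simps, ex_simps, cost_simps]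
  refine ⟨by omega, by omega, ?_⟩
  refine WP.for l.length (150 * L) (fun i g => (∀ x, x < 10 → g.v x = h.v x) ∧ g.v 10 = i ∧
    Fr (5 + 3 * G.m) 13 15 h.m g.m ∧
    ∀ j (hj : j < l.length), j < i → g.m (5 + 3 * G.m + 64 * l[j] + 13) = 2 ^ Nat.log 2 (G.len l[j]) ∧
        g.m (5 + 3 * G.m + 64 * l[j] + 14) = 2 ^ Nat.log 2 (G.occ l l[j])) ?_ ?_ ?_ ?_ ?_
  · rintro i g - -
    simp only [tst_simps, ok_simps]; omega
  · rintro i g hi ⟨gx, h10, -⟩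
    simp only [tst_simps, ex_simps, h10, gx 6 (by omega), h6]
  · rintro i g hi ⟨gx, g10, hF, hp⟩
    have hu : l[i] ∈ l := List.getElem_mem _
    obtain ⟨u, hue⟩ : ∃ u, l[i] = u := ⟨_, rfl⟩
    rw [hue] at hu
    have hum := O.lt hu
    have hord := (hL.congr hF (by omega)) i hi
    rw [hue] at hord
    have x4 : g.v 4 = 5 + 3 * G.m := by rw [gx 4 (by omega), g4]
    have y1 : g.m (5 + 3 * G.m + 64 * u + 3) = G.len u :=
      (hF.fld u 3 (by omega) (by omega)).trans (hl u hu)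
    have y2 : g.m (5 + 3 * G.m + 64 * u + 12) = G.occ l u :=
      (hF.fld u 12 (by omega) (by omega)).trans (ho u hu)
    have z1 := O.len_le hu
    have z2 := O.occ_le hu
    have z3 : Nat.log 2 (G.len u) ≤ Nat.log 2 (G.len G.st) := Nat.log_mono_right z1
    have z4 : Nat.log 2 (G.occ l u) ≤ Nat.log 2 (G.len G.st) := Nat.log_mono_right z2
    refine sym.sound _ ?_
    simp only [sym, tst_simps, ok_simps, ex_simps, cost_simps, reduceIte, Nat.reduceEqDiff, x4, g10,
      hord, y1]
    refine ⟨by omega, ⟨by omega, ⟨by omega, ⟨⟨by omega, ⟨by omega, by omega, by omega⟩, by omega⟩,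
      by omega, by omega⟩, by omega⟩, by omega⟩, by omega, ⟨by omega, by omega, by omega⟩, ?_⟩
    refine flog_spec (by simp [HS.set]; omega) fun t1 v1 e1 e2 ht1 => ?_
    have x11 := e1 11 (by omega)
    simp only [HS.set, reduceIte, Nat.reduceEqDiff] at x11 e2 ht1
    simp only [HS.set, x11, e2]
    refine ⟨⟨by omega, by omega, by omega⟩, by omega, by omega, ⟨by omega, by omega, by omega⟩, ?_⟩
    have n1 : 5 + 3 * G.m + 64 * u + 12 ≠ 5 + 3 * G.m + 64 * u + 13 := by omega
    simp only [HS.wr, n1, reduceIte, y2]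
    refine flog_spec (by simp; omega) fun t2 v2 f1 f2 ht2 => ?_
    have w11 := f1 11 (by omega)
    have w10 := f1 10 (by omega)
    have x10 := e1 10 (by omega)
    simp only [HS.set, reduceIte, Nat.reduceEqDiff, x11, g10] at w11 w10 f2 ht2 x10
    simp only [w11, w10, f2, x10]
    refine ⟨⟨by omega, by omega, by omega⟩, by omega, by omega, ⟨by omega, by omega, by omega⟩,
      ⟨fun x hx => ?_, by simp, ?_, ?_⟩, by omega⟩
    · have f := f1 x (by omega)
      have e := e1 x (by omega)
      simp only [HS.set, show x ≠ 40 by omega, show x ≠ 11 by omega, show x ≠ 10 by omega, reduceIte] at f e ⊢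
      rw [f, e, gx x hx]
    · intro a ha
      simp only [show a ≠ 5 + 3 * G.m + 64 * u + 13 by omega, show a ≠ 5 + 3 * G.m + 64 * u + 14 by omega,
        reduceIte]
      exact hF a ha
    · intro j hj hji
      by_cases hju : l[j] = u
      · rw [hju]; simp
      · have hji' : j ≠ i := fun hh => hju (by subst hh; exact hue)
        have := hp j hj (by omega)
        simp only [show 5 + 3 * G.m + 64 * l[j] + 13 ≠ 5 + 3 * G.m + 64 * u + 13 by omega,
          show 5 + 3 * G.m + 64 * l[j] + 13 ≠ 5 + 3 * G.m + 64 * u + 14 by omega,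
          show 5 + 3 * G.m + 64 * l[j] + 14 ≠ 5 + 3 * G.m + 64 * u + 13 by omega,
          show 5 + 3 * G.m + 64 * l[j] + 14 ≠ 5 + 3 * G.m + 64 * u + 14 by omega, reduceIte]
        exact this
  · rintro t g ⟨gx, g10, hF, hp⟩ ht
    refine hQ _ _ _ gx hF (fun v hv => ?_) ?_
    · obtain ⟨j, hj, rfl⟩ := List.getElem_of_mem hv
      exact hp j hj hj
    · simp only [tst_simps, cost_simps] at ht ⊢
      have h5 : l.length * (150 * L) ≤ G.m * (150 * L) := Nat.mul_le_mul_right _ hlm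
      have h6 : 50 * 1 ≤ 50 * L * G.m := by nlinarith
      have h7 : G.m * (150 * L) + 50 * L * G.m = 200 * L * G.m := by ring
      omega
  · refine ⟨fun x hx => ?_, ?_, Fr.refl, fun j hj hj0 => absurd hj0 (by omega)⟩
    · simp only [HS.set, show x ≠ 10 by omega, reduceIte]
    · simp [HS.set]

end WhileLang

/-! ### Symmetric centroid edges in memory -/

namespace WhileLang

open Ex St

/-- Register the edge from `r11` to `r15` if it is a symmetric centroid edge. -/
def scEdge : St := .asg 16 (r 4 + 64 * r 15) ;;
  .ite (.eq (ld (r 16 + 13)) (ld (r 13 + 13)))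
    (.ite (.eq (ld (r 16 + 14)) (ld (r 13 + 14)))
      (.sto (r 13 + 15) (r 15 + 1) ;; .sto (r 16 + 16) (r 11 + 1)) .skip) .skip

/-- Find the symmetric centroid edges. -/
def scP : St := .asg 10 0 ;; .loop (.lt (r 10) (r 6)) (.asg 11 (ld (r 4 + 64 * r 10 + 7)) ;;
  .asg 12 (5 + 3 * r 11) ;; .asg 13 (r 4 + 64 * r 11) ;;
  .ite (.eq (ld (r 12)) 1) (.asg 15 (ld (r 12 + 1)) ;; .call scEdge ;; .asg 15 (ld (r 12 + 2)) ;;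
    .call scEdge) .skip ;; .asg 10 (r 10 + 1))

/-- The memory contains the edges in `P`, forward and backward. -/
structure Edges (VB m : ℕ) (P : ℕ → ℕ → Prop) (M : ℕ → ℕ) : Prop where
  nx : ∀ a b, P a b → M (VB + 64 * a + 15) = b + 1
  pa : ∀ a b, P a b → M (VB + 64 * b + 16) = a + 1
  nx_ne : ∀ a < m, M (VB + 64 * a + 15) ≠ 0 → ∃ b, P a b
  pa_ne : ∀ b < m, M (VB + 64 * b + 16) ≠ 0 → ∃ a, P a b

theorem Edges.iff {VB m : ℕ} {P P' : ℕ → ℕ → Prop} {M : ℕ → ℕ} (I : Edges VB m P M)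
    (h : ∀ a b, P a b ↔ P' a b) : Edges VB m P' M := by
  have : P = P' := funext fun a => funext fun b => propext (h a b)
  rwa [← this]

theorem Edges.congr {VB m lo hi : ℕ} {P : ℕ → ℕ → Prop} {M M' : ℕ → ℕ} (I : Edges VB m P M)
    (h : Fr VB lo hi M M') (hl : 17 ≤ lo ∨ hi ≤ 15) : Edges VB m P M' := by
  have e1 : ∀ a, M' (VB + 64 * a + 15) = M (VB + 64 * a + 15) := fun a =>
    h.fld a 15 (by omega) (by omega)
  have e2 : ∀ a, M' (VB + 64 * a + 16) = M (VB + 64 * a + 16) := fun a =>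
    h.fld a 16 (by omega) (by omega)
  refine ⟨fun a b hp => (e1 a).trans (I.nx a b hp), fun a b hp => (e2 b).trans (I.pa a b hp),
    fun a ha hn => ?_, fun b hb hn => ?_⟩
  · rw [e1] at hn; exact I.nx_ne a ha hn
  · rw [e2] at hn; exact I.pa_ne b hb hn

/-- Powers of 2 below lengths and numbers of occurrences. -/
def Pows (G : Gram) (l : List ℕ) (M : ℕ → ℕ) : Prop :=
  ∀ v ∈ l, M (5 + 3 * G.m + 64 * v + 13) = 2 ^ Nat.log 2 (G.len v) ∧
    M (5 + 3 * G.m + 64 * v + 14) = 2 ^ Nat.log 2 (G.occ l v)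

theorem Pows.congr {G : Gram} {l : List ℕ} {lo hi : ℕ} {M M' : ℕ → ℕ} (I : Pows G l M)
    (h : Fr (5 + 3 * G.m) lo hi M M') (hl : 15 ≤ lo) : Pows G l M' := fun v hv =>
  ⟨(h.fld v 13 (by omega) (by omega)).trans (I v hv).1,
    (h.fld v 14 (by omega) (by omega)).trans (I v hv).2⟩

/-- Logarithms are compared through the stored powers of 2. As a variable has at most one symmetric
centroid child and parent, one field per direction suffices, and a write never destroys another
edge. -/
theorem scEdge_spec {w μ c N u X : ℕ} {G : Gram} (E : Env w μ c N G) {Q : ℕ → HS → Prop}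
    {l : List ℕ} {h : HS} {P : ℕ → ℕ → Prop} (O : G.Ord l) (hp : Pows G l h.m) (hu : u ∈ l)
    (hX : G.Ch u X) (h4 : h.v 4 = 5 + 3 * G.m) (h11 : h.v 11 = u)
    (h13 : h.v 13 = 5 + 3 * G.m + 64 * u) (h15 : h.v 15 = X)
    (hP : ∀ a b, P a b → a ∈ l ∧ G.SC l a b) (I : Edges (5 + 3 * G.m) G.m P h.m)
    (hQ : ∀ t v M', (∀ x, x < 16 → v x = h.v x) → Fr (5 + 3 * G.m) 15 17 h.m M' →
      Edges (5 + 3 * G.m) G.m (fun a b => P a b ∨ (a = u ∧ b = X ∧ G.SC l a b)) M' →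
      t ≤ 50 → Q t ⟨v, M'⟩) : WP w scEdge Q h := by
  have hlin := E.lin
  have h3 := E.m_le
  have hum := O.lt hu
  have hXm := hX.lt hum
  have hXl := O.ch_mem hu hX
  obtain ⟨p1, p2⟩ := hp u hu
  obtain ⟨q1, q2⟩ := hp X hXl
  have inj : ∀ {a b}, 2 ^ a = 2 ^ b ↔ a = b := fun {a b} =>
    ⟨fun hh => Nat.pow_right_injective le_rfl hh, fun hh => hh ▸ rfl⟩
  refine sym.sound _ ?_
  simp only [scEdge, sym, tst_simps, ok_simps, ex_simps, cost_simps, reduceIte, Nat.reduceEqDiff,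
    h4, h11, h13, h15, p1, p2, q1, q2, inj]
  refine ⟨by omega, ⟨by omega, ⟨by omega, by omega, by omega⟩, by omega⟩, ⟨⟨by omega, by omega, by omega⟩,
    by omega, by omega, by omega⟩, fun k1 => ⟨⟨⟨by omega, by omega, by omega⟩,
    by omega, by omega, by omega⟩, fun k2 => ⟨⟨by omega, by omega, by omega⟩, ⟨by omega, by omega, by omega⟩,
    ⟨by omega, by omega, by omega⟩, ⟨by omega, by omega, by omega⟩, ?_⟩, fun k2 => ?_⟩, fun k1 => ?_⟩
  · have hs : G.SC l u X := ⟨hX, k1.symm, k2.symm⟩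
    refine hQ _ _ _ (fun x hx => ?_) (fun a ha => ?_) ⟨fun a b hab => ?_, fun a b hab => ?_,
      fun a ha hn => ?_, fun b hb hn => ?_⟩ (by norm_num)
    · simp only [HS.set, HS.wr, show x ≠ 16 by omega, reduceIte]
    · simp only [HS.set, wr_m, show a ≠ 5 + 3 * G.m + 64 * u + 15 by omega,
        show a ≠ 5 + 3 * G.m + 64 * X + 16 by omega, reduceIte]
    · simp only [HS.set, wr_m]
      rw [if_neg (by omega)]
      by_cases hau : a = u
      · subst hau
        rw [if_pos rfl]
        rcases hab with hab | ⟨-, rfl, -⟩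
        · rw [O.sc_child_unique hu (hP _ _ hab).2 hs]
        · rfl
      · rw [if_neg (by omega)]
        rcases hab with hab | ⟨rfl, -⟩
        · exact I.nx a b hab
        · exact absurd rfl hau
    · simp only [HS.set, wr_m]
      by_cases hbX : b = X
      · subst hbX
        rw [if_pos rfl]
        rcases hab with hab | ⟨rfl, -⟩
        · rw [O.sc_parent_unique (hP _ _ hab).1 hu (hP _ _ hab).2 hs]
        · rfl
      · rw [if_neg (by omega), if_neg (by omega)]
        rcases hab with hab | ⟨-, rfl, -⟩
        · exact I.pa a b hab
        · exact absurd rfl hbX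
    · simp only [HS.set, wr_m] at hn
      rw [if_neg (by omega)] at hn
      by_cases hau : a = u
      · subst hau
        exact ⟨X, Or.inr ⟨rfl, rfl, hs⟩⟩
      · rw [if_neg (by omega)] at hn
        exact (I.nx_ne a ha hn).imp fun _ => Or.inl
    · simp only [HS.set, wr_m] at hn
      by_cases hbX : b = X
      · subst hbX
        exact ⟨u, Or.inr ⟨rfl, rfl, hs⟩⟩
      · rw [if_neg (by omega), if_neg (by omega)] at hn
        exact (I.pa_ne b hb hn).imp fun _ => Or.inl
  all_goals
    refine hQ _ _ _ (fun x hx => ?_) Fr.refl ?_ (by norm_num)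
    · simp only [HS.set, show x ≠ 16 by omega, reduceIte]
    · refine I.iff fun a b => ⟨Or.inl, ?_⟩
      rintro (hab | ⟨rfl, rfl, hs⟩)
      · exact hab
      · first
          | exact absurd hs.2.2.symm k2
          | exact absurd hs.2.1.symm k1

/-- Only pair rules need to be examined, by `sc_kd`. -/
theorem scP_spec {w μ c N : ℕ} {G : Gram} (E : Env w μ c N G) {Q : ℕ → HS → Prop} {l : List ℕ}
    {h : HS} (hg : Glob μ c G h) (h6 : h.v 6 = l.length) (O : G.Ord l) (hlm : l.length ≤ G.m)
    (hI : Inp G h.m) (hL : Lst (5 + 3 * G.m) l h.m) (hp : Pows G l h.m)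
    (hz : ∀ v < G.m, h.m (5 + 3 * G.m + 64 * v + 15) = 0 ∧ h.m (5 + 3 * G.m + 64 * v + 16) = 0)
    (hQ : ∀ t v M', (∀ x, x < 10 → v x = h.v x) → Fr (5 + 3 * G.m) 15 17 h.m M' →
      Edges (5 + 3 * G.m) G.m (fun a b => a ∈ l ∧ G.SC l a b) M' →
      t ≤ 250 * G.m → Q t ⟨v, M'⟩) :
    WP w scP Q h := by
  have hlin := E.lin
  have h3 := E.m_le
  have hm1 := E.m_pos
  obtain ⟨g2, g3, g4, g5⟩ := hg
  refine sym.sound _ ?_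
  simp only [scP, sym, ok_simps, ex_simps, cost_simps]
  refine ⟨by omega, by omega, ?_⟩
  refine WP.for l.length 200 (fun i g => (∀ x, x < 10 → g.v x = h.v x) ∧ g.v 10 = i ∧
    Fr (5 + 3 * G.m) 15 17 h.m g.m ∧
    Edges (5 + 3 * G.m) G.m (fun a b => a ∈ l.take i ∧ G.SC l a b) g.m) ?_ ?_ ?_ ?_ ?_
  · rintro i g - -
    simp only [tst_simps, ok_simps]; omega
  · rintro i g hi ⟨gx, h10, -⟩
    simp only [tst_simps, ex_simps, h10, gx 6 (by omega), h6]
  · rintro i g hi ⟨gx, g10, hF, I⟩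
    have hu : l[i] ∈ l := List.getElem_mem _
    obtain ⟨u, hue⟩ : ∃ u, l[i] = u := ⟨_, rfl⟩
    rw [hue] at hu
    have hum := O.lt hu
    have hord := (hL.congr hF (by omega)) i hi
    rw [hue] at hord
    have x4 : g.v 4 = 5 + 3 * G.m := by rw [gx 4 (by omega), g4]
    have hI' := hI.congr hF
    have i1 := hI'.kd u hum
    have i2 := hI'.a1 u hum
    have hmem : ∀ a, a ∈ l.take (i + 1) ↔ a ∈ l.take i ∨ a = u := by
      intro a
      rw [List.take_succ_eq_append_getElem hi, List.mem_append, List.mem_singleton, hue]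
    have hle : ∀ a, a ∈ l.take i → a ∈ l := fun a => List.mem_of_mem_take
    refine sym.sound _ ?_
    simp only [sym, tst_simps, ok_simps, ex_simps, cost_simps, reduceIte, Nat.reduceEqDiff, x4, g10,
      hord, i1, i2]
    refine ⟨by omega, ⟨⟨by omega, ⟨by omega, by omega, by omega⟩, by omega⟩, by omega, by omega⟩, by omega,
      ⟨by omega, ⟨by omega, by omega, by omega⟩, by omega⟩, by omega, ⟨by omega, ⟨by omega, by omega,
      by omega⟩, by omega⟩, ⟨by omega, by omega⟩, fun k1 => ⟨by omega, ⟨by omega, by omega, by omega⟩, ?_⟩,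
      fun k1 => ⟨by omega, ⟨by omega, by omega, by omega⟩, ⟨fun x hx => ?_, ?_, hF, ?_⟩, by omega⟩⟩
    · refine scEdge_spec E O (l := l) (u := u) (X := G.a1 u) (P := fun a b => a ∈ l.take i ∧ G.SC l a b)
        (hp.congr hF le_rfl) hu (Or.inl ⟨k1, Or.inl rfl⟩) (by simp [HS.set, x4]) (by simp [HS.set])
        (by simp [HS.set]) (by simp [HS.set]) (fun a b hab => ⟨hle a hab.1, hab.2⟩) I
        fun t1 v1 M1 e1 F1 I1 ht1 => ?_
      have y12 := e1 12 (by omega)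
      have y4 := e1 4 (by omega)
      have y11 := e1 11 (by omega)
      have y13 := e1 13 (by omega)
      simp only [HS.set, reduceIte, Nat.reduceEqDiff, x4] at y12 y4 y11 y13
      have F1' := hF.trans F1
      have i3 := (hI.congr F1').a2 u hum
      simp only [y12, i3]
      refine ⟨by omega, ⟨by omega, by omega, by omega⟩, ?_⟩
      refine scEdge_spec E O (l := l) (u := u) (X := G.a2 u) (hp.congr F1' le_rfl) hu
        (Or.inl ⟨k1, Or.inr rfl⟩) (by simp [HS.set, y4]) (by simp [HS.set, y11])
        (by simp [HS.set, y13]) (by simp [HS.set]) (fun a b hab => ?_) I1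
        fun t2 v2 M2 f1 F2 I2 ht2 => ?_
      · rcases hab with hab | ⟨rfl, -, hab⟩
        · exact ⟨hle a hab.1, hab.2⟩
        · exact ⟨hu, hab⟩
      have z10 := f1 10 (by omega)
      have y10 := e1 10 (by omega)
      simp only [HS.set, reduceIte, Nat.reduceEqDiff, g10] at z10 y10
      simp only [z10, y10]
      refine ⟨by omega, ⟨by omega, by omega, by omega⟩, ⟨fun x hx => ?_, by simp [HS.set],
        F1'.trans F2, ?_⟩, by omega⟩
      · have f := f1 x (by omega)
        have e := e1 x (by omega)
        simp only [HS.set, show x ≠ 10 by omega, show x ≠ 11 by omega, show x ≠ 12 by omega,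
          show x ≠ 13 by omega, show x ≠ 15 by omega, reduceIte] at f e ⊢
        rw [f, e, gx x hx]
      · refine I2.iff fun a b => ?_
        rw [hmem]
        constructor
        · rintro ((hab | ⟨rfl, -, hab⟩) | ⟨rfl, -, hab⟩)
          · exact ⟨Or.inl hab.1, hab.2⟩
          · exact ⟨Or.inr rfl, hab⟩
          · exact ⟨Or.inr rfl, hab⟩
        · rintro ⟨ha | rfl, hab⟩
          · exact Or.inl (Or.inl ⟨ha, hab⟩)
          · rcases hab.1 with ⟨-, rfl | rfl⟩ | ⟨k2, -⟩
            · exact Or.inl (Or.inr ⟨rfl, rfl, hab⟩)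
            · exact Or.inr ⟨rfl, rfl, hab⟩
            · omega
    · simp only [HS.set, show x ≠ 10 by omega, show x ≠ 11 by omega, show x ≠ 12 by omega,
          show x ≠ 13 by omega, reduceIte]
      exact gx x hx
    · simp [HS.set]
    · refine I.iff fun a b => ?_
      rw [hmem]
      refine ⟨fun hab => ⟨Or.inl hab.1, hab.2⟩, ?_⟩
      rintro ⟨ha | rfl, hab⟩
      · exact ⟨ha, hab⟩
      · exact absurd (O.sc_kd hu hab).1 k1
  · rintro t g ⟨gx, g10, hF, I⟩ ht
    rw [List.take_length] at I
    refine hQ _ _ _ gx hF I ?_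
    simp only [tst_simps, cost_simps] at ht ⊢
    omega
  · refine ⟨fun x hx => ?_, ?_, Fr.refl, ⟨by simp, by simp, fun a ha hn => absurd (hz a ha).1 hn,
      fun b hb hn => absurd (hz b hb).2 hn⟩⟩
    · simp only [HS.set, show x ≠ 10 by omega, reduceIte]
    · simp [HS.set]

end WhileLang

/-! ### Placing the variables on positions, path by path -/

namespace WhileLang

open Ex St

/-- Placement of some variables of `l` on the positions `1, …, n`. -/
structure Plc (G : Gram) (l : List ℕ) (n : ℕ) (va pid : ℕ → ℕ) : Prop where
  inj : ∀ x y, 1 ≤ x → x ≤ n → 1 ≤ y → y ≤ n → va x = va y → x = y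
  mem : ∀ x, 1 ≤ x → x ≤ n → va x ∈ l
  pid_out : ∀ x, x = 0 ∨ n < x → pid x = 0
  pid_pos : ∀ x, 1 ≤ x → x ≤ n → 1 ≤ pid x ∧ pid x ≤ x
  bot : ∀ x, 1 ≤ x → x ≤ n → pid x = x → ∀ X, ¬ G.SC l (va x) X
  sc : ∀ x, 1 ≤ x → x ≤ n → pid x ≠ x → G.SC l (va x) (va (x - 1)) ∧ pid (x - 1) = pid x

/-- Position of a variable. -/
def Placed (n : ℕ) (va : ℕ → ℕ) (v : ℕ) : Prop := ∃ x, 1 ≤ x ∧ x ≤ n ∧ va x = v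

theorem Plc.le_length {G : Gram} {l : List ℕ} {n : ℕ} {va pid : ℕ → ℕ} (P : Plc G l n va pid) :
    n ≤ l.length := by
  have h1 : (Finset.Icc 1 n).image va ⊆ l.toFinset := by
    intro v hv
    obtain ⟨x, hx, rfl⟩ := Finset.mem_image.1 hv
    rw [Finset.mem_Icc] at hx
    exact List.mem_toFinset.2 (P.mem x hx.1 hx.2)
  have h2 := Finset.card_le_card h1
  rw [Finset.card_image_of_injOn, Nat.card_Icc] at h2
  · have := l.toFinset_card_le; omega
  · intro x hx y hy hxy
    simp only [Finset.coe_Icc, Set.mem_Icc] at hx hy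
    exact P.inj x y hx.1 hx.2 hy.1 hy.2 hxy

/-- State of the placement before the variable `u` of the list, with the variables of `A` as possible
ends of paths; `y` stands for the next variable `y - 1` of the path that ends at position `b`. -/
structure Walk (G : Gram) (l : List ℕ) (A : List ℕ) (n : ℕ) (va pid : ℕ → ℕ) (y b : ℕ) : Prop where
  plc : Plc G l n va pid
  bots : ∀ x, 1 ≤ x → x ≤ n → pid x = x → va x ∈ A
  done : ∀ v ∈ A, (∀ X, ¬ G.SC l v X) → Placed n va v ∨ v + 1 = y
  up : ∀ x, 1 ≤ x → x ≤ n → ∀ u ∈ l, G.SC l u (va x) → Placed n va u ∨ u + 1 = y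
  cur : y ≠ 0 → y - 1 ∈ l ∧ ¬ Placed n va (y - 1) ∧
    ((b = n + 1 ∧ y - 1 ∈ A ∧ ∀ X, ¬ G.SC l (y - 1) X) ∨
      (1 ≤ n ∧ b = pid n ∧ G.SC l (y - 1) (va n)))

theorem Walk.step {G : Gram} {l A : List ℕ} {n : ℕ} {va pid va' pid' : ℕ → ℕ} {y y' b : ℕ}
    (O : G.Ord l) (W : Walk G l A n va pid y b) (hy : y ≠ 0)
    (hva : ∀ x, x ≠ n + 1 → va' x = va x) (hpid : ∀ x, x ≠ n + 1 → pid' x = pid x)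
    (hvn : va' (n + 1) = y - 1) (hpn : pid' (n + 1) = b)
    (h1 : ∀ a ∈ l, G.SC l a (y - 1) → y' = a + 1)
    (h2 : y' ≠ 0 → ∃ a ∈ l, G.SC l a (y - 1)) : Walk G l A (n + 1) va' pid' y' b := by
  obtain ⟨c1, c2, c3⟩ := W.cur hy
  have P := W.plc
  have hpl : ∀ v, Placed (n + 1) va' v ↔ Placed n va v ∨ v = y - 1 := by
    intro v
    constructor
    · rintro ⟨x, x1, x2, rfl⟩
      by_cases hx : x = n + 1
      · subst hx; exact Or.inr hvn
      · exact Or.inl ⟨x, x1, by omega, (hva x hx).symm⟩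
    · rintro (⟨x, x1, x2, rfl⟩ | rfl)
      · exact ⟨x, x1, by omega, hva x (by omega)⟩
      · exact ⟨n + 1, by omega, le_rfl, hvn⟩
  have hb : 1 ≤ b ∧ b ≤ n + 1 := by
    rcases c3 with ⟨rfl, -⟩ | ⟨hn, rfl, -⟩
    · omega
    · have := P.pid_pos n hn le_rfl; omega
  have Pl' : Plc G l (n + 1) va' pid' := by
    refine ⟨fun x z x1 x2 z1 z2 hxz => ?_, fun x x1 x2 => ?_, fun x hx => ?_, fun x x1 x2 => ?_,
      fun x x1 x2 hx => ?_, fun x x1 x2 hx => ?_⟩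
    · by_cases hx : x = n + 1 <;> by_cases hz : z = n + 1
      · omega
      · rw [hx, hvn, hva z hz] at hxz
        exact absurd ⟨z, z1, by omega, hxz.symm⟩ c2
      · rw [hz, hvn, hva x hx] at hxz
        exact absurd ⟨x, x1, by omega, hxz⟩ c2
      · rw [hva x hx, hva z hz] at hxz
        exact P.inj x z x1 (by omega) z1 (by omega) hxz
    · by_cases hx : x = n + 1
      · rw [hx, hvn]; exact c1
      · rw [hva x hx]; exact P.mem x x1 (by omega)
    · rw [hpid x (by omega)]
      exact P.pid_out x (by omega)
    · by_cases hx : x = n + 1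
      · rw [hx, hpn]; exact hb
      · rw [hpid x hx]; exact P.pid_pos x x1 (by omega)
    · by_cases hxn : x = n + 1
      · rw [hxn, hpn] at hx
        rw [hxn, hvn]
        rcases c3 with ⟨-, -, c4⟩ | ⟨hn, rfl, -⟩
        · exact c4
        · have := P.pid_pos n hn le_rfl; omega
      · rw [hpid x hxn] at hx
        rw [hva x hxn]
        exact P.bot x x1 (by omega) hx
    · by_cases hxn : x = n + 1
      · rw [hxn, hpn] at hx
        rw [hxn, hvn, hpn, Nat.add_sub_cancel, hva n (by omega), hpid n (by omega)]
        rcases c3 with ⟨rfl, -⟩ | ⟨hn, rfl, c4⟩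
        · omega
        · exact ⟨c4, rfl⟩
      · rw [hpid x hxn] at hx ⊢
        rw [hva x hxn, hva (x - 1) (by omega), hpid (x - 1) (by omega)]
        exact P.sc x x1 (by omega) hx
  refine ⟨Pl', fun x x1 x2 hx => ?_, fun v hv hs => ?_, fun x x1 x2 u hu hs => ?_, fun hy' => ?_⟩
  · by_cases hxn : x = n + 1
    · rw [hxn, hpn] at hx
      rw [hxn, hvn]
      rcases c3 with ⟨-, c4, -⟩ | ⟨hn, rfl, -⟩
      · exact c4
      · have := P.pid_pos n hn le_rfl; omega
    · rw [hpid x hxn] at hx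
      rw [hva x hxn]
      exact W.bots x x1 (by omega) hx
  · rw [hpl]
    rcases W.done v hv hs with h | h
    · exact Or.inl (Or.inl h)
    · exact Or.inl (Or.inr (by omega))
  · rw [hpl]
    by_cases hxn : x = n + 1
    · rw [hxn, hvn] at hs
      exact Or.inr (h1 u hu hs).symm
    · rw [hva x hxn] at hs
      rcases W.up x x1 (by omega) u hu hs with h | h
      · exact Or.inl (Or.inl h)
      · exact Or.inl (Or.inr (by omega))
  · obtain ⟨a, ha, has⟩ := h2 hy'
    have hya := h1 a ha has
    have hya' : y' - 1 = a := by omega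
    rw [hya', hpl, hvn, hpn]
    refine ⟨ha, ?_, Or.inr ⟨by omega, rfl, has⟩⟩
    -- If the parent had been placed, it would not be the end of a path, as it has a symmetric
    -- centroid child. That child is unique, so it would sit just below and be placed as well; but
    -- it is the variable being placed now.
    rintro (⟨x, x1, x2, rfl⟩ | rfl)
    · by_cases hx : pid x = x
      · exact P.bot x x1 x2 hx _ has
      · have h3 := P.sc x x1 x2 hx
        have h4 := P.pid_pos x x1 x2
        refine c2 ⟨x - 1, by omega, by omega, ?_⟩
        exact O.sc_child_unique ha h3.1 has
    · exact lt_irrefl _ (has.1.len_lt (O.lt c1))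

/-- The path structure is complete. -/
theorem Walk.surj {G : Gram} {l : List ℕ} {n b : ℕ} {va pid : ℕ → ℕ} (O : G.Ord l)
    (W : Walk G l l n va pid 0 b) : ∀ v ∈ l, Placed n va v := by
  -- Induction on the length: a variable with a symmetric centroid child is placed because the child
  -- is (`up`), and one without is an end of a path (`done`).
  have main : ∀ k, ∀ v ∈ l, G.len v < k → Placed n va v := by
    intro k
    induction k with
    | zero => intro v _ h; omega
    | succ k ih =>
      intro v hv hk
      by_cases hs : ∃ X, G.SC l v X
      · obtain ⟨X, hX⟩ := hs
        have hlt := hX.1.len_lt (O.lt hv)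
        obtain ⟨x, x1, x2, rfl⟩ := ih X (O.ch_mem hv hX.1) (by omega)
        rcases W.up x x1 x2 v hv hX with h | h
        · exact h
        · omega
      · rcases W.done v hv (fun X hX => hs ⟨X, hX⟩) with h | h
        · exact h
        · omega
  exact fun v hv => main _ v hv (Nat.lt_succ_self _)

/-- A placed variable without symmetric centroid child is the end of its path, hence among those of
`A`; so `u` is still free to open a path at position `n + 1`. -/
theorem Walk.start {G : Gram} {l A : List ℕ} {n u b : ℕ} {va pid : ℕ → ℕ}
    (W : Walk G l A n va pid 0 b) (hu : u ∈ l) (huA : u ∉ A) (hs : ∀ X, ¬ G.SC l u X) :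
    Walk G l (A ++ [u]) n va pid (u + 1) (n + 1) := by
  refine ⟨W.plc, fun x x1 x2 hx => by simp [W.bots x x1 x2 hx], fun v hv hvs => ?_,
    fun x x1 x2 v hv hvs => ?_, fun _ => ?_⟩
  · rw [List.mem_append, List.mem_singleton] at hv
    rcases hv with hv | rfl
    · exact (W.done v hv hvs).imp_right fun h => by omega
    · exact Or.inr rfl
  · exact (W.up x x1 x2 v hv hvs).imp_right fun h => by omega
  · rw [Nat.add_sub_cancel]
    refine ⟨hu, ?_, Or.inl ⟨rfl, by simp, hs⟩⟩
    rintro ⟨x, x1, x2, rfl⟩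
    by_cases hx : pid x = x
    · exact huA (W.bots x x1 x2 hx)
    · exact hs _ (W.plc.sc x x1 x2 hx).1

theorem Walk.skip {G : Gram} {l A : List ℕ} {n u b X : ℕ} {va pid : ℕ → ℕ}
    (W : Walk G l A n va pid 0 b) (hs : G.SC l u X) :
    Walk G l (A ++ [u]) n va pid 0 b := by
  refine ⟨W.plc, fun x x1 x2 hx => by simp [W.bots x x1 x2 hx], fun v hv hvs => ?_, W.up,
    fun h => absurd rfl h⟩
  rw [List.mem_append, List.mem_singleton] at hv
  rcases hv with hv | rfl
  · exact W.done v hv hvs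
  · exact absurd hs (hvs X)

/-- Place the variables of a path. -/
def walk : St := .loop (.lt 0 (r 14)) (.asg 11 (r 11 + 1) ;;
  .sto (r 4 + 64 * r 11 + 20) (r 14 - 1) ;; .sto (r 4 + 64 * r 11 + 21) (r 13) ;;
  .asg 14 (ld (r 4 + 64 * (r 14 - 1) + 16)))

/-- Place all variables. -/
def posP : St := .asg 10 0 ;; .asg 11 0 ;; .loop (.lt (r 10) (r 6))
  (.asg 12 (ld (r 4 + 64 * r 10 + 7)) ;;
    .ite (.eq (ld (r 4 + 64 * r 12 + 15)) 0)
      (.asg 13 (r 11 + 1) ;; .asg 14 (r 12 + 1) ;; .call walk) .skip ;;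
    .asg 10 (r 10 + 1)) ;; .asg 6 (r 11)

/-- The placement in memory. -/
def vaM (G : Gram) (M : ℕ → ℕ) (x : ℕ) : ℕ := M (5 + 3 * G.m + 64 * x + 20)
def pidM (G : Gram) (M : ℕ → ℕ) (x : ℕ) : ℕ := M (5 + 3 * G.m + 64 * x + 21)

/-- Every pass fills a new position. So the walks over all paths together are linear, although a
single one may be long. -/
theorem walk_spec {w μ c N n : ℕ} {G : Gram} (E : Env w μ c N G) {Q : ℕ → HS → Prop} {l A : List ℕ}
    {h : HS} (h4 : h.v 4 = 5 + 3 * G.m) (O : G.Ord l) (hlm : l.length ≤ G.m)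
    (hE : Edges (5 + 3 * G.m) G.m (fun a b => a ∈ l ∧ G.SC l a b) h.m) (h11 : h.v 11 = n)
    (hW : Walk G l A n (vaM G h.m) (pidM G h.m) (h.v 14) (h.v 13))
    (hQ : ∀ t v M' n', (∀ x, x < 11 → v x = h.v x) → Fr (5 + 3 * G.m) 20 22 h.m M' →
      v 11 = n' → n ≤ n' → Walk G l A n' (vaM G M') (pidM G M') 0 (h.v 13) →
      t ≤ 100 * (n' - n) + 10 → Q t ⟨v, M'⟩) : WP w walk Q h := by
  have hlin := E.lin
  have h3 := E.m_le
  refine WP.loop (fun t g => ∃ n', (∀ x, x < 11 → g.v x = h.v x) ∧ Fr (5 + 3 * G.m) 20 22 h.m g.m ∧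
    g.v 11 = n' ∧ n ≤ n' ∧ Walk G l A n' (vaM G g.m) (pidM G g.m) (g.v 14) (h.v 13) ∧
    g.v 13 = h.v 13 ∧ t ≤ 100 * (n' - n)) (100 * l.length) ?_ ?_ ?_ ?_ ?_
  · rintro t g -
    simp only [tst_simps, ok_simps]; omega
  · rintro t g ⟨n', -, -, -, -, W, -, ht⟩
    have := W.plc.le_length
    omega
  · rintro t g ⟨n', gx, hF, g11, hn, W, g13, ht⟩ hb
    simp only [tst_simps, ex_simps] at hb
    obtain ⟨v, hv⟩ : ∃ v, g.v 14 = v + 1 := ⟨g.v 14 - 1, by omega⟩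
    have hE' := hE.congr hF (Or.inl (by omega))
    rw [hv] at W
    have hc := W.cur (by omega)
    rw [Nat.add_sub_cancel] at hc
    have hvm := O.lt hc.1
    have hn' := W.plc.le_length
    have hb' : h.v 13 ≤ n' + 1 := by
      rcases hc.2.2 with ⟨h1, -⟩ | ⟨h1, h2, -⟩
      · omega
      · have := W.plc.pid_pos n' h1 le_rfl; omega
    have x4 : g.v 4 = 5 + 3 * G.m := by rw [gx 4 (by omega), h4]
    refine sym.sound _ ?_
    simp only [sym, ok_simps, ex_simps, cost_simps, reduceIte, Nat.reduceEqDiff, x4, g11, hv,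
      Nat.add_sub_cancel, g13]
    have n1 : 5 + 3 * G.m + 64 * v + 16 ≠ 5 + 3 * G.m + 64 * (n' + 1) + 20 := by omega
    have n2 : 5 + 3 * G.m + 64 * v + 16 ≠ 5 + 3 * G.m + 64 * (n' + 1) + 21 := by omega
    rw [wr_ne _ _ n2, wr_ne _ _ n1]
    simp only [HS.set]
    refine ⟨by omega, ⟨by omega, by omega, by omega⟩, ⟨⟨by omega, ⟨by omega, by omega, by omega⟩,
      by omega⟩, by omega, by omega⟩, ⟨by omega, by omega, by omega⟩, ⟨⟨by omega, ⟨by omega, by omega,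
      by omega⟩, by omega⟩, by omega, by omega⟩, by omega, by omega, ⟨⟨by omega, ⟨by omega, ⟨by omega,
      by omega, by omega⟩, by omega⟩, by omega⟩, by omega, by omega⟩, ?_⟩
    have hstep := W.step (va' := fun x => if x = n' + 1 then v else vaM G g.m x)
      (pid' := fun x => if x = n' + 1 then h.v 13 else pidM G g.m x)
      (y' := g.m (5 + 3 * G.m + 64 * v + 16)) O (by omega)
      (fun x hx => by simp [hx]) (fun x hx => by simp [hx]) (by simp) (by simp)
      (fun a ha hs => hE'.pa a v ⟨ha, by simpa using hs⟩)
      (fun hne => by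
        obtain ⟨a, ha⟩ := hE'.pa_ne v hvm hne
        exact ⟨a, ha.1, by simpa using ha.2⟩)
    refine ⟨n' + 1, fun x hx => ?_, fun a ha => ?_, by simp [HS.wr], by omega, ?_, ?_, by simp only [cost_simps, tst_simps]; omega⟩
    · simp only [HS.wr, show x ≠ 11 by omega, show x ≠ 14 by omega, reduceIte]
      exact gx x hx
    · simp only [wr_m, show a ≠ 5 + 3 * G.m + 64 * (n' + 1) + 20 by omega,
        show a ≠ 5 + 3 * G.m + 64 * (n' + 1) + 21 by omega, reduceIte]
      exact hF a ha
    · convert hstep using 1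
      · funext x
        simp only [vaM, wr_m]
        rw [if_neg (by omega)]
        by_cases hx : x = n' + 1
        · subst hx; simp
        · rw [if_neg (by omega), if_neg hx]
      · funext x
        simp only [pidM, wr_m]
        by_cases hx : x = n' + 1
        · subst hx; simp
        · rw [if_neg (by omega), if_neg (by omega), if_neg hx]
    · simp [HS.wr, g13]
  · rintro t g ⟨n', gx, hF, g11, hn, W, g13, ht⟩ hb
    simp only [tst_simps, ex_simps] at hb
    rw [show g.v 14 = 0 by omega] at W
    refine hQ _ _ _ n' gx hF g11 hn W ?_
    simp only [tst_simps, cost_simps]; omega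
  · exact ⟨n, fun x _ => rfl, Fr.refl, h11, le_rfl, hW, rfl, by omega⟩

theorem posP_spec {w μ c N : ℕ} {G : Gram} (E : Env w μ c N G) {Q : ℕ → HS → Prop} {l : List ℕ}
    {h : HS} (hg : Glob μ c G h) (h6 : h.v 6 = l.length) (O : G.Ord l) (hlm : l.length ≤ G.m)
    (hL : Lst (5 + 3 * G.m) l h.m)
    (hE : Edges (5 + 3 * G.m) G.m (fun a b => a ∈ l ∧ G.SC l a b) h.m)
    (hz : ∀ x, h.m (5 + 3 * G.m + 64 * x + 21) = 0)
    (hQ : ∀ t v M' n, (∀ x, x < 10 → x ≠ 6 → v x = h.v x) → Fr (5 + 3 * G.m) 20 22 h.m M' →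
      v 6 = n → Plc G l n (vaM G M') (pidM G M') → (∀ v ∈ l, Placed n (vaM G M') v) →
      t ≤ 400 * G.m → Q t ⟨v, M'⟩) : WP w posP Q h := by
  have hlin := E.lin
  have h3 := E.m_le
  have hm1 := E.m_pos
  obtain ⟨g2, g3, g4, g5⟩ := hg
  refine sym.sound _ ?_
  simp only [posP, sym, ok_simps, ex_simps, cost_simps]
  refine ⟨by omega, by omega, by omega, by omega, ?_⟩
  refine WP.loop (fun t g => ∃ i n, i ≤ l.length ∧ (∀ x, x < 10 → g.v x = h.v x) ∧ g.v 10 = i ∧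
    g.v 11 = n ∧ Fr (5 + 3 * G.m) 20 22 h.m g.m ∧
    Walk G l (l.take i) n (vaM G g.m) (pidM G g.m) 0 0 ∧ t ≤ 100 * (i + n)) (200 * G.m) ?_ ?_ ?_ ?_ ?_
  · rintro t g -
    simp only [tst_simps, ok_simps]; omega
  · rintro t g ⟨i, n, hi, -, -, -, -, W, ht⟩
    have := W.plc.le_length
    omega
  · rintro t g ⟨i, n, hi, gx, g10, g11, hF, W, ht⟩ hb
    have x4 : g.v 4 = 5 + 3 * G.m := by rw [gx 4 (by omega), g4]
    simp only [tst_simps, ex_simps, g10, gx 6 (by omega), h6] at hb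
    have hu : l[i] ∈ l := List.getElem_mem _
    have hnd := O.nodup
    rw [← List.take_append_drop i l, List.drop_eq_getElem_cons hb] at hnd
    have htake := List.take_succ_eq_append_getElem hb
    obtain ⟨u, hue⟩ : ∃ u, l[i] = u := ⟨_, rfl⟩
    have hord := (hL.congr hF (by omega)) i hb
    rw [hue] at hu hord htake hnd
    have huA : u ∉ l.take i := fun hA => by
      rw [List.nodup_append] at hnd
      exact hnd.2.2 u hA u (by simp) rfl
    have hum := O.lt hu
    have hE' := hE.congr hF (Or.inl (by omega))
    have hn' := W.plc.le_length
    refine sym.sound _ ?_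
    simp only [sym, tst_simps, ok_simps, ex_simps, cost_simps, reduceIte, Nat.reduceEqDiff, x4, g10,
      g11, hord]
    refine ⟨by omega, ⟨⟨by omega, ⟨by omega, by omega, by omega⟩, by omega⟩, by omega, by omega⟩,
      ⟨⟨⟨by omega, ⟨by omega, by omega, by omega⟩, by omega⟩, by omega, by omega⟩, by omega⟩, fun k0 => ?_,
      fun k0 => ?_⟩
    · have hs : ∀ X, ¬ G.SC l u X := fun X hX => by
        have := hE'.nx u X ⟨hu, hX⟩; omega
      refine ⟨by omega, ⟨by omega, by omega, by omega⟩, by omega, ⟨by omega, by omega, by omega⟩, ?_⟩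
      have W1 := W.start hu huA hs
      refine walk_spec E (n := n) (A := l.take i ++ [u]) (by simp [HS.set, x4]) O hlm hE'
        (by simp [HS.set, g11]) (by simpa [HS.set] using W1) fun t1 v1 M1 n1 e1 F1 e11 hn W2 ht1 => ?_
      have x10 := e1 10 (by omega)
      simp only [HS.set, reduceIte, Nat.reduceEqDiff, g10] at x10
      simp only [x10]
      refine ⟨by omega, ⟨by omega, by omega, by omega⟩, i + 1, n1, by omega, fun x hx => ?_,
        by simp [HS.set], by simp [HS.set, e11], hF.trans F1, ?_, by omega⟩
      · have := e1 x (by omega)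
        simp only [HS.set, show x ≠ 10 by omega, show x ≠ 12 by omega, show x ≠ 13 by omega,
          show x ≠ 14 by omega, reduceIte] at this ⊢
        rw [this, gx x hx]
      · rw [htake]
        exact ⟨W2.plc, W2.bots, W2.done, W2.up, fun h => absurd rfl h⟩
    · obtain ⟨X, -, hX⟩ := hE'.nx_ne u hum k0
      refine ⟨by omega, ⟨by omega, by omega, by omega⟩, i + 1, n, by omega, fun x hx => ?_,
        by simp [HS.set], by simp [HS.set, g11], hF, ?_, by omega⟩
      · simp only [HS.set, show x ≠ 10 by omega, show x ≠ 12 by omega, reduceIte]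
        exact gx x hx
      · rw [htake]
        exact W.skip hX
  · rintro t g ⟨i, n, hi, gx, g10, g11, hF, W, ht⟩ hb
    simp only [tst_simps, ex_simps, g10, gx 6 (by omega), h6] at hb
    have hil : i = l.length := by omega
    subst hil
    rw [List.take_length] at W
    have hn' := W.plc.le_length
    refine ⟨by omega, by omega, ?_⟩
    refine hQ _ _ _ n (fun x hx hx6 => ?_) hF (by simp [HS.set, g11]) W.plc (W.surj O) ?_
    · simp only [HS.set, hx6, reduceIte]; exact gx x hx
    · simp only [tst_simps, cost_simps]; omega
  · refine ⟨0, 0, by omega, fun x hx => ?_, by simp [HS.set], by simp [HS.set], Fr.refl,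
      ⟨⟨by omega, by omega, fun x _ => hz x, by omega, by omega, by omega⟩, by omega, by simp, by omega,
        fun h => absurd rfl h⟩, by omega⟩
    simp only [HS.set, show x ≠ 10 by omega, show x ≠ 11 by omega, reduceIte]

end WhileLang

/-! ### Records for the blocks -/

namespace WhileLang

open Ex St

namespace Dat

variable (D : Dat)

/-- Bounds for the numbers in the construction. -/
structure Ctx (w μ c N : ℕ) : Prop where
  env : Env w μ c N D.G
  ok : D.Ok
  vb : D.VB = 5 + 3 * D.G.m
  cnt_le : D.cnt ≤ D.G.m
  K_le : 2 ^ D.K ≤ 2 * D.G.m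

/-- The memory describes the grammar, the lengths and fingerprints of its variables, and the
placement. -/
structure Mid (μ c : ℕ) (M : ℕ → ℕ) : Prop where
  kd : ∀ A < D.G.m, M (5 + 3 * A) = D.G.kd A
  a1 : ∀ A < D.G.m, M (5 + 3 * A + 1) = D.G.a1 A
  a2 : ∀ A < D.G.m, M (5 + 3 * A + 2) = D.G.a2 A
  va : ∀ x, M (D.VB + 64 * x + 20) = D.va x
  pid : ∀ x, M (D.VB + 64 * x + 21) = D.pid x
  rcd : ∀ v ∈ D.l, Rec μ c M (D.VB + 64 * v) (D.G.str v)
  pow : ∀ v ∈ D.l, M (D.VB + 64 * v + 13) = 2 ^ Nat.log 2 (D.G.len v)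
  emp : Rec μ c M (D.VB + 32) [] ∧ Rec μ c M (D.VB + 38) []

/-- Only heap fields of positive indices have changed. -/
def Hfr (M M' : ℕ → ℕ) : Prop :=
  ∀ a, a < D.VB + 64 ∨ (a - D.VB) % 64 < 29 → M' a = M a

variable {D}

theorem Hfr.trans {M M' M'' : ℕ → ℕ} (h1 : D.Hfr M M') (h2 : D.Hfr M' M'') : D.Hfr M M'' :=
  fun a ha => (h2 a ha).trans (h1 a ha)

theorem Hfr.of_ne {M M' : ℕ → ℕ} {h : ℕ} (h1 : 1 ≤ h)
    (hM : ∀ a, a < D.VB + 64 * h + 29 ∨ D.VB + 64 * h + 64 ≤ a → M' a = M a) : D.Hfr M M' :=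
  fun a ha => hM a (by omega)

theorem Mid.congr {w μ c N : ℕ} {M M' : ℕ → ℕ} (C : D.Ctx w μ c N) (I : D.Mid μ c M)
    (h : D.Hfr M M') : D.Mid μ c M' := by
  have hvb := C.vb
  have hr : ∀ {a X}, a + 5 < D.VB + 64 ∨ (a - D.VB) % 64 < 20 → Rec μ c M a X → Rec μ c M' a X :=
    fun {a X} ha r => ⟨(h _ (by omega)).trans r.1, (h _ (by omega)).trans r.2.1,
      (h _ (by omega)).trans r.2.2⟩
  exact ⟨fun A hA => (h _ (by omega)).trans (I.kd A hA), fun A hA => (h _ (by omega)).trans (I.a1 A hA),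
    fun A hA => (h _ (by omega)).trans (I.a2 A hA), fun x => (h _ (by omega)).trans (I.va x),
    fun x => (h _ (by omega)).trans (I.pid x), fun v hv => hr (by omega) (I.rcd v hv),
    fun v hv => (h _ (by omega)).trans (I.pow v hv), hr (by omega) I.emp.1, hr (by omega) I.emp.2⟩

/-- Fields of a heap node. -/
def HFact (D : Dat) (μ c : ℕ) (M : ℕ → ℕ) (h : ℕ) : Prop :=
  M (D.VB + 64 * h + 29) = D.lo h ∧ M (D.VB + 64 * h + 30) = D.hi h ∧
    M (D.VB + 64 * h + 31) = (if D.cut h then 1 else 0) ∧ D.BFact μ c M h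

theorem HFact.congr {μ c h : ℕ} {M M' : ℕ → ℕ} (F : D.HFact μ c M h)
    (hM : ∀ a, D.VB + 64 * h + 29 ≤ a → a < D.VB + 64 * h + 44 → M' a = M a) :
    D.HFact μ c M' h := by
  obtain ⟨f1, f2, f3, f4⟩ := F
  refine ⟨(hM _ (by omega) (by omega)).trans f1, (hM _ (by omega) (by omega)).trans f2,
    (hM _ (by omega) (by omega)).trans f3, fun hc => ?_⟩
  obtain ⟨g1, g2, g3⟩ := f4 hc
  have hp : ∀ {k a b}, k ≤ 6 → PairAt M (D.bk h + k) a b → PairAt M' (D.bk h + k) a b :=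
    fun {k a b} hk p => ⟨(hM _ (by unfold bk; omega) (by unfold bk; omega)).trans p.1,
      (hM _ (by unfold bk; omega) (by unfold bk; omega)).trans p.2.1,
      (hM _ (by unfold bk; omega) (by unfold bk; omega)).trans p.2.2⟩
  have hr : ∀ {k X}, k ≤ 6 → Rec μ c M (D.bk h + k) X → Rec μ c M' (D.bk h + k) X :=
    fun {k X} hk p => ⟨(hM _ (by unfold bk; omega) (by unfold bk; omega)).trans p.1,
      (hM _ (by unfold bk; omega) (by unfold bk; omega)).trans p.2.1,
      (hM _ (by unfold bk; omega) (by unfold bk; omega)).trans p.2.2⟩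
  exact ⟨⟨hr (k := 0) (by omega) g1.1, hr (by omega) g1.2⟩,
    fun hh => ⟨hp (k := 0) (by omega) (g2 hh).1, hp (by omega) (g2 hh).2⟩,
    fun hh => ⟨hp (k := 0) (by omega) (g3 hh).1, hp (by omega) (g3 hh).2⟩⟩

/-- Both contexts are factors of the string of the upper variable, so their lengths fit into words.
-/
theorem Ctx.cL_le {w μ c N x y : ℕ} (C : D.Ctx w μ c N) (hx : D.pid x ≠ 0)
    (hxy : D.pid x = D.pid y) (h : x ≤ y) : (D.cL x y).length ≤ N ∧ (D.cR x y).length ≤ N := by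
  have h1 := congrArg List.length (C.ok.str_chain hx hxy h)
  simp only [List.length_append] at h1
  have h2 := C.ok.range_of_pid (x := y) (hxy ▸ hx)
  have h3 := C.ok.ord.len_le (C.ok.mem y h2.1 h2.2)
  have h4 := C.env.len_le
  unfold Gram.len at h3 h4
  omega

end Dat

/-- Set `r15` to 1 or 0 according to whether the block from `r11` to `r12` is cut. -/
def cutTest : St := .asg 15 1 ;; .asg 16 (ld (r 4 + 64 * r 12 + 21)) ;;
  .ite (.eq (r 16) 0) .skip
    (.ite (.eq (ld (r 4 + 64 * r 11 + 21)) (r 16))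
      (.asg 17 (r 12 - r 11) ;; .asg 18 (r 4 + 64 * ld (r 4 + 64 * r 11 + 20)) ;;
        .asg 19 (r 4 + 64 * ld (r 4 + 64 * r 12 + 20)) ;;
        .ite (.eq (ld (r 18 + 3) * r 17 / ld (r 18 + 13)) (ld (r 19 + 3) * r 17 / ld (r 19 + 13)))
          (.asg 15 0) .skip) .skip)

/-- The factor `2 ^ lev` in a cell index is available as the number of edges `hi - lo`, and the
divisor as the stored power of 2. Positions off all paths have `pid` 0, which is tested before their
variables are used. -/
theorem cutTest_spec {w μ c N k : ℕ} {D : Dat} {Q : ℕ → HS → Prop} {h : HS} (C : D.Ctx w μ c N)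
    (I : D.Mid μ c h.m) (k1 : 1 ≤ k) (k2 : k < 2 * 2 ^ D.K) (h4 : h.v 4 = D.VB)
    (h11 : h.v 11 = D.lo k) (h12 : h.v 12 = D.hi k)
    (hQ : ∀ t v, (∀ x, x < 15 → v x = h.v x) → v 15 = (if D.cut k then 1 else 0) → t ≤ 100 →
      Q t ⟨v, h.m⟩) : WP w cutTest Q h := by
  have hlin := C.env.lin
  have h3 := C.env.m_le
  have hvb := C.vb
  have hK := C.K_le
  have hlo := D.lo_lt_hi k
  have hhi := Dat.hi_le (D := D) k1 k2
  have hcnt := C.cnt_le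
  have hsz : D.hi k - D.lo k = 2 ^ D.lev k := Nat.add_sub_cancel_left _ _
  have hpid : ∀ x, D.pid x ≤ D.cnt := fun x => by
    by_cases hx : D.pid x = 0
    · omega
    · have h1 := C.ok.range_of_pid hx
      have := C.ok.pid_pos x h1.1 h1.2
      omega
  have p1 := hpid (D.lo k)
  have p2 := hpid (D.hi k)
  refine sym.sound _ ?_
  simp only [cutTest, sym, tst_simps, ok_simps, ex_simps, cost_simps, reduceIte, Nat.reduceEqDiff,
    h4, h11, h12, I.pid, I.va]
  refine ⟨by omega, by omega, by omega, ⟨⟨by omega, ⟨by omega, by omega, by omega⟩, by omega⟩, by omega,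
    by omega⟩, ⟨by omega, by omega⟩, fun z0 => ?_, fun z0 => ⟨⟨⟨⟨by omega, ⟨by omega, by omega, by omega⟩,
    by omega⟩, by omega, by omega⟩, by omega⟩, fun z1 => ?_, fun z1 => ?_⟩⟩
  · refine hQ _ _ (fun x hx => ?_) ?_ (by norm_num)
    · simp only [HS.set, show x ≠ 15 by omega, show x ≠ 16 by omega, reduceIte]
    · rw [if_pos (show D.cut k from Or.inl z0)]; simp [HS.set]
  · have z2 := C.ok.range_of_pid z0
    have z3 := C.ok.range_of_pid (z1 ▸ z0)
    have m1 := C.ok.mem _ z3.1 z3.2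
    have m2 := C.ok.mem _ z2.1 z2.2
    have n1 := C.ok.ord.lt m1
    have n2 := C.ok.ord.lt m2
    have e1 := (I.rcd _ m1).1
    have e2 := (I.rcd _ m2).1
    have e3 := I.pow _ m1
    have e4 := I.pow _ m2
    have l1 := (C.ok.ord.len_le m1).trans C.env.len_le
    have l2 := (C.ok.ord.len_le m2).trans C.env.len_le
    have c1 : D.G.len (D.va (D.lo k)) * 2 ^ D.lev k < 2 ^ w := C.env.mul_lt (by omega) (by omega)
    have c2 : D.G.len (D.va (D.hi k)) * 2 ^ D.lev k < 2 ^ w := C.env.mul_lt (by omega) (by omega)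
    have d1 := (Nat.div_le_self (D.G.len (D.va (D.lo k)) * 2 ^ D.lev k)
      (2 ^ Nat.log 2 (D.G.len (D.va (D.lo k))))).trans_lt c1
    have d2 := (Nat.div_le_self (D.G.len (D.va (D.hi k)) * 2 ^ D.lev k)
      (2 ^ Nat.log 2 (D.G.len (D.va (D.hi k))))).trans_lt c2
    rw [show (D.G.str (D.va (D.lo k))).length = D.G.len (D.va (D.lo k)) from rfl] at e1
    rw [show (D.G.str (D.va (D.hi k))).length = D.G.len (D.va (D.hi k)) from rfl] at e2
    simp only [e1, e2, e3, e4, hsz]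
    refine ⟨by omega, ⟨by omega, by omega, by omega⟩, by omega, ⟨by omega, ⟨by omega, ⟨⟨by omega, ⟨by omega,
      by omega, by omega⟩, by omega⟩, by omega, by omega⟩, by omega⟩, by omega⟩, by omega, ⟨by omega,
      ⟨by omega, ⟨⟨by omega, ⟨by omega, by omega, by omega⟩, by omega⟩, by omega, by omega⟩, by omega⟩,
      by omega⟩, ⟨⟨⟨⟨by omega, by omega, by omega⟩, by omega, c1⟩, ⟨by omega, by omega, by omega⟩, d1⟩,
      ⟨⟨by omega, by omega, by omega⟩, by omega, c2⟩, ⟨by omega, by omega, by omega⟩, d2⟩,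
      fun z4 => ⟨by omega, by omega, ?_⟩, fun z4 => ?_⟩
    · refine hQ _ _ (fun x hx => ?_) ?_ (by norm_num)
      · simp only [HS.set, show x ≠ 15 by omega, show x ≠ 16 by omega, show x ≠ 17 by omega,
          show x ≠ 18 by omega, show x ≠ 19 by omega, reduceIte]
      · have hn : ¬ D.cut k := by
          rintro (hc | hc | hc)
          · exact z0 hc
          · exact hc z1
          · exact hc z4
        rw [if_neg hn]
        simp [HS.set]
    · refine hQ _ _ (fun x hx => ?_) ?_ (by norm_num)
      · simp only [HS.set, show x ≠ 15 by omega, show x ≠ 16 by omega, show x ≠ 17 by omega,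
          show x ≠ 18 by omega, show x ≠ 19 by omega, reduceIte]
      · rw [if_pos (show D.cut k from Or.inr (Or.inr z4))]; simp [HS.set]
  · refine hQ _ _ (fun x hx => ?_) ?_ (by norm_num)
    · simp only [HS.set, show x ≠ 15 by omega, show x ≠ 16 by omega, reduceIte]
    · rw [if_pos (show D.cut k from Or.inr (Or.inl z1))]; simp [HS.set]

/-- Records for a block at `r13` with the single parts `r19` and `r21`. -/
def leafMk : St := .asg 30 (r 13 + 32) ;; .asg 31 (r 19) ;; .asg 32 (r 4 + 32) ;; .call mk ;;
  .asg 30 (r 13 + 38) ;; .asg 31 (r 21) ;; .asg 32 (r 4 + 32) ;; .call mk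

/-- Records for a single edge, from position `r11` to position `r12`. -/
def leafB : St := .asg 16 (ld (r 4 + 64 * r 12 + 20)) ;; .asg 17 (ld (r 4 + 64 * r 11 + 20)) ;;
  .asg 18 (5 + 3 * r 16) ;; .asg 20 (ld (r 18 + 1)) ;;
  .ite (.eq (r 20) (r 17)) (.asg 19 (r 4 + 32) ;; .asg 21 (r 4 + 64 * ld (r 18 + 2)))
    (.asg 19 (r 4 + 64 * r 20) ;; .asg 21 (r 4 + 32)) ;; .call leafMk

/-- An uncut leaf is a symmetric centroid edge, so the upper variable is a pair with distinct
children. Comparing its first child with the lower variable tells the side of the sibling. -/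
theorem leafB_spec {w μ c N k : ℕ} {D : Dat} {Q : ℕ → HS → Prop} {h : HS} (C : D.Ctx w μ c N)
    (I : D.Mid μ c h.m) (k1 : 1 ≤ k) (k2 : k < 2 * 2 ^ D.K) (k3 : 2 ^ D.K ≤ k) (hn : ¬ D.cut k)
    (h2 : h.v 2 = μ) (h4 : h.v 4 = D.VB) (h11 : h.v 11 = D.lo k) (h12 : h.v 12 = D.hi k)
    (h13 : h.v 13 = D.VB + 64 * k)
    (hQ : ∀ t v M', (∀ x, x < 14 → v x = h.v x) →
      (∀ e, e < D.VB + 64 * k + 32 ∨ D.VB + 64 * k + 44 ≤ e → M' e = h.m e) →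
      D.BFact μ c M' k → t ≤ 300 → Q t ⟨v, M'⟩) : WP w leafB Q h := by
  have hlin := C.env.lin
  have h3 := C.env.m_le
  have hvb := C.vb
  have hK := C.K_le
  have hhi := Dat.hi_le (D := D) k1 k2
  have hlo : D.hi k = D.lo k + 1 := by rw [Dat.hi_leaf k3, Dat.lo_leaf k3]
  obtain ⟨z1, z2, -⟩ := Dat.Ok.noncut_pid hn
  have r1 := C.ok.range_of_pid z1
  have r2 := C.ok.range_of_pid (z2 ▸ z1)
  have m2 := C.ok.mem _ r2.1 r2.2
  have n2 := C.ok.ord.lt m2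
  have hsc := C.ok.sc (D.hi k) r2.1 r2.2 (by
    have := C.ok.pid_pos (D.lo k) r1.1 r1.2; omega)
  have hkd := (C.ok.ord.sc_kd m2 hsc.1).1
  obtain ⟨l1, l2, -⟩ := D.G.pair _ n2 hkd
  have ml1 := C.ok.ord.ch_mem m2 (Or.inl ⟨hkd, Or.inl rfl⟩)
  have ml2 := C.ok.ord.ch_mem m2 (Or.inl ⟨hkd, Or.inr rfl⟩)
  have ba := C.env.a1_le _ n2
  have ba' := C.env.a2_le _ n2
  have hlen := C.cL_le z1 z2 (by omega)
  have hsub : D.hi k - 1 = D.lo k := by omega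
  rw [hlo, Dat.cL_succ, Dat.cR_succ, ← hlo] at hlen
  -- the addresses of the two parts
  have hadL : D.adL (D.hi k) + 6 < 2 ^ w ∧ Rec μ c h.m (D.adL (D.hi k)) (D.itL (D.hi k)) := by
    unfold Dat.adL Dat.itL
    split_ifs
    · exact ⟨by unfold Dat.bk; omega, I.emp.1⟩
    · exact ⟨by unfold Dat.vr; omega, I.rcd _ ml1⟩
  have hadR : D.adR (D.hi k) + 6 < 2 ^ w ∧ Rec μ c h.m (D.adR (D.hi k)) (D.itR (D.hi k)) ∧
      ∀ M', (∀ e, e < D.VB + 64 * k + 32 ∨ D.VB + 64 * k + 44 ≤ e → M' e = h.m e) →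
        Rec μ c M' (D.adR (D.hi k)) (D.itR (D.hi k)) := by
    unfold Dat.adR Dat.itR
    split_ifs
    · exact ⟨by unfold Dat.vr; omega, I.rcd _ ml2, fun M' hM =>
        (I.rcd _ ml2).of_ne (a := D.VB + 64 * k + 32) (k := 12) hM (by omega)⟩
    · exact ⟨by unfold Dat.bk; omega, I.emp.1, fun M' hM =>
        I.emp.1.of_ne (a := D.VB + 64 * k + 32) (k := 12) hM (by omega)⟩
  have hbk : D.bk k = D.VB + 64 * k + 32 := rfl
  have fin : ∀ (Q' : ℕ → HS → Prop) (g : HS), g.m = h.m → (∀ x, x < 14 → g.v x = h.v x) →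
      g.v 19 = D.adL (D.hi k) → g.v 21 = D.adR (D.hi k) →
      (∀ t v M', (∀ x, x < 14 → v x = h.v x) →
        (∀ e, e < D.VB + 64 * k + 32 ∨ D.VB + 64 * k + 44 ≤ e → M' e = h.m e) →
        D.BFact μ c M' k → t ≤ 230 → Q' t ⟨v, M'⟩) → WP w leafMk Q' g := by
    intro Q' g gm gx g19 g21 hQ'
    refine sym.sound _ ?_
    have x13 := (gx 13 (by omega)).trans h13
    have x4 := (gx 4 (by omega)).trans h4
    have x2 := (gx 2 (by omega)).trans h2
    simp only [leafMk, sym, ok_simps, ex_simps, cost_simps, reduceIte, Nat.reduceEqDiff, x13, x4, g19]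
    refine ⟨by omega, ⟨by omega, by omega, by omega⟩, by omega, by omega, by omega, ⟨by omega, by omega,
      by omega⟩, ?_⟩
    refine mk_spec C.env (X := D.itL (D.hi k)) (Y := []) (by simp [HS.set, x2]) (by simp [HS.set]; omega)
      (by simp [HS.set]; omega) (by simp [HS.set]; omega) (by simpa [HS.set, gm] using hadL.2)
      (by simpa [HS.set, gm] using I.emp.1) (by simpa using hlen.1) fun t1 v1 M1 e1 e2 e3 e4 ht1 => ?_
    have y2 := e1 2 (by omega)
    have y4 := e1 4 (by omega)
    have y13 := e1 13 (by omega)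
    have y21 := e1 21 (by omega)
    simp only [HS.set, reduceIte, Nat.reduceEqDiff, x2, x4, x13, g21, gm] at y2 y4 y13 y21 e2 e3 e4
    simp only [y4, y13, y21]
    refine ⟨by omega, ⟨by omega, by omega, by omega⟩, by omega, by omega, by omega, ⟨by omega, by omega,
      by omega⟩, ?_⟩
    have hE1 : Rec μ c M1 (D.VB + 32) [] :=
      I.emp.1.of_ne (a := D.VB + 64 * k + 32) (k := 6) e2 (by omega)
    have hR1 := hadR.2.2 M1 fun e he => e2 e (by omega)
    refine mk_spec C.env (X := D.itR (D.hi k)) (Y := []) (by simp [HS.set, y2]) (by simp [HS.set]; omega)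
      (by simp [HS.set]; omega) (by simp [HS.set]; omega) (by simpa [HS.set] using hR1)
      (by simpa [HS.set] using hE1) (by simpa using hlen.2) fun t2 v2 M2 f1 f2 f3 f4 ht2 => ?_
    simp only [HS.set, reduceIte, Nat.reduceEqDiff] at f2 f3 f4
    refine hQ' _ _ _ (fun x hx => ?_) (fun e he => ?_) (fun _ => ⟨⟨?_, ?_⟩, fun _ => ⟨?_, ?_⟩,
      fun hlt => absurd hlt (by omega)⟩) (by omega)
    · have f := f1 x (by omega)
      have e := e1 x (by omega)
      simp only [HS.set, show x ≠ 30 by omega, show x ≠ 31 by omega, show x ≠ 32 by omega, reduceIte] at f e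
      rw [f, e, gx x hx]
    · rw [f2 e (by omega), e2 e (by omega)]
    · rw [hlo, Dat.cL_succ, ← hlo]
      rw [List.append_nil] at e3
      exact ⟨(f2 _ (by omega)).trans e3.1, (f2 _ (by omega)).trans e3.2.1,
        (f2 _ (by omega)).trans e3.2.2⟩
    · rw [hlo, Dat.cR_succ, ← hlo]
      rw [List.append_nil] at f3
      exact f3
    · exact ⟨(f2 _ (by omega)).trans e4.1, (f2 _ (by omega)).trans e4.2.1,
        (f2 _ (by omega)).trans e4.2.2⟩
    · exact f4
  have i1 := I.a1 _ n2
  have i2 := I.a2 _ n2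
  refine sym.sound _ ?_
  simp only [leafB, sym, tst_simps, ok_simps, ex_simps, cost_simps, reduceIte, Nat.reduceEqDiff,
    h4, h11, h12, I.va, i1, i2]
  refine ⟨by omega, ⟨⟨by omega, ⟨by omega, by omega, by omega⟩, by omega⟩, by omega, by omega⟩, by omega,
    ⟨⟨by omega, ⟨by omega, by omega, by omega⟩, by omega⟩, by omega, by omega⟩, by omega, ⟨by omega,
    ⟨by omega, by omega, by omega⟩, by omega⟩, by omega, ⟨by omega, by omega, by omega⟩,
    ⟨by omega, by omega⟩, fun z => ?_, fun z => ?_⟩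
  all_goals
    refine ⟨by omega, ⟨by omega, by omega, by omega⟩, by omega,
      ⟨by omega, by omega, by omega⟩, ?_⟩
    refine fin _ _ rfl (fun x hx => ?_) ?_ ?_ fun t v M' e1 e2 e3 ht => hQ _ _ _ e1 e2 e3 (by omega)
    · simp only [HS.set, show x ≠ 16 by omega, show x ≠ 17 by omega, show x ≠ 18 by omega,
        show x ≠ 19 by omega, show x ≠ 20 by omega, show x ≠ 21 by omega, reduceIte]
    · simp [HS.set, Dat.adL, hsub, z, Dat.bk, Dat.vr]
    · simp [HS.set, Dat.adR, hsub, z, Dat.bk, Dat.vr]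

end WhileLang

/-! ### The heap of blocks -/

namespace WhileLang

open Ex St

/-- Smallest power of 2 that is not below `r6`. -/
def twoPow : St := .asg 7 1 ;; .loop (.lt (r 7) (r 6)) (.asg 7 (r 7 * 2))

/-- Doubling happens only below `r6 ≤ m`, so the result is at most `2 * m`; this keeps the heap
linear in the number of variables. -/
theorem twoPow_spec {w μ c N : ℕ} {G : Gram} (E : Env w μ c N G) {Q : ℕ → HS → Prop} {h : HS}
    (h6 : h.v 6 ≤ G.m) (hQ : ∀ t v K, (∀ x, x ≠ 7 → v x = h.v x) → v 7 = 2 ^ K → h.v 6 ≤ 2 ^ K →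
      2 ^ K ≤ 2 * G.m → t ≤ 50 * G.m → Q t ⟨v, h.m⟩) : WP w twoPow Q h := by
  have hlin := E.lin
  have h3 := E.m_le
  have hm := E.m_pos
  refine sym.sound _ ?_
  simp only [twoPow, sym, ok_simps, ex_simps, cost_simps]
  refine ⟨by omega, by omega, ?_⟩
  refine WP.loop (fun t g => ∃ K, g.m = h.m ∧ (∀ x, x ≠ 7 → g.v x = h.v x) ∧ g.v 7 = 2 ^ K ∧
    2 ^ K ≤ 2 * G.m ∧ t ≤ 10 * 2 ^ K) (20 * G.m) ?_ ?_ ?_ ?_ ?_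
  · rintro t g -
    simp only [tst_simps, ok_simps]; omega
  · rintro t g ⟨K, -, -, -, hK, ht⟩
    omega
  · rintro t g ⟨K, gm, gx, g7, hK, ht⟩ hb
    simp only [tst_simps, ex_simps, g7, gx 6 (by omega)] at hb
    refine sym.sound _ ?_
    simp only [sym, ok_simps, ex_simps, cost_simps, g7]
    have hpos : 0 < 2 ^ K := by positivity
    have e : 2 ^ (K + 1) = 2 ^ K * 2 := pow_succ _ _
    refine ⟨by omega, ⟨by omega, by omega, by omega⟩, K + 1, gm, fun x hx => ?_, ?_, by omega, ?_⟩
    · simp only [HS.set, hx, reduceIte]; exact gx x hx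
    · simp [HS.set, e]
    · simp only [cost_simps, tst_simps]; omega
  · rintro t g ⟨K, gm, gx, g7, hK, ht⟩ hb
    simp only [tst_simps, ex_simps, g7, gx 6 (by omega)] at hb
    have := hQ (1 + 1 + (t + ((Tst.lt (r 7) (r 6)).cost + 1))) g.v K gx g7 (by omega) hK
      (by simp only [cost_simps, tst_simps]; omega)
    rw [← gm] at this
    exact this
  · exact ⟨0, rfl, fun x hx => by simp [HS.set, hx], by simp [HS.set], by simp; omega, by omega⟩

/-- Ends of the block of a heap node. -/
def heapEnds : St := .ite (.lt (r 10) (r 7))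
    (.asg 11 (ld (r 4 + 64 * (2 * r 10) + 29)) ;; .asg 12 (ld (r 4 + 64 * (2 * r 10 + 1) + 30)))
    (.asg 11 (r 10 - r 7) ;; .asg 12 (r 11 + 1)) ;;
  .asg 13 (r 4 + 64 * r 10) ;; .sto (r 13 + 29) (r 11) ;; .sto (r 13 + 30) (r 12)

/-- Compute the records of all blocks. -/
def heapP : St := .asg 10 (2 * r 7) ;; .loop (.lt 1 (r 10)) (.asg 10 (r 10 - 1) ;; .call heapEnds ;;
  .call cutTest ;; .sto (r 13 + 31) (r 15) ;;
  .ite (.eq (r 15) 0)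
    (.ite (.lt (r 10) (r 7)) (.asg 30 (r 13 + 32) ;; .asg 31 (r 4 + 64 * (2 * r 10 + 1) + 32) ;;
      .asg 32 (r 4 + 64 * (2 * r 10) + 32) ;; .call ccat) (.call leafB)) .skip)

theorem heapEnds_spec {w μ c N k : ℕ} {D : Dat} {Q : ℕ → HS → Prop} {h : HS} (C : D.Ctx w μ c N)
    (k1 : 1 ≤ k) (k2 : k < 2 * 2 ^ D.K) (h4 : h.v 4 = D.VB) (h7 : h.v 7 = 2 ^ D.K) (h10 : h.v 10 = k)
    (hF : ∀ j, k < j → j < 2 * 2 ^ D.K → D.HFact μ c h.m j)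
    (hQ : ∀ t v M', (∀ x, x < 11 → v x = h.v x) →
      (∀ e, e < D.VB + 64 * k + 29 ∨ D.VB + 64 * k + 31 ≤ e → M' e = h.m e) →
      v 11 = D.lo k → v 12 = D.hi k → v 13 = D.VB + 64 * k → M' (D.VB + 64 * k + 29) = D.lo k →
      M' (D.VB + 64 * k + 30) = D.hi k → t ≤ 60 → Q t ⟨v, M'⟩) : WP w heapEnds Q h := by
  have hlin := C.env.lin
  have h3 := C.env.m_le
  have hvb := C.vb
  have hK := C.K_le
  have hhi := Dat.hi_le (D := D) k1 k2
  have hlo := D.lo_lt_hi k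
  refine sym.sound _ ?_
  simp only [heapEnds, sym, tst_simps, ok_simps, ex_simps, cost_simps, reduceIte, Nat.reduceEqDiff,
    h4, h7, h10]
  refine ⟨⟨by omega, by omega⟩, fun hlt => ?_, fun hlt => ?_⟩
  · have f1 := (hF (2 * k) (by omega) (by omega)).1
    have f2 := (hF (2 * k + 1) (by omega) (by omega)).2.1
    rw [Dat.lo_even k1 hlt] at f1
    rw [Dat.hi_odd k1 hlt] at f2
    simp only [f1, f2]
    refine ⟨by omega, ⟨⟨by omega, ⟨by omega, ⟨by omega, by omega, by omega⟩, by omega⟩, by omega⟩, by omega,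
      by omega⟩, by omega, ⟨⟨by omega, ⟨by omega, ⟨⟨by omega, by omega, by omega⟩, by omega, by omega⟩,
      by omega⟩, by omega⟩, by omega, by omega⟩, by omega, ⟨by omega, ⟨by omega, by omega, by omega⟩, by omega⟩,
      ⟨by omega, by omega, by omega⟩, by omega, ⟨by omega, by omega, by omega⟩, by omega, ?_⟩
    refine hQ _ _ _ (fun x hx => ?_) (fun e he => ?_) (by simp [HS.wr, HS.set])
      (by simp [HS.wr, HS.set])
      (by simp [HS.wr, HS.set]) (by simp [wr_m]) (by simp [wr_m]) (by norm_num)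
    · simp only [HS.set, HS.wr, show x ≠ 11 by omega, show x ≠ 12 by omega, show x ≠ 13 by omega,
        reduceIte]
    · simp only [HS.set, wr_m, show e ≠ D.VB + 64 * k + 29 by omega, show e ≠ D.VB + 64 * k + 30 by omega,
        reduceIte]
  · have f1 := Dat.lo_leaf (D := D) (h := k) (by omega)
    have f2 := Dat.hi_leaf (D := D) (h := k) (by omega)
    rw [← f2, ← f1]
    refine ⟨by omega, ⟨by omega, by omega, by omega⟩, by omega, ⟨by omega, by omega, by omega⟩,
      by omega, ⟨by omega, ⟨by omega, by omega, by omega⟩, by omega⟩,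
      ⟨by omega, by omega, by omega⟩, by omega, ⟨by omega, by omega, by omega⟩, by omega, ?_⟩
    refine hQ _ _ _ (fun x hx => ?_) (fun e he => ?_) (by simp [HS.wr, HS.set])
      (by simp [HS.wr, HS.set])
      (by simp [HS.wr, HS.set]) (by simp [wr_m]) (by simp [wr_m]) (by norm_num)
    · simp only [HS.set, HS.wr, show x ≠ 11 by omega, show x ≠ 12 by omega, show x ≠ 13 by omega,
        reduceIte]
    · simp only [HS.set, wr_m, show e ≠ D.VB + 64 * k + 29 by omega, show e ≠ D.VB + 64 * k + 30 by omega,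
        reduceIte]

/-- Decreasing indices treat children before parents. An uncut block has uncut children, so the
records it combines exist. -/
theorem heapP_spec {w μ c N : ℕ} {D : Dat} {Q : ℕ → HS → Prop} {h : HS} (C : D.Ctx w μ c N)
    (I : D.Mid μ c h.m) (h2 : h.v 2 = μ) (h4 : h.v 4 = D.VB) (h7 : h.v 7 = 2 ^ D.K)
    (hQ : ∀ t v M', (∀ x, x < 10 → v x = h.v x) → D.Hfr h.m M' →
      (∀ j, 1 ≤ j → j < 2 * 2 ^ D.K → D.HFact μ c M' j) → t ≤ 3000 * D.G.m → Q t ⟨v, M'⟩) :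
    WP w heapP Q h := by
  have hlin := C.env.lin
  have h3 := C.env.m_le
  have hm := C.env.m_pos
  have hvb := C.vb
  have hK := C.K_le
  have hKp : 0 < 2 ^ D.K := by positivity
  refine sym.sound _ ?_
  simp only [heapP, sym, ok_simps, ex_simps, cost_simps, h7]
  refine ⟨by omega, ⟨by omega, by omega, by omega⟩, ?_⟩
  refine WP.for (2 * 2 ^ D.K - 1) 700 (fun i g => (∀ x, x < 10 → g.v x = h.v x) ∧
    g.v 10 = 2 * 2 ^ D.K - i ∧ D.Hfr h.m g.m ∧
    ∀ j, 2 * 2 ^ D.K - i ≤ j → j < 2 * 2 ^ D.K → D.HFact μ c g.m j) ?_ ?_ ?_ ?_ ?_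
  · rintro i g - -
    simp only [tst_simps, ok_simps]; omega
  · rintro i g hi ⟨-, h10, -⟩
    simp only [tst_simps, ex_simps, h10]; omega
  · rintro i g hi ⟨gx, g10, hH, hF⟩
    obtain ⟨k, hk⟩ : ∃ k, k = 2 * 2 ^ D.K - (i + 1) := ⟨_, rfl⟩
    rw [← hk]
    have k1 : 1 ≤ k := by omega
    have k2 : k < 2 * 2 ^ D.K := by omega
    have hhi := Dat.hi_le (D := D) k1 k2
    rw [show 2 * 2 ^ D.K - i = k + 1 by omega] at g10 hF
    have x2 : g.v 2 = μ := by rw [gx 2 (by omega), h2]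
    have x4 : g.v 4 = D.VB := by rw [gx 4 (by omega), h4]
    have x7 : g.v 7 = 2 ^ D.K := by rw [gx 7 (by omega), h7]
    have hbk : D.bk k = D.VB + 64 * k + 32 := rfl
    have hbk1 : D.bk (2 * k + 1) = D.VB + 64 * (2 * k + 1) + 32 := rfl
    have hbk2 : D.bk (2 * k) = D.VB + 64 * (2 * k) + 32 := rfl
    refine sym.sound _ ?_
    simp only [sym, tst_simps, ok_simps, ex_simps, cost_simps, g10, Nat.add_sub_cancel]
    refine ⟨by omega, ⟨by omega, by omega, by omega⟩, ?_⟩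
    refine heapEnds_spec (μ := μ) (c := c) C k1 k2 (by simp [HS.set, x4]) (by simp [HS.set, x7])
      (by simp [HS.set]) hF fun t1 v1 M1 e1 e2 e11 e12 e13 e5 e6 ht1 => ?_
    have I1 : D.Mid μ c M1 := (I.congr C hH).congr C
      (Dat.Hfr.of_ne k1 fun a ha => e2 a (by omega))
    have y2 := e1 2 (by omega)
    have y4 := e1 4 (by omega)
    have y7 := e1 7 (by omega)
    have y10 := e1 10 (by omega)
    simp only [HS.set, reduceIte, Nat.reduceEqDiff, x2, x4, x7] at y2 y4 y7 y10
    refine cutTest_spec C I1 k1 k2 y4 e11 e12 fun t2 v2 f1 f2 ht2 => ?_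
    have z2 := f1 2 (by omega)
    have z4 := f1 4 (by omega)
    have z7 := f1 7 (by omega)
    have z10 := f1 10 (by omega)
    have z11 := f1 11 (by omega)
    have z12 := f1 12 (by omega)
    have z13 := f1 13 (by omega)
    simp only [y2, y4, y7, y10, e11, e12, e13] at z2 z4 z7 z10 z11 z12 z13
    simp only [z4, z7, z10, z13]
    set x15 := v2 15 with hx15
    have hx2 : x15 ≤ 1 := by rw [f2]; split_ifs <;> omega
    have hreg : ∀ x, x < 10 → v2 x = h.v x := fun x hx => by
      rw [f1 x (by omega)]
      show v1 x = _
      rw [e1 x (by omega)]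
      simp only [HS.set, show x ≠ 10 by omega, reduceIte]
      exact gx x hx
    have hHs : ∀ M', (∀ e, e < D.VB + 64 * k + 32 ∨ D.VB + 64 * k + 44 ≤ e →
        M' e = if e = D.VB + 64 * k + 31 then x15 else M1 e) → D.BFact μ c M' k →
        D.Hfr h.m M' ∧ ∀ j, k ≤ j → j < 2 * 2 ^ D.K → D.HFact μ c M' j := by
      intro M' hM hB
      have hM2 : ∀ e, e < D.VB + 64 * k + 29 ∨ D.VB + 64 * k + 44 ≤ e → M' e = g.m e := fun e he => by
        rw [hM e (by omega), if_neg (by omega), e2 e (by omega)]; rfl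
      refine ⟨hH.trans (Dat.Hfr.of_ne k1 fun a ha => hM2 a (by omega)), fun j j1 j2 => ?_⟩
      rcases Nat.lt_or_ge k j with hj | hj
      · exact (hF j hj j2).congr fun a a1 a2 => hM2 a (by omega)
      · obtain rfl : j = k := by omega
        refine ⟨?_, ?_, ?_, hB⟩
        · rw [hM _ (by omega), if_neg (by omega)]; exact e5
        · rw [hM _ (by omega), if_neg (by omega)]; exact e6
        · rw [hM _ (by omega), if_pos rfl]; exact f2
    refine ⟨⟨by omega, by omega, by omega⟩, by omega, ⟨by omega, by omega⟩, fun hc => ?_, fun hc => ?_⟩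
    · have hn : ¬ D.cut k := fun hcut => by rw [hc, if_pos hcut] at f2; omega
      refine ⟨⟨by omega, by omega⟩, fun hlt => ?_, fun hlt => ?_⟩
      · obtain ⟨b1, b2, b3⟩ := (hF (2 * k + 1) (by omega) (by omega)).2.2.2 (C.ok.noncut_odd k1 hlt hn)
        obtain ⟨d1, d2, d3⟩ := (hF (2 * k) (by omega) (by omega)).2.2.2 (C.ok.noncut_even k1 hlt hn)
        obtain ⟨n1, n2, -⟩ := Dat.Ok.noncut_pid hn
        rw [Dat.hi_odd k1 hlt, Dat.lo_odd k1 hlt] at b1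
        rw [Dat.lo_even k1 hlt] at d1
        have hle1 : D.lo k ≤ D.hi (2 * k) := by
          have := D.lo_lt_hi (2 * k); rw [Dat.lo_even k1 hlt] at this; omega
        have hle2 : D.hi (2 * k) ≤ D.hi k := by
          have := D.lo_lt_hi (2 * k + 1); rw [Dat.hi_odd k1 hlt, Dat.lo_odd k1 hlt] at this; omega
        have hlen := C.cL_le n1 n2 (hle1.trans hle2)
        have htr : ∀ {p X}, D.VB + 64 * k + 64 ≤ p → Rec μ c g.m p X →
            Rec μ c ((HS.wr ⟨v2, M1⟩ (D.VB + 64 * k + 31) x15).m) p X := fun {p X} hp R => by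
          refine R.of_ne (a := D.VB + 64 * k + 29) (k := 3) (fun e he => ?_) (by omega)
          rw [wr_ne _ _ (by omega)]
          exact e2 e (by omega)
        simp only [HS.set, HS.wr, reduceIte, Nat.reduceEqDiff, z4, z10]
        refine ⟨by omega, ⟨by omega, by omega, by omega⟩, by omega, ⟨⟨by omega, ⟨by omega, ⟨⟨by omega, by omega,
          by omega⟩, by omega, by omega⟩, by omega⟩, by omega⟩, by omega, by omega⟩, by omega, ⟨⟨by omega,
          ⟨by omega, ⟨by omega, by omega, by omega⟩, by omega⟩, by omega⟩, by omega, by omega⟩, ?_⟩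
        refine ccat_spec C.env (D := D) (x := D.lo k) (y := D.hi (2 * k)) (z := D.hi k)
          (a := D.bk k) (b := D.bk (2 * k + 1)) (b' := D.bk (2 * k)) (by simp [z2]) (by simp [hbk])
          (by simp [hbk1]) (by simp [hbk2]) (by omega) (by omega) (by omega) (by omega) (by omega) hle1 hle2
          ⟨htr (by omega) b1.1, htr (by omega) b1.2⟩ ⟨htr (by omega) d1.1, htr (by omega) d1.2⟩
          hlen.1 hlen.2 fun t3 v3 M3 g1 g2 g3 g4 ht3 => ?_
        obtain ⟨q1, q2⟩ := hHs M3 (fun e he => by rw [g2 e (by omega)]) fun _ =>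
          ⟨g3, fun hh => absurd hlt (by omega), fun _ => g4⟩
        refine ⟨⟨fun x hx => ?_, ?_, q1, q2⟩, by omega⟩
        · show v3 x = _
          rw [g1 x (by omega)]
          simp only [show x ≠ 30 by omega, show x ≠ 31 by omega, show x ≠ 32 by omega, reduceIte]
          exact hreg x hx
        · show v3 10 = _
          rw [g1 10 (by omega)]
          simp [z10]
      · have I2 : D.Mid μ c ((HS.wr ⟨v2, M1⟩ (D.VB + 64 * k + 31) x15).m) := I1.congr C
          (Dat.Hfr.of_ne k1 fun a ha => wr_ne _ _ (by omega))
        refine leafB_spec C I2 k1 k2 (by omega) hn z2 z4 z11 z12 z13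
          fun t3 v3 M3 g1 g2 g3 ht3 => ?_
        obtain ⟨q1, q2⟩ := hHs M3 (fun e he => by rw [g2 e (by omega)]; rfl) g3
        refine ⟨⟨fun x hx => ?_, ?_, q1, q2⟩, by omega⟩
        · show v3 x = _
          rw [g1 x (by omega)]
          exact hreg x hx
        · show v3 10 = _
          rw [g1 10 (by omega)]
          exact z10
    · have hcut : D.cut k := by
        by_contra hn
        rw [if_neg hn] at f2; exact hc f2
      obtain ⟨q1, q2⟩ := hHs ((HS.wr ⟨v2, M1⟩ (D.VB + 64 * k + 31) x15).m) (fun e he => wr_m _ _ _ _)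
        fun hn => absurd hcut hn
      exact ⟨⟨hreg, trivial, q1, q2⟩, by omega⟩
  · rintro t g ⟨gx, g10, hH, hF⟩ ht
    refine hQ _ _ _ gx hH (fun j j1 j2 => hF j (by omega) j2) ?_
    simp only [tst_simps, cost_simps] at ht ⊢
    omega
  · refine ⟨fun x hx => ?_, ?_, fun _ _ => rfl, fun j j1 j2 => absurd j2 (by omega)⟩
    · simp only [HS.set, show x ≠ 10 by omega, reduceIte]
    · simp [HS.set]

end WhileLang

/-! ### Contexts that reach back to the last cut -/

namespace WhileLang

open Ex St

namespace Dat

variable {D : Dat}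

theorem SFact.congr {μ c h : ℕ} {M M' : ℕ → ℕ} (F : D.SFact μ c M h)
    (hM : ∀ a, D.VB + 64 * h + 44 ≤ a → a < D.VB + 64 * h + 56 → M' a = M a) :
    D.SFact μ c M' h := by
  have hs : D.sk h = D.VB + 64 * h + 44 := rfl
  have e : ∀ k, k < 12 → M' (D.sk h + k) = M (D.sk h + k) := fun k hk => hM _ (by omega) (by omega)
  obtain ⟨⟨r1, r2⟩, p1, p2⟩ := F
  exact ⟨⟨⟨(e 3 (by omega)).trans r1.1, (e 4 (by omega)).trans r1.2.1, (e 5 (by omega)).trans r1.2.2⟩,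
    ⟨(e 9 (by omega)).trans r2.1, (e 10 (by omega)).trans r2.2.1, (e 11 (by omega)).trans r2.2.2⟩⟩,
    ⟨(e 0 (by omega)).trans p1.1, (e 1 (by omega)).trans p1.2.1, (e 2 (by omega)).trans p1.2.2⟩,
    ⟨(e 6 (by omega)).trans p2.1, (e 7 (by omega)).trans p2.2.1, (e 8 (by omega)).trans p2.2.2⟩⟩

/-- The operands belong to smaller heap nodes, to record 0, or to the block of `h` itself. So
increasing indices find them finished, and they are disjoint from the target. -/
theorem Ok.op_le (H : D.Ok) {h : ℕ} (h1 : 1 ≤ h) (h2 : h < 2 * 2 ^ D.K) :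
    D.VB + 32 ≤ D.opx h ∧ D.opx h + 12 ≤ D.sk h ∧ D.VB + 32 ≤ D.opy h ∧ D.opy h + 12 ≤ D.sk h := by
  unfold opx opy
  split_ifs with hc hc2
  · unfold bk sk; omega
  · have hg : 1 ≤ h / 2 := by
      rcases Nat.eq_zero_or_pos (h / 2) with h0 | h0
      · have : h = 1 := by omega
        have := H.prev h1 h2 hc
        omega
      · exact h0
    have := (H.q_spec hg (by omega)).2.2.2.2.2 hc2.2
    unfold sk; omega
  · unfold bk sk; omega

/-- The operands describe contexts that can be combined. -/
theorem Ok.suf_ops (H : D.Ok) {μ c h : ℕ} {M : ℕ → ℕ} (h1 : 1 ≤ h) (h2 : h < 2 * 2 ^ D.K)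
    (hE : Rec μ c M (D.VB + 32) [] ∧ Rec μ c M (D.VB + 38) []) (hB : D.BFact μ c M h)
    (hS : ∀ g, 1 ≤ g → g < h → D.SFact μ c M g) :
    ∃ y, D.hi (D.q h) ≤ y ∧ y ≤ D.hi h ∧ D.CRec μ c M (D.opx h) y (D.hi h) ∧
      D.CRec μ c M (D.opy h) (D.hi (D.q h)) y := by
  by_cases hc : D.cut h
  · have he : D.CRec μ c M (D.bk 0) (D.hi h) (D.hi h) := by
      rw [CRec, cL_self, cR_self]; exact hE
    rw [Ok.q_cut hc]
    refine ⟨D.hi h, le_rfl, le_rfl, ?_, ?_⟩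
    · rw [opx, if_pos hc]; exact he
    · rw [opy, if_pos hc]; exact he
  · obtain ⟨r1, r2, r3⟩ := H.prev h1 h2 hc
    have hqh := H.q_spec h1 h2
    have hqn := hqh.2.2.2.2.2 hc
    by_cases hodd : h % 2 = 1 ∧ ¬ D.cut (h / 2)
    · obtain ⟨ho, hc2⟩ := hodd
      obtain ⟨g, hg⟩ : ∃ g, g = h / 2 := ⟨_, rfl⟩
      rw [opx, opy, if_neg hc, if_neg hc, if_pos ⟨ho, hc2⟩, if_pos ⟨ho, hc2⟩]
      rw [← hg] at hc2 ⊢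
      have hg1 : 1 ≤ g := by omega
      have hgK : g < 2 ^ D.K := by omega
      have hh : h = 2 * g + 1 := by omega
      have e1 : D.hi h = D.hi g := by rw [hh]; exact hi_odd hg1 hgK
      obtain ⟨s1, s2, s3, s4, s5, s6⟩ := H.q_spec hg1 (by omega : g < 2 * 2 ^ D.K)
      obtain ⟨t1, t2, t3, t4, t5⟩ := s6 hc2
      have e3 : D.q h = D.q (2 * D.q g + 1) := by rw [hh]; exact H.q_half hg1 hgK hc2
      have e4 : D.hi (2 * D.q g + 1) = D.hi (D.q g) := hi_odd s1 (by omega)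
      have c1 := (hS g hg1 (by omega)).1
      have c2 := (hS (2 * D.q g + 1) (by omega) (by omega)).1
      rw [← e3, e4] at c2
      rw [← e1] at c1 s5
      refine ⟨D.hi (D.q g), ?_, s5, c1, c2⟩
      rw [e3, ← e4]
      exact (H.q_spec (by omega) (by omega)).2.2.2.2.1
    · rw [opx, opy, if_neg hc, if_neg hc, if_neg hodd, if_neg hodd]
      have c2 := (hS (h - 1) r1 (by omega)).1
      rw [← Ok.q_noncut h1 hc, r3] at c2
      exact ⟨D.lo h, hqn.2.2.2.1, (lo_lt_hi h).le, (hB hc).1, c2⟩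

end Dat

/-- Find the operands for the node `r10`; `r11` is the last cut. -/
def sufOp : St := .asg 13 (r 4 + 64 * r 10) ;; .asg 12 (r 10 / 2) ;; .asg 14 (r 4 + 64 * r 12) ;;
  .asg 30 (r 13 + 44) ;;
  .ite (.eq (ld (r 13 + 31)) 0)
    (.asg 31 (r 13 + 32) ;; .asg 32 (r 4 + 64 * (r 10 - 1) + 44) ;;
      .ite (.eq (r 10 % 2) 1)
        (.ite (.eq (ld (r 14 + 31)) 0)
          (.asg 31 (r 14 + 44) ;; .asg 32 (r 4 + 64 * (2 * ld (r 14 + 56) + 1) + 44)) .skip) .skip)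
    (.asg 11 (r 10) ;; .asg 31 (r 4 + 32) ;; .asg 32 (r 4 + 32))

/-- Compute the records of all contexts that reach back to the last cut. -/
def sufP : St := .asg 10 1 ;; .asg 11 0 ;; .loop (.lt (r 10) (2 * r 7))
  (.call sufOp ;; .call ccat ;; .sto (r 13 + 56) (r 11) ;; .asg 10 (r 10 + 1))

set_option maxHeartbeats 1000000 in
theorem sufOp_spec {w μ c N k : ℕ} {D : Dat} {Q : ℕ → HS → Prop} {h : HS} (C : D.Ctx w μ c N)
    (k1 : 1 ≤ k) (k2 : k < 2 * 2 ^ D.K) (h4 : h.v 4 = D.VB) (h10 : h.v 10 = k)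
    (h11 : h.v 11 = D.q (k - 1))
    (hF : ∀ j, 1 ≤ j → j < 2 * 2 ^ D.K → h.m (D.VB + 64 * j + 31) = if D.cut j then 1 else 0)
    (hq : ∀ j, 1 ≤ j → j < k → h.m (D.VB + 64 * j + 56) = D.q j)
    (hQ : ∀ t v, (∀ x, x < 11 → v x = h.v x) → v 11 = D.q k → v 13 = D.VB + 64 * k →
      v 30 = D.sk k → v 31 = D.opx k → v 32 = D.opy k → t ≤ 100 → Q t ⟨v, h.m⟩) :
    WP w sufOp Q h := by
  have hlin := C.env.lin
  have h3 := C.env.m_le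
  have hvb := C.vb
  have hK := C.K_le
  have hFk := hF k k1 k2
  refine sym.sound _ ?_
  simp only [sufOp, sym, tst_simps, ok_simps, ex_simps, cost_simps, reduceIte, Nat.reduceEqDiff,
    h4, h10, hFk]
  refine ⟨by omega, ⟨by omega, ⟨by omega, by omega, by omega⟩, by omega⟩, by omega, ⟨by omega, by omega,
    by omega⟩, by omega, ⟨by omega, ⟨by omega, by omega, by omega⟩, by omega⟩, by omega, ⟨by omega,
    by omega, by omega⟩, ⟨⟨by omega, by omega, by omega⟩, by omega⟩, fun hc => ?_, fun hc => ?_⟩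
  · have hn : ¬ D.cut k := fun hcut => by rw [if_pos hcut] at hc; omega
    have hprev := C.ok.prev k1 k2 hn
    have hqk := Dat.Ok.q_noncut k1 hn
    refine ⟨by omega, ⟨by omega, by omega, by omega⟩, by omega, ⟨⟨by omega, ⟨by omega, ⟨by omega, by omega,
      by omega⟩, by omega⟩, by omega⟩, by omega, by omega⟩, ⟨⟨by omega, by omega, by omega⟩, by omega⟩,
      fun ho => ⟨⟨⟨by omega, by omega, by omega⟩, by omega⟩, ?_⟩, fun ho => ?_⟩
    -- The root is cut, as its block starts at position 0; an uncut node thus has a parent.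
    · have hg1 : 1 ≤ k / 2 := by omega
      have hg2 : k / 2 < 2 * 2 ^ D.K := by omega
      have hqs := C.ok.q_spec hg1 hg2
      rw [hF (k / 2) hg1 hg2, hq (k / 2) hg1 (by omega)]
      refine ⟨fun hc2 => ?_, fun hc2 => ?_⟩
      · have hn2 : ¬ D.cut (k / 2) := fun hcut => by rw [if_pos hcut] at hc2; omega
        refine ⟨by omega, ⟨by omega, by omega, by omega⟩, by omega, ⟨⟨by omega, ⟨by omega, ⟨⟨by omega,
          ⟨by omega, by omega, by omega⟩, by omega⟩, by omega, by omega⟩, by omega⟩, by omega⟩, by omega,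
          by omega⟩, ?_⟩
        refine hQ _ _ (fun x hx => ?_) ?_ ?_ ?_ ?_ ?_ (by norm_num)
        · simp only [HS.set, show x ≠ 12 by omega, show x ≠ 13 by omega, show x ≠ 14 by omega,
            show x ≠ 30 by omega, show x ≠ 31 by omega, show x ≠ 32 by omega, reduceIte]
        · simp [HS.set, h11, hqk]
        · simp [HS.set]
        · simp [HS.set, Dat.sk]
        · simp [HS.set, Dat.opx, hn, hn2, ho, Dat.sk]
        · simp [HS.set, Dat.opy, hn, hn2, ho, Dat.sk]
      · have hn2 : D.cut (k / 2) := by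
          by_contra hcut; rw [if_neg hcut] at hc2; exact hc2 rfl
        refine hQ _ _ (fun x hx => ?_) ?_ ?_ ?_ ?_ ?_ (by norm_num)
        · simp only [HS.set, show x ≠ 12 by omega, show x ≠ 13 by omega, show x ≠ 14 by omega,
            show x ≠ 30 by omega, show x ≠ 31 by omega, show x ≠ 32 by omega, reduceIte]
        · simp [HS.set, h11, hqk]
        · simp [HS.set]
        · simp [HS.set, Dat.sk]
        · simp [HS.set, Dat.opx, hn, hn2, Dat.bk]
        · simp [HS.set, Dat.opy, hn, hn2, Dat.sk]
    · refine hQ _ _ (fun x hx => ?_) ?_ ?_ ?_ ?_ ?_ (by norm_num)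
      · simp only [HS.set, show x ≠ 12 by omega, show x ≠ 13 by omega, show x ≠ 14 by omega,
          show x ≠ 30 by omega, show x ≠ 31 by omega, show x ≠ 32 by omega, reduceIte]
      · simp [HS.set, h11, hqk]
      · simp [HS.set]
      · simp [HS.set, Dat.sk]
      · simp [HS.set, Dat.opx, hn, ho, Dat.bk]
      · simp [HS.set, Dat.opy, hn, ho, Dat.sk]
  · have hcut : D.cut k := by
      by_contra hn; rw [if_neg hn] at hc; exact hc rfl
    refine ⟨by omega, by omega, by omega, ⟨by omega, by omega, by omega⟩, by omega, ⟨by omega, by omega,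
      by omega⟩, ?_⟩
    refine hQ _ _ (fun x hx => ?_) ?_ ?_ ?_ ?_ ?_ (by norm_num)
    · simp only [HS.set, show x ≠ 11 by omega, show x ≠ 12 by omega, show x ≠ 13 by omega,
        show x ≠ 14 by omega, show x ≠ 30 by omega, show x ≠ 31 by omega, show x ≠ 32 by omega, reduceIte]
    · simp [HS.set, Dat.Ok.q_cut hcut]
    · simp [HS.set]
    · simp [HS.set, Dat.sk]
    · simp [HS.set, Dat.opx, hcut, Dat.bk]
    · simp [HS.set, Dat.opy, hcut, Dat.bk]

-- The last cut runs across levels in register 11, which is sound because each level begins with a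
-- cut. Field 56 keeps `q` for the odd children of later nodes, whose remainder is found through the
-- last cut of the parent.
set_option maxHeartbeats 1000000 in
theorem sufP_spec {w μ c N : ℕ} {D : Dat} {Q : ℕ → HS → Prop} {h : HS} (C : D.Ctx w μ c N)
    (I : D.Mid μ c h.m) (h2 : h.v 2 = μ) (h4 : h.v 4 = D.VB) (h7 : h.v 7 = 2 ^ D.K)
    (hF : ∀ j, 1 ≤ j → j < 2 * 2 ^ D.K → D.HFact μ c h.m j)
    (hQ : ∀ t v M', (∀ x, x < 10 → v x = h.v x) → D.Hfr h.m M' →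
      (∀ j, 1 ≤ j → j < 2 * 2 ^ D.K → D.BFact μ c M' j ∧ D.SFact μ c M' j) → t ≤ 2000 * D.G.m →
      Q t ⟨v, M'⟩) : WP w sufP Q h := by
  have hlin := C.env.lin
  have h3 := C.env.m_le
  have hm := C.env.m_pos
  have hvb := C.vb
  have hK := C.K_le
  have hKp : 0 < 2 ^ D.K := by positivity
  refine sym.sound _ ?_
  simp only [sufP, sym, ok_simps, ex_simps, cost_simps]
  refine ⟨by omega, by omega, by omega, by omega, ?_⟩
  refine WP.for (2 * 2 ^ D.K - 1) 400 (fun i g => (∀ x, x < 10 → g.v x = h.v x) ∧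
    g.v 10 = i + 1 ∧ g.v 11 = D.q i ∧ D.Hfr h.m g.m ∧
    (∀ j, 1 ≤ j → j < 2 * 2 ^ D.K → D.HFact μ c g.m j) ∧
    ∀ j, 1 ≤ j → j < i + 1 → g.m (D.VB + 64 * j + 56) = D.q j ∧ D.SFact μ c g.m j) ?_ ?_ ?_ ?_ ?_
  · rintro i g - ⟨gx, -⟩
    simp only [tst_simps, ok_simps, ex_simps, gx 7 (by omega), h7]; omega
  · rintro i g hi ⟨gx, h10, -⟩
    simp only [tst_simps, ex_simps, h10, gx 7 (by omega), h7]; omega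
  · rintro i g hi ⟨gx, g10, g11, hH, hF, hS⟩
    obtain ⟨k, rfl⟩ : ∃ k, i + 1 = k := ⟨_, rfl⟩
    have k1 : 1 ≤ i + 1 := by omega
    have k2 : i + 1 < 2 * 2 ^ D.K := by omega
    generalize hk : i + 1 = k at *
    have hik : k - 1 = i := by omega
    have x2 : g.v 2 = μ := by rw [gx 2 (by omega), h2]
    have x4 : g.v 4 = D.VB := by rw [gx 4 (by omega), h4]
    refine sym.sound _ ?_
    simp only [sym, tst_simps, ok_simps, ex_simps, cost_simps]
    refine sufOp_spec C k1 k2 x4 g10 (by rw [hik, g11]) (fun j j1 j2 => (hF j j1 j2).2.2.1)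
      (fun j j1 j2 => (hS j j1 j2).1) fun t1 v1 e1 e11 e13 e30 e31 e32 ht1 => ?_
    obtain ⟨y, y1, y2, cx, cy⟩ := C.ok.suf_ops k1 k2 (I.congr C hH).emp (hF k k1 k2).2.2.2
      fun j j1 j2 => (hS j j1 j2).2
    obtain ⟨o1, o2, o3, o4⟩ := C.ok.op_le k1 k2
    have hsk : D.sk k = D.VB + 64 * k + 44 := rfl
    have hlen : (D.cL (D.hi (D.q k)) (D.hi k)).length ≤ N ∧ (D.cR (D.hi (D.q k)) (D.hi k)).length ≤ N := by
      have hqs := C.ok.q_spec k1 k2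
      by_cases hc : D.cut k
      · rw [Dat.Ok.q_cut hc, D.cL_self, D.cR_self]; simp
      · have := hqs.2.2.2.2.2 hc
        exact C.cL_le this.2.1 this.2.2.1 hqs.2.2.2.2.1
    refine ccat_spec C.env (D := D) (x := D.hi (D.q k)) (y := y) (z := D.hi k) (a := D.sk k)
      (b := D.opx k) (b' := D.opy k) (by show v1 2 = μ; rw [e1 2 (by omega), x2]) e30 e31 e32 (by omega)
      (by omega) (by omega) (by omega) (by omega) y1 y2 cx cy hlen.1 hlen.2
      fun t2 v2 M2 f1 f2 f3 f4 ht2 => ?_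
    have z10 : v2 10 = k := by rw [f1 10 (by omega)]; show v1 10 = k; rw [e1 10 (by omega), g10]
    have z11 : v2 11 = D.q k := by rw [f1 11 (by omega)]; exact e11
    have z13 : v2 13 = D.VB + 64 * k := by rw [f1 13 (by omega)]; exact e13
    have hqk := (C.ok.q_spec k1 k2).2.1
    simp only [z10, z11, z13]
    refine ⟨⟨by omega, by omega, by omega⟩, by omega, by omega, ⟨by omega, by omega, by omega⟩, ?_, by omega⟩
    have hM : ∀ a, a < D.VB + 64 * k + 44 ∨ D.VB + 64 * k + 57 ≤ a →
        (HS.wr ⟨v2, M2⟩ (D.VB + 64 * k + 56) (D.q k)).m a = g.m a := fun a ha => by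
      rw [wr_ne _ _ (by omega)]; exact f2 a (by omega)
    have hM2 : ∀ a, a < D.VB + 64 * k + 56 →
        (HS.wr ⟨v2, M2⟩ (D.VB + 64 * k + 56) (D.q k)).m a = M2 a := fun a ha => wr_ne _ _ (by omega)
    refine ⟨fun x hx => ?_, by simp [HS.set], by simp [HS.set, HS.wr, z11], ?_, fun j j1 j2 => ?_,
      fun j j1 j2 => ?_⟩
    · simp only [HS.set, HS.wr, show x ≠ 10 by omega, reduceIte]
      rw [f1 x (by omega)]
      show v1 x = _
      rw [e1 x (by omega), gx x hx]
    · exact hH.trans (Dat.Hfr.of_ne k1 fun a ha => hM a (by omega))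
    · exact (hF j j1 j2).congr fun a a1 a2 => hM a (by omega)
    · rcases Nat.lt_or_ge j k with hj | hj
      · obtain ⟨s1, s2⟩ := hS j j1 (by omega)
        exact ⟨(hM _ (by omega)).trans s1, s2.congr fun a a1 a2 => hM a (by omega)⟩
      · obtain rfl : j = k := by omega
        exact ⟨wr_self _ _ rfl, Dat.SFact.congr (M := M2) ⟨f3, f4⟩ fun a a1 a2 => hM2 a (by omega)⟩
  · rintro t g ⟨gx, g10, g11, hH, hF, hS⟩ ht
    refine hQ _ _ _ gx hH (fun j j1 j2 => ⟨(hF j j1 j2).2.2.2, (hS j j1 (by omega)).2⟩) ?_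
    simp only [tst_simps, cost_simps] at ht ⊢
    omega
  · exact ⟨fun x hx => by simp only [HS.set, show x ≠ 10 by omega, show x ≠ 11 by omega, reduceIte],
      by simp [HS.set], by simp [HS.set, Dat.q], fun _ _ => rfl, hF, fun j j1 j2 => by omega⟩

end WhileLang

/-! ### Nodes of the variables -/

namespace WhileLang

open Ex St

namespace Dat

variable (D : Dat)

/-- Only tags and pointers of variables, and auxiliary records, have changed. -/
def Vfr (M M' : ℕ → ℕ) : Prop :=
  ∀ a, a < D.VB ∨ (3 ≤ (a - D.VB) % 64 ∧ (a - D.VB) % 64 < 6) ∨ 12 ≤ (a - D.VB) % 64 → M' a = M a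

variable {D}

theorem Vfr.trans {M M' M'' : ℕ → ℕ} (h1 : D.Vfr M M') (h2 : D.Vfr M' M'') : D.Vfr M M'' :=
  fun a ha => (h2 a ha).trans (h1 a ha)

theorem Vfr.of_ne {M M' : ℕ → ℕ} {v : ℕ}
    (hM : ∀ a, a < D.VB + 64 * v ∨ (D.VB + 64 * v + 3 ≤ a ∧ a < D.VB + 64 * v + 6) ∨
      D.VB + 64 * v + 12 ≤ a → M' a = M a) : D.Vfr M M' :=
  fun a ha => hM a (by omega)

theorem Mid.congr_vfr {w μ c N : ℕ} {M M' : ℕ → ℕ} (C : D.Ctx w μ c N) (I : D.Mid μ c M)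
    (h : D.Vfr M M') : D.Mid μ c M' := by
  have hvb := C.vb
  exact ⟨fun A hA => (h _ (by omega)).trans (I.kd A hA), fun A hA => (h _ (by omega)).trans (I.a1 A hA),
    fun A hA => (h _ (by omega)).trans (I.a2 A hA), fun x => (h _ (by omega)).trans (I.va x),
    fun x => (h _ (by omega)).trans (I.pid x),
    fun v hv => ⟨(h _ (by omega)).trans (I.rcd v hv).1, (h _ (by omega)).trans (I.rcd v hv).2.1,
      (h _ (by omega)).trans (I.rcd v hv).2.2⟩,
    fun v hv => (h _ (by omega)).trans (I.pow v hv),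
    ⟨(h _ (by omega)).trans I.emp.1.1, (h _ (by omega)).trans I.emp.1.2.1,
      (h _ (by omega)).trans I.emp.1.2.2⟩,
    ⟨(h _ (by omega)).trans I.emp.2.1, (h _ (by omega)).trans I.emp.2.2.1,
      (h _ (by omega)).trans I.emp.2.2.2⟩⟩

theorem VFact.congr {μ c x : ℕ} {M M' : ℕ → ℕ} (F : D.VFact μ c M x)
    (hM : ∀ a, D.VB + 64 * D.va x ≤ a → a < D.VB + 64 * D.va x + 12 → M' a = M a) :
    D.VFact μ c M' x := by
  have hv : D.vr (D.va x) = D.VB + 64 * D.va x := rfl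
  have ha : D.ax (D.va x) = D.VB + 64 * D.va x + 6 := rfl
  have e : ∀ k, k < 12 → M' (D.vr (D.va x) + k) = M (D.vr (D.va x) + k) :=
    fun k hk => hM _ (by omega) (by omega)
  have e' : ∀ k, k < 6 → M' (D.ax (D.va x) + k) = M (D.ax (D.va x) + k) :=
    fun k hk => hM _ (by omega) (by omega)
  have e0 := e 0 (by omega)
  have e0' := e' 0 (by omega)
  rw [add_zero] at e0 e0'
  unfold VFact PairAt Rec at *
  rw [e0, e 1 (by omega), e 2 (by omega), e0', e' 1 (by omega), e' 2 (by omega), e' 3 (by omega),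
    e' 4 (by omega), e' 5 (by omega)]
  exact F

end Dat

/-- Complete the node of the variable at position `r10`. -/
def varOp : St := .asg 12 (ld (r 4 + 64 * r 10 + 20)) ;; .asg 13 (r 4 + 64 * r 12) ;;
  .asg 14 (ld (r 4 + 64 * r 10 + 21)) ;;
  .ite (.eq (r 14) (r 10))
    (.asg 15 (5 + 3 * r 12) ;; .asg 16 (ld (r 15)) ;; .sto (r 13) (r 16) ;;
      .ite (.eq (r 16) 0) .skip
        (.sto (r 13 + 1) (r 4 + 64 * ld (r 15 + 1)) ;;
          .ite (.eq (r 16) 1) (.sto (r 13 + 2) (r 4 + 64 * ld (r 15 + 2)))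
            (.sto (r 13 + 2) (ld (r 15 + 2)))))
    (.asg 17 (r 4 + 64 * (r 7 + r 10 - 1) + 44) ;; .asg 30 (r 13 + 6) ;;
      .asg 31 (r 4 + 64 * ld (r 4 + 64 * r 14 + 20)) ;; .asg 32 (r 17 + 6) ;; .call mk ;;
      .sto (r 13) 1 ;; .sto (r 13 + 1) (r 17) ;; .sto (r 13 + 2) (r 13 + 6))

/-- Complete the nodes of all variables. -/
def varP : St := .asg 10 1 ;; .loop (.lt (r 10) (r 6 + 1)) (.call varOp ;; .asg 10 (r 10 + 1))

-- The end of a path keeps its rule, with variables turned into addresses. Any other variable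
-- becomes a pair of its left context and the auxiliary record, which pairs the string of the path's
-- end with the right context. The auxiliary record reuses the fields of the stack and of the
-- topological list.
set_option maxHeartbeats 1000000 in
theorem varOp_spec {w μ c N k : ℕ} {D : Dat} {Q : ℕ → HS → Prop} {h : HS} (C : D.Ctx w μ c N)
    (I : D.Mid μ c h.m) (k1 : 1 ≤ k) (k2 : k ≤ D.cnt) (h2 : h.v 2 = μ) (h4 : h.v 4 = D.VB)
    (h7 : h.v 7 = 2 ^ D.K) (h10 : h.v 10 = k) (hS : D.SFact μ c h.m (2 ^ D.K + k - 1))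
    (hQ : ∀ t v M', (∀ x, x < 11 → v x = h.v x) →
      (∀ a, a < D.VB + 64 * D.va k ∨ (D.VB + 64 * D.va k + 3 ≤ a ∧ a < D.VB + 64 * D.va k + 6) ∨
        D.VB + 64 * D.va k + 12 ≤ a → M' a = h.m a) →
      D.VFact μ c M' k → t ≤ 300 → Q t ⟨v, M'⟩) : WP w varOp Q h := by
  have hlin := C.env.lin
  have h3 := C.env.m_le
  have hvb := C.vb
  have hK := C.K_le
  have hcnt := C.cnt_le
  have hcK := C.ok.cnt_le
  have hv := C.ok.mem k k1 k2
  have hvm := C.ok.ord.lt hv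
  have hpp := C.ok.pid_pos k k1 k2
  have i0 := I.kd _ hvm
  have i1 := I.a1 _ hvm
  have i2 := I.a2 _ hvm
  have b1 := C.env.a1_le _ hvm
  have b2 := C.env.a2_le _ hvm
  have b0 := D.G.kd_le _ hvm
  have hvr : D.vr (D.va k) = D.VB + 64 * D.va k := rfl
  refine sym.sound _ ?_
  simp only [varOp, sym, tst_simps, ok_simps, ex_simps, cost_simps, reduceIte, Nat.reduceEqDiff,
    h4, h7, h10, I.va, I.pid, i0]
  refine ⟨by omega, ⟨⟨by omega, ⟨by omega, by omega, by omega⟩, by omega⟩, by omega, by omega⟩, by omega,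
    ⟨by omega, ⟨by omega, by omega, by omega⟩, by omega⟩, by omega, ⟨⟨by omega, ⟨by omega, by omega,
    by omega⟩, by omega⟩, by omega, by omega⟩, ⟨by omega, by omega⟩, fun hp => ?_, fun hp => ?_⟩
  · have w1 : (HS.wr ⟨fun y => if y = 16 then D.G.kd (D.va k) else if y = 15 then 5 + 3 * D.va k else
      if y = 14 then D.pid k else if y = 13 then D.VB + 64 * D.va k else if y = 12 then D.va k else h.v y,
      h.m⟩ (D.VB + 64 * D.va k) (D.G.kd (D.va k))).m (5 + 3 * D.va k + 1) = D.G.a1 (D.va k) := by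
      rw [wr_ne _ _ (by omega)]; exact i1
    have hreg : ∀ x, x < 11 → (if x = 16 then D.G.kd (D.va k) else if x = 15 then 5 + 3 * D.va k else
      if x = 14 then D.pid k else if x = 13 then D.VB + 64 * D.va k else if x = 12 then D.va k else h.v x)
      = h.v x := fun x hx => by
      simp only [show x ≠ 12 by omega, show x ≠ 13 by omega, show x ≠ 14 by omega,
        show x ≠ 15 by omega, show x ≠ 16 by omega, reduceIte]
    simp only [HS.set] at *
    refine ⟨by omega, ⟨by omega, ⟨by omega, by omega, by omega⟩, by omega⟩, by omega, by omega, by omega,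
      by omega, ⟨by omega, by omega⟩, fun z => ?_, fun z => ⟨⟨by omega, by omega, by omega⟩, ?_⟩⟩
    · refine hQ _ _ _ (fun x hx => hreg x hx) (fun a ha => if_neg (by omega)) ?_ (by norm_num)
      rw [Dat.VFact, if_pos hp]
      refine ⟨fun _ => ?_, fun hh => by omega, fun hh => by omega⟩
      simp [hvr, z]
    · have hl1 : D.G.a1 (D.va k) < D.G.m := by
        rcases (show D.G.kd (D.va k) = 1 ∨ D.G.kd (D.va k) = 2 by omega) with hk | hk
        · exact (D.G.pair _ hvm hk).1
        · exact (D.G.run _ hvm hk).1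
      have w2 : ∀ v x (y : ℕ), x ≠ 5 + 3 * D.va k + 2 → y ≠ 5 + 3 * D.va k + 2 → ∀ a b,
          ((HS.wr ⟨v, h.m⟩ x a).wr y b).m (5 + 3 * D.va k + 2) = D.G.a2 (D.va k) :=
        fun v x y hx hy a b => by
          rw [wr_ne _ _ hy.symm, wr_ne _ _ hx.symm]; exact i2
      rw [w1, w2 _ _ _ (by omega) (by omega)]
      refine ⟨⟨by omega, ⟨by omega, ⟨by omega, by omega, by omega⟩, by omega⟩, by omega⟩,
        ⟨by omega, by omega⟩, fun z1 => ⟨⟨by omega, by omega, by omega⟩, ?_⟩,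
        fun z1 => ⟨⟨by omega, by omega, by omega⟩, ⟨by omega, by omega, by omega⟩, ?_⟩⟩
      · have hl2 := (D.G.pair _ hvm z1).2.1
        refine ⟨⟨by omega, ⟨by omega, ⟨by omega, by omega, by omega⟩, by omega⟩, by omega⟩, ?_⟩
        refine hQ _ _ _ (fun x hx => hreg x hx) (fun a ha => ?_) ?_ (by norm_num)
        · simp only [wr_m]
          rw [if_neg (by omega), if_neg (by omega), if_neg (by omega)]
        rw [Dat.VFact, if_pos hp]
        refine ⟨fun hh => by omega, fun _ => ⟨?_, ?_, ?_⟩, fun hh => by omega⟩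
        · simp [hvr, wr_m, Dat.vr, *]
        · simp [hvr, wr_m, Dat.vr, *]
        · simp [hvr, wr_m, Dat.vr, *]
      · refine hQ _ _ _ (fun x hx => hreg x hx) (fun a ha => ?_) ?_ (by norm_num)
        · simp only [wr_m]
          rw [if_neg (by omega), if_neg (by omega), if_neg (by omega)]
        rw [Dat.VFact, if_pos hp]
        refine ⟨fun hh => by omega, fun hh => by omega, fun hh => ⟨?_, ?_, ?_⟩⟩
        · simp [hvr, wr_m, Dat.vr, *]
        · simp [hvr, wr_m, Dat.vr, *]
        · simp [hvr, wr_m, Dat.vr, *]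
  · have m1 := C.ok.mem (D.pid k) (by omega) (by omega)
    have n1 := C.ok.ord.lt m1
    have hpt := C.ok.pid_mid (y := k) (x := D.pid k) (by omega) (by omega) (by omega)
    have hh : D.hi (2 ^ D.K + k - 1) = k := by rw [Dat.hi_leaf (by omega)]; omega
    have hR := hS.1.2
    rw [C.ok.leaf_hi_q k1 k2, hh] at hR
    have hlen := congrArg List.length (C.ok.str_chain (x := D.pid k) (y := k) (by omega) hpt (by omega))
    have hle := (C.ok.ord.len_le hv).trans C.env.len_le
    have hsk : D.sk (2 ^ D.K + k - 1) = D.VB + 64 * (2 ^ D.K + k - 1) + 44 := rfl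
    simp only [HS.set] at *
    refine ⟨by omega, ⟨⟨by omega, ⟨by omega, ⟨⟨by omega, by omega, by omega⟩, by omega, by omega⟩,
      by omega⟩, by omega⟩, by omega, by omega⟩, by omega, ⟨by omega, by omega, by omega⟩, by omega,
      ⟨by omega, ⟨by omega, ⟨⟨by omega, ⟨by omega, by omega, by omega⟩, by omega⟩, by omega, by omega⟩,
      by omega⟩, by omega⟩, by omega, ⟨by omega, by omega, by omega⟩, ?_⟩
    refine mk_spec C.env (X := D.G.str (D.va (D.pid k))) (Y := D.cR (D.pid k) k) (by simp [h2])
      (by simp; omega) (by simp; omega) (by simp; omega) (by simpa using I.rcd _ m1)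
      (by simpa [hsk] using hR) ?_ fun t1 v1 M1 e1 e2 e3 e4 ht1 => ?_
    · simp only [List.length_append] at hlen ⊢
      unfold Gram.len at hle
      omega
    · have y13 := e1 13 (by omega)
      have y17 := e1 17 (by omega)
      simp only [reduceIte, Nat.reduceEqDiff] at y13 y17 e2 e3 e4
      simp only [y13, y17]
      refine ⟨by omega, by omega, ⟨by omega, by omega, by omega⟩, by omega, ⟨by omega, by omega, by omega⟩,
        ⟨by omega, by omega, by omega⟩, ?_⟩
      refine hQ _ _ _ (fun x hx => ?_) (fun a ha => ?_) ?_ (by omega)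
      · have := e1 x (by omega)
        simp only [show x ≠ 12 by omega, show x ≠ 13 by omega, show x ≠ 14 by omega,
          show x ≠ 17 by omega, show x ≠ 30 by omega, show x ≠ 31 by omega, show x ≠ 32 by omega,
          reduceIte] at this
        exact this
      · simp only [wr_m]
        rw [if_neg (by omega), if_neg (by omega), if_neg (by omega)]
        exact e2 a (by omega)
      · have hax : ∀ a, D.VB + 64 * D.va k + 6 ≤ a →
            (((HS.wr ⟨v1, M1⟩ (D.VB + 64 * D.va k) 1).wr (D.VB + 64 * D.va k + 1)
              (D.VB + 64 * (2 ^ D.K + k - 1) + 44)).wr (D.VB + 64 * D.va k + 2)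
              (D.VB + 64 * D.va k + 6)).m a = M1 a := fun a ha => by
          rw [wr_ne _ _ (by omega), wr_ne _ _ (by omega), wr_ne _ _ (by omega)]
        have hax' : D.ax (D.va k) = D.VB + 64 * D.va k + 6 := rfl
        rw [Dat.VFact, if_neg hp]
        refine ⟨⟨?_, ?_, ?_⟩, ⟨?_, ?_, ?_⟩, ?_, ?_, ?_⟩
        · simp [hvr, wr_m, Dat.vr, hax', hsk]
        · simp [hvr, wr_m, Dat.vr, hax', hsk]
        · simp [hvr, wr_m, Dat.vr, hax', hsk]
        · exact (hax _ (by omega)).trans e4.1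
        · exact (hax _ (by omega)).trans e4.2.1
        · exact (hax _ (by omega)).trans e4.2.2
        · exact (hax _ (by omega)).trans e3.1
        · exact (hax _ (by omega)).trans e3.2.1
        · exact (hax _ (by omega)).trans e3.2.2

/-- Injectivity of the placement ensures that no node is written twice. -/
theorem varP_spec {w μ c N : ℕ} {D : Dat} {Q : ℕ → HS → Prop} {h : HS} (C : D.Ctx w μ c N)
    (I : D.Mid μ c h.m) (hinj : ∀ x y, 1 ≤ x → x ≤ D.cnt → 1 ≤ y → y ≤ D.cnt → D.va x = D.va y → x = y)
    (h2 : h.v 2 = μ) (h4 : h.v 4 = D.VB) (h6 : h.v 6 = D.cnt) (h7 : h.v 7 = 2 ^ D.K)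
    (hS : ∀ j, 1 ≤ j → j < 2 * 2 ^ D.K → D.SFact μ c h.m j)
    (hQ : ∀ t v M', D.Vfr h.m M' → (∀ x, 1 ≤ x → x ≤ D.cnt → D.VFact μ c M' x) → t ≤ 500 * D.G.m →
      Q t ⟨v, M'⟩) : WP w varP Q h := by
  have hlin := C.env.lin
  have h3 := C.env.m_le
  have hm := C.env.m_pos
  have hcnt := C.cnt_le
  have hcK := C.ok.cnt_le
  refine sym.sound _ ?_
  simp only [varP, sym, ok_simps, ex_simps, cost_simps]
  refine ⟨by omega, by omega, ?_⟩
  refine WP.for D.cnt 400 (fun i g => (∀ x, x < 10 → g.v x = h.v x) ∧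
    g.v 10 = i + 1 ∧ D.Vfr h.m g.m ∧ ∀ x, 1 ≤ x → x < i + 1 → D.VFact μ c g.m x) ?_ ?_ ?_ ?_ ?_
  · rintro i g - ⟨gx, -⟩
    simp only [tst_simps, ok_simps, ex_simps, gx 6 (by omega), h6]; omega
  · rintro i g hi ⟨gx, h10, -⟩
    simp only [tst_simps, ex_simps, h10, gx 6 (by omega), h6]; omega
  · rintro i g hi ⟨gx, g10, hV, hF⟩
    have x2 : g.v 2 = μ := by rw [gx 2 (by omega), h2]
    have x4 : g.v 4 = D.VB := by rw [gx 4 (by omega), h4]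
    have x7 : g.v 7 = 2 ^ D.K := by rw [gx 7 (by omega), h7]
    refine sym.sound _ ?_
    simp only [sym, tst_simps, ok_simps, ex_simps, cost_simps]
    refine varOp_spec C (I.congr_vfr C hV) (k := i + 1) (by omega) (by omega) x2 x4 x7 g10
      ((hS _ (by omega) (by omega)).congr fun a a1 a2 => hV a (by omega))
      fun t1 v1 M1 e1 e2 e3 ht1 => ?_
    have z10 : v1 10 = i + 1 := by rw [e1 10 (by omega), g10]
    simp only [z10]
    refine ⟨by omega, ⟨by omega, by omega, by omega⟩, ⟨fun x hx => ?_, by simp [HS.set], ?_,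
      fun x j1 j2 => ?_⟩, by omega⟩
    · simp only [HS.set, show x ≠ 10 by omega, reduceIte]
      rw [e1 x (by omega), gx x hx]
    · exact hV.trans (Dat.Vfr.of_ne e2)
    · rcases Nat.lt_or_ge x (i + 1) with hx | hx
      · have hne : D.va x ≠ D.va (i + 1) := fun he => by
          have := hinj x (i + 1) j1 (by omega) (by omega) (by omega) he
          omega
        exact (hF x j1 hx).congr fun a a1 a2 => e2 a (by omega)
      · obtain rfl : x = i + 1 := by omega
        exact e3
  · rintro t g ⟨gx, g10, hV, hF⟩ ht
    refine hQ _ _ _ hV (fun x x1 x2 => hF x x1 (by omega)) ?_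
    simp only [tst_simps, cost_simps] at ht ⊢
    omega
  · exact ⟨fun x hx => by simp only [HS.set, show x ≠ 10 by omega, reduceIte],
      by simp [HS.set], fun _ _ => rfl, fun j j1 j2 => by omega⟩

end WhileLang

/-! ### The construction program -/

namespace WhileLang

open Ex St

/-- Everything that precedes the construction of records for blocks. -/
def prep : St := .call hdr ;; .asg 5 (ld 3) ;; .sto (r 4 + 37) 1 ;; .sto (r 4 + 43) 1 ;; .call dfs ;;
  .call occP ;; .call powP ;; .call scP ;; .call posP ;; .call twoPow

/-- The construction program. -/
def build : St := .call prep ;; .call heapP ;; .call sufP ;; .call varP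

set_option maxHeartbeats 1000000 in
theorem prep_spec {w μ sg ca N : ℕ} {G : Gram} (E : Env w μ (cres μ sg ca) N G)
    {Q : ℕ → HS → Prop} {h : HS} (h0 : h.m 0 = μ) (h1 : h.m 1 = sg) (h2 : h.m 2 = ca)
    (hI : Inp G h.m) (hz : ∀ a, 5 + 3 * G.m ≤ a → h.m a = 0)
    (hQ : ∀ t v M' (D : Dat), D.G = G → D.Ctx w μ (cres μ sg ca) N → D.Mid μ (cres μ sg ca) M' →
      (∀ x y, 1 ≤ x → x ≤ D.cnt → 1 ≤ y → y ≤ D.cnt → D.va x = D.va y → x = y) →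
      v 2 = μ → v 4 = D.VB → v 6 = D.cnt → v 7 = 2 ^ D.K → (∀ a, a < 5 → M' a = h.m a) →
      t ≤ 3000 * ((Nat.log 2 (G.len G.st) + 1) * G.m) → Q t ⟨v, M'⟩) : WP w prep Q h := by
  have hlin := E.lin
  have h3 := E.m_le
  have hm := E.m_pos
  have hμ := E.two_le
  refine sym.sound _ ?_
  simp only [prep, sym, ok_simps, ex_simps, cost_simps]
  refine hdr_spec E.two_le E.sq_le (by omega) h0 h1 h2 hI.m fun t1 v1 e1 a2 a3 a4 ht1 => ?_
  simp only [hI.m, reduceIte, Nat.reduceEqDiff, a4]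
  refine ⟨by omega, by omega, ⟨by omega, by omega, by omega⟩, by omega, ⟨by omega, by omega, by omega⟩,
    by omega, ?_⟩
  -- The two empty records start at offsets 32 and 38. Their power fields, at 37 and 43, must be `c
  -- ^ 0`; length and fingerprint are 0 in the fresh memory already.
  generalize hg0 : (((HS.set ⟨v1, h.m⟩ 5 G.m).wr (5 + 3 * G.m + 37) 1).wr (5 + 3 * G.m + 43) 1) = g0
  have F0 : ∀ a, a ≠ 5 + 3 * G.m + 37 → a ≠ 5 + 3 * G.m + 43 → g0.m a = h.m a := fun a x y => by
    subst hg0; rw [wr_ne _ _ y, wr_ne _ _ x]; rfl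
  have Fe : g0.m (5 + 3 * G.m + 37) = 1 ∧ g0.m (5 + 3 * G.m + 43) = 1 := by
    subst hg0; constructor
    · rw [wr_ne _ _ (by omega), wr_self _ _ rfl]
    · rw [wr_self _ _ rfl]
  have Gl0 : Glob μ (cres μ sg ca) G g0 := by
    subst hg0; exact ⟨by simp [HS.set, HS.wr, a2], by simp [HS.set, HS.wr, a3],
      by simp [HS.set, HS.wr, a4], by simp [HS.set, HS.wr]⟩
  have I0 : Inp G g0.m := ⟨(F0 _ (by omega) (by omega)).trans hI.m, (F0 _ (by omega) (by omega)).trans hI.st,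
    fun A hA => (F0 _ (by omega) (by omega)).trans (hI.kd A hA),
    fun A hA => (F0 _ (by omega) (by omega)).trans (hI.a1 A hA),
    fun A hA => (F0 _ (by omega) (by omega)).trans (hI.a2 A hA)⟩
  have Z0 : ∀ x f, f < 37 → g0.m (5 + 3 * G.m + 64 * x + f) = 0 := fun x f hf => by
    rw [F0 _ (by omega) (by omega)]; exact hz _ (by omega)
  refine dfs_spec E Gl0 I0 (fun v _ => Z0 v 3 (by omega)) fun t2 v2 M2 l b6 c6 O hlm F2 L2 R2 ht2 => ?_
  have Gl2 : Glob μ (cres μ sg ca) G ⟨v2, M2⟩ := Gl0.congr b6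
  have I2 : Inp G M2 := I0.congr F2
  have Z2 : ∀ x f, 8 ≤ f → f < 37 → M2 (5 + 3 * G.m + 64 * x + f) = 0 := fun x f h8 hf => by
    rw [F2.fld x f (by omega) (by omega)]; exact Z0 x f hf
  refine occP_spec E Gl2 c6 O hlm I2 L2 (fun v _ => Z2 v 12 (by omega) (by omega))
    fun t3 v3 M3 b7 F3 P3 ht3 => ?_
  replace F3 : Fr (5 + 3 * G.m) 12 13 M2 M3 := F3
  have c7 : v3 6 = l.length := (b7 6 (by omega)).trans c6
  have Gl3 : Glob μ (cres μ sg ca) G ⟨v3, M3⟩ := Gl2.congr fun x hx => b7 x (by omega)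
  have L3 : Lst (5 + 3 * G.m) l M3 := Lst.congr L2 F3 (by omega)
  refine powP_spec E Gl3 c7 O hlm L3 (fun v hv => ?_) (fun v hv => P3 v (O.lt hv))
    fun t4 v4 M4 b8 F4 P4 ht4 => ?_
  · show M3 _ = _
    rw [F3.fld v 3 (by omega) (by omega)]; exact (R2 v hv).1
  replace F4 : Fr (5 + 3 * G.m) 13 15 M3 M4 := F4
  have c8 : v4 6 = l.length := (b8 6 (by omega)).trans c7
  have Gl4 : Glob μ (cres μ sg ca) G ⟨v4, M4⟩ := Gl3.congr fun x hx => b8 x (by omega)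
  have L4 : Lst (5 + 3 * G.m) l M4 := L3.congr F4 (by omega)
  refine scP_spec E Gl4 c8 O hlm ((I2.congr F3).congr F4) L4 P4 (fun v _ => ⟨?_, ?_⟩)
    fun t5 v5 M5 b9 F5 E5 ht5 => ?_
  · show M4 _ = _
    rw [F4.fld v 15 (by omega) (by omega), F3.fld v 15 (by omega) (by omega)]
    exact Z2 v 15 (by omega) (by omega)
  · show M4 _ = _
    rw [F4.fld v 16 (by omega) (by omega), F3.fld v 16 (by omega) (by omega)]
    exact Z2 v 16 (by omega) (by omega)
  replace F5 : Fr (5 + 3 * G.m) 15 17 M4 M5 := F5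
  have c9 : v5 6 = l.length := (b9 6 (by omega)).trans c8
  have Gl5 : Glob μ (cres μ sg ca) G ⟨v5, M5⟩ := Gl4.congr fun x hx => b9 x (by omega)
  refine posP_spec E Gl5 c9 O hlm (L4.congr F5 (by omega)) E5 (fun x => ?_)
    fun t6 v6 M6 n b10 F6 c10 Pc Pl ht6 => ?_
  · show M5 _ = _
    rw [F5.fld x 21 (by omega) (by omega), F4.fld x 21 (by omega) (by omega),
      F3.fld x 21 (by omega) (by omega)]
    exact Z2 x 21 (by omega) (by omega)
  replace F6 : Fr (5 + 3 * G.m) 20 22 M5 M6 := F6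
  have hn := Pc.le_length
  refine twoPow_spec E (by show v6 6 ≤ _; omega) fun t7 v7 K b11 c11 c12 c13 ht7 => ?_
  have F36 : Fr (5 + 3 * G.m) 12 22 M2 M6 := (((F3.mono (by omega) (by omega)).trans
    (F4.mono (by omega) (by omega))).trans (F5.mono (by omega) (by omega))).trans
    (F6.mono (by omega) (by omega))
  have F06 : Fr (5 + 3 * G.m) 0 22 g0.m M6 := (F2.mono (by omega) (by omega)).trans
    (F36.mono (by omega) (by omega))
  have I6 : Inp G M6 := I0.congr F06
  have hregs : ∀ x, x < 6 → v7 x = g0.v x := fun x hx => by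
    rw [b11 x (by omega)]
    show v6 x = _
    rw [b10 x (by omega) (by omega)]
    show v5 x = _
    rw [b9 x (by omega)]
    show v4 x = _
    rw [b8 x (by omega)]
    show v3 x = _
    rw [b7 x (by omega)]
    exact b6 x hx
  have hE : ∀ a, a = 5 + 3 * G.m + 32 ∨ a = 5 + 3 * G.m + 38 → Rec μ (cres μ sg ca) M6 a [] := by
    intro a ha
    have hf : ∀ k, k < 6 → M6 (a + k) = g0.m (a + k) := fun k hk => F06 _ (by omega)
    refine ⟨?_, ?_, ?_⟩
    · rw [hf 3 (by omega), F0 _ (by omega) (by omega), hz _ (by omega)]; rfl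
    · rw [hf 4 (by omega), F0 _ (by omega) (by omega), hz _ (by omega)]; rfl
    · rw [hf 5 (by omega), List.length_nil, pow_zero, Nat.mod_eq_of_lt (by omega)]
      rcases ha with rfl | rfl
      · exact Fe.1
      · exact Fe.2
  refine hQ _ v7 M6 ⟨G, l, n, vaM G M6, pidM G M6, K, 5 + 3 * G.m⟩ rfl ⟨E, ?_, rfl, ?_, c13⟩ ?_ Pc.inj
    ((hregs 2 (by omega)).trans Gl0.1) ((hregs 4 (by omega)).trans Gl0.2.2.1)
    ((b11 6 (by omega)).trans c10) c11 (fun a ha => ?_) ?_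
  · refine ⟨O, Pc.mem, Pc.pid_out, Pc.pid_pos, Pc.bot, Pc.sc, Pl, ?_⟩
    have : v6 6 ≤ 2 ^ K := c12
    show n ≤ 2 ^ K
    omega
  · show n ≤ G.m
    omega
  · refine ⟨I6.kd, I6.a1, I6.a2, fun x => rfl, fun x => rfl, fun v hv => ?_, fun v hv => ?_,
      hE _ (Or.inl rfl), hE _ (Or.inr rfl)⟩
    · have hr := R2 v hv
      exact ⟨(F36.fld v 3 (by omega) (by omega)).trans hr.1,
        (F36.fld v 4 (by omega) (by omega)).trans hr.2.1,
        (F36.fld v 5 (by omega) (by omega)).trans hr.2.2⟩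
    · show M6 _ = _
      rw [F6.fld v 13 (by omega) (by omega), F5.fld v 13 (by omega) (by omega)]
      exact (P4 v hv).1
  · rw [F06.low (by omega), F0 a (by omega) (by omega)]
  · have hL : 1 ≤ Nat.log 2 (G.len G.st) + 1 := by omega
    have hLm : G.m ≤ (Nat.log 2 (G.len G.st) + 1) * G.m := Nat.le_mul_of_pos_left _ hL
    rw [mul_assoc] at ht2 ht4
    omega

set_option maxHeartbeats 1000000 in
theorem build_spec {w μ sg ca N : ℕ} {G : Gram} (E : Env w μ (cres μ sg ca) N G)
    {Q : ℕ → HS → Prop} {h : HS} (h0 : h.m 0 = μ) (h1 : h.m 1 = sg) (h2 : h.m 2 = ca)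
    (hI : Inp G h.m) (hz : ∀ a, 5 + 3 * G.m ≤ a → h.m a = 0)
    (hQ : ∀ t v M', (∀ a, a < 5 → M' a = h.m a) →
      Node μ (cres μ sg ca) M' (5 + 3 * G.m + 256 * G.m) (5 + 3 * G.m + 64 * G.st) (G.str G.st)
        (14 * Nat.log 2 (G.len G.st) + 1) →
      t ≤ 10000 * ((Nat.log 2 (G.len G.st) + 1) * G.m) → Q t ⟨v, M'⟩) : WP w build Q h := by
  have hm := E.m_pos
  refine sym.sound _ ?_
  simp only [build, sym]
  refine prep_spec E h0 h1 h2 hI hz fun t1 v1 M1 D hG C I hinj x2 x4 x6 x7 hM1 ht1 => ?_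
  subst hG
  have hvb := C.vb
  have hK := C.K_le
  refine heapP_spec C I x2 x4 x7 fun t2 v2 M2 e2 hH2 hF2 ht2 => ?_
  have I2 := I.congr C hH2
  have y2 : v2 2 = μ := (e2 2 (by omega)).trans x2
  have y4 : v2 4 = D.VB := (e2 4 (by omega)).trans x4
  have y6 : v2 6 = D.cnt := (e2 6 (by omega)).trans x6
  have y7 : v2 7 = 2 ^ D.K := (e2 7 (by omega)).trans x7
  refine sufP_spec C I2 y2 y4 y7 hF2 fun t3 v3 M3 e3 hH3 hF3 ht3 => ?_
  have I3 := I2.congr C hH3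
  have z2 : v3 2 = μ := (e3 2 (by omega)).trans y2
  have z4 : v3 4 = D.VB := (e3 4 (by omega)).trans y4
  have z6 : v3 6 = D.cnt := (e3 6 (by omega)).trans y6
  have z7 : v3 7 = 2 ^ D.K := (e3 7 (by omega)).trans y7
  refine varP_spec C I3 hinj z2 z4 z6 z7 (fun j j1 j2 => (hF3 j j1 j2).2) fun t4 v4 M4 hV hF4 ht4 => ?_
  have I4 := I3.congr_vfr C hV
  -- Heap indices stay below `2 * 2 ^ K ≤ 4 * m`, and a record has 64 words.
  have U : D.Built μ (cres μ sg ca) M4 (5 + 3 * D.G.m + 256 * D.G.m) := by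
    refine ⟨fun i hi => by omega, I4.rcd, ?_, fun j j1 j2 => ?_, fun j j1 j2 => ?_, hF4⟩
    · rw [Dat.CRec, D.cL_self, D.cR_self]; exact I4.emp
    · intro hn
      obtain ⟨⟨r1, r2⟩, p1, p2⟩ := (hF3 j j1 j2).1 hn
      have e : ∀ k, k < 12 → M4 (D.bk j + k) = M3 (D.bk j + k) := fun k hk => hV _ (by unfold Dat.bk; omega)
      have tr : ∀ k a b, k ≤ 6 → PairAt M3 (D.bk j + k) a b → PairAt M4 (D.bk j + k) a b :=
        fun k a b hk p => ⟨(e _ (by omega)).trans p.1, (e (k + 1) (by omega)).trans p.2.1,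
          (e (k + 2) (by omega)).trans p.2.2⟩
      exact ⟨⟨⟨(e 3 (by omega)).trans r1.1, (e 4 (by omega)).trans r1.2.1, (e 5 (by omega)).trans r1.2.2⟩,
        ⟨(e 9 (by omega)).trans r2.1, (e 10 (by omega)).trans r2.2.1, (e 11 (by omega)).trans r2.2.2⟩⟩,
        fun hh => ⟨tr 0 _ _ (by omega) (p1 hh).1, tr 6 _ _ (by omega) (p1 hh).2⟩,
        fun hh => ⟨tr 0 _ _ (by omega) (p2 hh).1, tr 6 _ _ (by omega) (p2 hh).2⟩⟩
    · exact (hF3 j j1 j2).2.congr fun a a1 a2 => hV a (by omega)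
  refine hQ _ _ _ (fun a ha => ?_) ?_ ?_
  · exact (hV a (by omega)).trans ((hH3 a (by omega)).trans ((hH2 a (by omega)).trans (hM1 a ha)))
  -- The potential is at most `2 * log n`, so the cost of the initial variable is at most `8 * log n
  -- + 3 * (2 * log n) + 1`.
  · have hn := Dat.Built.node_var C.ok U _ D.G.st C.ok.ord.st_mem rfl
      (14 * Nat.log 2 (D.G.len D.G.st) + 1) (by have := C.ok.ord.pot_le C.ok.ord.st_mem; omega)
    unfold Dat.vr at hn
    rwa [hvb] at hn
  · have hLm : D.G.m ≤ (Nat.log 2 (D.G.len D.G.st) + 1) * D.G.m := Nat.le_mul_of_pos_left _ (by omega)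
    omega

end WhileLang

/-! ### From run-length straight-line programs to arrays -/

namespace WhileLang

/-- A word of the description of the rule of a variable. -/
def ruleWord (G : RLSLP) (A k : ℕ) : ℕ :=
  if h : A < G.m then (RLSLP.encodeRule (G.rule ⟨A, h⟩)).getD k 0 else 0

theorem ruleWord_of_lt {G : RLSLP} {A : ℕ} (h : A < G.m) (k : ℕ) :
    ruleWord G A k = (RLSLP.encodeRule (G.rule ⟨A, h⟩)).getD k 0 := dif_pos h

theorem exp_ne_nil (G : RLSLP) (A : Fin G.m) : G.exp A ≠ [] := by
  induction A using G.wf.induction with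
  | _ A ih =>
    cases hr : G.rule A with
    | term a => rw [G.exp_term hr]; simp
    | pair B C =>
      have := ih B (by rw [hr]; exact Or.inl rfl)
      rw [G.exp_pair hr]; simp [this]
    | run B t =>
      have h1 := ih B (by rw [hr]; rfl)
      have h3 := G.three_le A B t hr
      rw [G.exp_run hr]
      obtain ⟨k, rfl⟩ : ∃ k, t = k + 1 := ⟨t - 1, by omega⟩
      simp [List.replicate_succ, h1]

/-- The arrays of a run-length straight-line program. -/
noncomputable def toGram (G : RLSLP) : Gram where
  m := G.m
  kd A := ruleWord G A 0
  a1 A := ruleWord G A 1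
  a2 A := ruleWord G A 2
  st := G.start
  str A := if h : A < G.m then G.exp ⟨A, h⟩ else []
  st_lt := G.start.2
  kd_le A hA := by
    rw [ruleWord_of_lt hA]
    cases G.rule ⟨A, hA⟩ <;> simp [RLSLP.encodeRule]
  term A hA hk := by
    rw [ruleWord_of_lt hA] at hk ⊢
    rw [dif_pos hA]
    cases hr : G.rule ⟨A, hA⟩ with
    | term a => rw [G.exp_term hr]; rfl
    | pair B C => simp [hr, RLSLP.encodeRule] at hk
    | run B t => simp [hr, RLSLP.encodeRule] at hk
  pair A hA hk := by
    rw [ruleWord_of_lt hA] at hk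
    rw [ruleWord_of_lt hA, ruleWord_of_lt hA, dif_pos hA]
    cases hr : G.rule ⟨A, hA⟩ with
    | term a => simp [hr, RLSLP.encodeRule] at hk
    | pair B C => simp [G.exp_pair hr, RLSLP.encodeRule]
    | run B t => simp [hr, RLSLP.encodeRule] at hk
  run A hA hk := by
    rw [ruleWord_of_lt hA] at hk
    rw [ruleWord_of_lt hA, ruleWord_of_lt hA, dif_pos hA]
    cases hr : G.rule ⟨A, hA⟩ with
    | term a => simp [hr, RLSLP.encodeRule] at hk
    | pair B C => simp [hr, RLSLP.encodeRule] at hk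
    | run B t => simpa [G.exp_run hr, RLSLP.encodeRule] using G.three_le _ B t hr
  ne A hA := by rw [dif_pos hA]; exact exp_ne_nil G _

theorem getD_flatten {L : List (List ℕ)} {b : ℕ} (hL : ∀ x ∈ L, x.length = b) :
    ∀ {A k : ℕ}, k < b → L.flatten.getD (b * A + k) 0 = (L.getD A []).getD k 0 := by
  induction L with
  | nil => intro A k _; simp
  | cons x L ih =>
    intro A k hk
    have hx := hL x (by simp)
    rw [List.flatten_cons]
    cases A with
    | zero => rw [List.getD_append _ _ _ _ (by omega)]; simp
    | succ A =>
      rw [List.getD_append_right _ _ _ _ (by rw [hx]; nlinarith),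
        show b * (A + 1) + k - x.length = b * A + k by rw [hx, Nat.mul_succ]; omega,
        ih (fun y hy => hL y (by simp [hy])) hk]
      simp

theorem encodeRule_length {m : ℕ} (r : RLRule (Fin m)) : (RLSLP.encodeRule r).length = 3 := by
  cases r <;> rfl

theorem length_rules (G : RLSLP) :
    (List.ofFn (fun A => RLSLP.encodeRule (G.rule A))).flatten.length = 3 * G.m := by
  rw [List.length_flatten, List.map_ofFn]
  have : (List.length ∘ fun A => RLSLP.encodeRule (G.rule A)) = fun _ => 3 :=
    funext fun A => encodeRule_length _
  rw [this]
  simp [mul_comm]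

theorem words_rule (G : RLSLP) (μ : ℕ) (c : ℤ) {A k : ℕ} (hA : A < G.m) (hk : k < 3) :
    RAM.words (encodeKR μ c ++ G.encode) (5 + 3 * A + k) = ruleWord G A k := by
  have h1 : encodeKR μ c ++ G.encode = [μ, if c < 0 then 1 else 0, c.natAbs, G.m, (G.start : ℕ)] ++
      (List.ofFn (fun A => RLSLP.encodeRule (G.rule A))).flatten := rfl
  have h2 := getD_flatten (L := List.ofFn (fun A => RLSLP.encodeRule (G.rule A))) (b := 3)
    (fun x hx => by
      obtain ⟨i, rfl⟩ := List.mem_ofFn.1 hx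
      exact encodeRule_length _) (A := A) hk
  rw [RAM.words, h1, List.getD_append_right _ _ _ _ (show 5 ≤ 5 + 3 * A + k by omega),
    show 5 + 3 * A + k - [μ, if c < 0 then 1 else 0, c.natAbs, G.m, (G.start : ℕ)].length
      = 3 * A + k from (show 5 + 3 * A + k - 5 = _ by omega), h2, ruleWord_of_lt hA]
  congr 1
  simp [List.getD_eq_getElem?_getD, hA]

theorem inp_words (G : RLSLP) (μ : ℕ) (c : ℤ) :
    Inp (toGram G) (RAM.words (encodeKR μ c ++ G.encode)) :=
  ⟨rfl, rfl, fun _ hA => words_rule G μ c (k := 0) hA (by omega), fun _ hA => words_rule G μ c hA (by omega),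
    fun _ hA => words_rule G μ c hA (by omega)⟩

theorem length_input (G : RLSLP) (μ : ℕ) (c : ℤ) :
    (encodeKR μ c ++ G.encode).length = 5 + 3 * G.m := by
  simp only [List.length_append, RLSLP.encode, length_rules, encodeKR, List.length_cons,
    List.length_nil]
  omega

theorem words_le {l : List ℕ} {N : ℕ} (h : ∀ x ∈ l, x ≤ N) (k : ℕ) : RAM.words l k ≤ N := by
  rcases Nat.lt_or_ge k l.length with hk | hk
  · rw [RAM.words, List.getD_eq_getElem _ _ hk]
    exact h _ (List.getElem_mem hk)
  · rw [RAM.words, List.getD_eq_default _ _ hk]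
    exact Nat.zero_le _

theorem m_le_size (G : RLSLP) : G.m ≤ G.size := by
  have : ∀ A : Fin G.m, 1 ≤ (G.rule A).size := fun A => by cases G.rule A <;> simp [RLRule.size]
  have h := Finset.sum_le_sum (s := Finset.univ) fun A _ => this A
  simpa [RLSLP.size] using h

theorem cres_cast {μ : ℕ} (h : 0 < μ) (c : ℤ) :
    (cres μ (if c < 0 then 1 else 0) c.natAbs : ℤ) ≡ c [ZMOD μ] := by
  unfold cres
  by_cases hc : c < 0
  · rw [if_pos hc, if_pos rfl]
    have h1 : c.natAbs % μ ≤ μ := (Nat.mod_lt _ h).le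
    push_cast [Nat.cast_sub h1]
    rw [abs_of_neg hc]
    refine (Int.mod_modEq _ _).trans ?_
    refine ((Int.ModEq.refl _).sub (Int.mod_modEq _ _)).trans ?_
    rw [Int.modEq_iff_dvd]
    exact ⟨-1, by ring⟩
  · rw [if_neg hc, if_neg (by norm_num)]
    push_cast
    rw [abs_of_nonneg (by omega)]
    exact Int.mod_modEq _ _

/-- Horner's rule for the defining sum; it identifies the sum with the recursion of `kap`. -/
theorem karpRabin_cons (μ : ℕ) (c : ℤ) (a : ℕ) (X : List ℕ) :
    karpRabin μ c (a :: X) ≡ a + c * karpRabin μ c X [ZMOD μ] := by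
  unfold karpRabin
  refine (Int.mod_modEq _ _).trans ?_
  refine Int.ModEq.trans ?_ ((Int.ModEq.refl _).add ((Int.mod_modEq _ _).symm.mul_left c))
  refine congrArg (· % (μ : ℤ)) ((Fin.sum_univ_succ (n := X.length) _).trans ?_)
  rw [Finset.mul_sum]
  simp only [List.get_cons_zero, Fin.val_zero, pow_zero, mul_one, List.get_cons_succ', Fin.val_succ]
  congr 1
  exact Finset.sum_congr rfl fun k _ => by rw [pow_succ]; ring

theorem kap_eq_karpRabin {μ cr : ℕ} {c : ℤ} (hc : (cr : ℤ) ≡ c [ZMOD μ]) (X : List ℕ) :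
    (kap μ cr X 0 : ℤ) = karpRabin μ c X := by
  induction X with
  | nil => simp [kap, karpRabin]
  | cons a X ih =>
    have h1 : karpRabin μ c (a :: X) = karpRabin μ c (a :: X) % μ := by
      rw [karpRabin, Int.emod_emod_of_dvd _ dvd_rfl]
    rw [h1, karpRabin_cons μ c a X]
    show (((a + cr * kap μ cr X 0) % μ : ℕ) : ℤ) = _
    push_cast
    rw [ih]
    exact (Int.ModEq.refl _).add (hc.mul_right _)

theorem env_of_bounds {G : RLSLP} {T : List ℕ} (hT : G.Represents T) {μ : ℕ} {c : ℤ} (hμ : μ.Prime)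
    {N w : ℕ} (h1 : T.length ≤ N) (h2 : (encodeKR μ c ++ G.encode).length ≤ N)
    (h3 : ∀ x ∈ encodeKR μ c ++ G.encode, x ≤ N) (h4 : 15 * (Nat.log 2 N + 1) ≤ w) :
    Env w μ (cres μ (if c < 0 then 1 else 0) c.natAbs) N (toGram G) ∧
      (toGram G).str (toGram G).st = T := by
  have hst : (toGram G).str (toGram G).st = T := by
    show (if h : (G.start : ℕ) < G.m then G.exp ⟨G.start, h⟩ else []) = T
    rw [dif_pos G.start.2]
    exact hT
  rw [length_input] at h2
  have hw := words_le h3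
  refine ⟨⟨hμ.two_le, hw 0, cres_lt hμ.pos _ _, ?_, ?_, ?_, ?_, fun A hA => ?_, fun A hA => ?_⟩, hst⟩
  · show G.m ≤ N
    omega
  · rw [Gram.len, hst]; exact h1
  · set L := Nat.log 2 N + 1 with hL
    have hN : N < 2 ^ L := Nat.lt_pow_succ_log_self (by omega) N
    have e1 : N + 2 ≤ 2 ^ (2 * L) := by
      have : 2 ^ 1 ≤ 2 ^ L := Nat.pow_le_pow_right (by omega) (by omega)
      rw [two_mul, pow_add]
      nlinarith
    have e2 : 2000 ≤ 2 ^ (11 * L) :=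
      le_trans (by norm_num : 2000 ≤ 2 ^ 11) (Nat.pow_le_pow_right (by omega) (by omega))
    -- The word length factor 15 is 11 for the constant 2000 and 2 for each factor `N + 2`.
    calc 2000 * ((N + 2) * (N + 2)) ≤ 2 ^ (11 * L) * (2 ^ (2 * L) * 2 ^ (2 * L)) :=
          Nat.mul_le_mul e2 (Nat.mul_le_mul e1 e1)
      _ = 2 ^ (15 * L) := by rw [← pow_add, ← pow_add]; congr 1; ring
      _ ≤ 2 ^ w := Nat.pow_le_pow_right (by omega) h4
  · exact lt_of_le_of_lt (Nat.zero_le _) G.start.2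
  · rw [← (inp_words G μ c).a1 A hA]; exact hw _
  · rw [← (inp_words G μ c).a2 A hA]; exact hw _

end WhileLang

theorem mainTheorem9 :
    -- two fixed programs, and two constants: `K` for time and space, `W` for the word length
    ∃ (build query : RAM.Prog) (K W : ℕ), 1 ≤ W ∧
      ∀ (G : RLSLP) (T : List ℕ), G.Represents T →
      ∀ (μ : ℕ) (c : ℤ), μ.Prime →
      -- `N` bounds the text length, the input length and the numbers in the input,
      -- and the words have at least `W * (log N + 1)` bits
      ∀ N w : ℕ, T.length ≤ N →
        (encodeKR μ c ++ G.encode).length ≤ N →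
        (∀ x ∈ encodeKR μ c ++ G.encode, x ≤ N) →
        W * (Nat.log 2 N + 1) ≤ w →
        -- the construction runs in time `O(|G| log n)` ...
        ∃ (tb : ℕ) (s : RAM.State),
          RAM.Exec w build (RAM.State.init [] (RAM.words (encodeKR μ c ++ G.encode))) tb s ∧
          tb ≤ K * (G.size * (Nat.log 2 T.length + 1)) ∧
          -- ... and leaves the data structure in the first `S = O(|G|)` memory words;
          ∃ S : ℕ, S ≤ K * G.size ∧
            -- queries rely on no other memory words, preserve the structure, and run in `O(log n)`
            ∀ M : ℕ → ℕ, (∀ a, M a < 2 ^ w) → (∀ a < S, M a = s.mem a) →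
            ∀ i j : ℕ, 1 ≤ i → i ≤ j → j ≤ T.length →
              ∃ (tq : ℕ) (s' : RAM.State),
                RAM.Exec w query (RAM.State.init [i, j] M) tq s' ∧
                tq ≤ K * (Nat.log 2 T.length + 1) ∧
                (∀ a < S, s'.mem a = M a) ∧
                (s'.reg 0 : ℤ) = karpRabin μ c (substr T i j) := by
  -- The bound of `build_spec` fixes 10000. It also covers the `5 + 259 * m` words and the query
  -- time, at most `600 * (14 * log n + 2) + 60 * log n + 300`.
  refine ⟨WhileLang.build.comp, WhileLang.query.comp, 10000, 15, by norm_num, ?_⟩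
  intro G T hT μ c hμ N w h1 h2 h3 h4
  obtain ⟨E, hst⟩ := WhileLang.env_of_bounds hT hμ h1 h2 h3 h4
  have hI := WhileLang.inp_words G μ c
  have hlin := E.lin
  have hmN := E.m_le
  have hlen : (WhileLang.toGram G).len (WhileLang.toGram G).st = T.length := congrArg _ hst
  have hz : ∀ a, 5 + 3 * (WhileLang.toGram G).m ≤ a → RAM.words (encodeKR μ c ++ G.encode) a = 0 :=
    fun a ha => List.getD_eq_default _ _ (by rw [WhileLang.length_input]; exact ha)
  obtain ⟨tb, s, g, hex, hrel, hlow, hnode, htb⟩ := WhileLang.build_spec E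
    (Q := fun t h' => (∀ a, a < 5 → h'.m a = RAM.words (encodeKR μ c ++ G.encode) a) ∧
      WhileLang.Node μ _ h'.m _ _ _ _ ∧ t ≤ _)
    (h := ⟨RAM.words [], RAM.words (encodeKR μ c ++ G.encode)⟩) rfl rfl rfl hI hz
    (fun t v M' e1 e2 e3 => ⟨e1, e2, e3⟩)
    (RAM.State.init [] (RAM.words (encodeKR μ c ++ G.encode))) ⟨rfl, fun _ _ => rfl⟩
  rw [hlen] at hnode htb
  rw [hst] at hnode
  have hms : (WhileLang.toGram G).m ≤ G.size := WhileLang.m_le_size G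
  have hm1 := E.m_pos
  refine ⟨tb, s, hex, htb.trans ?_, 5 + 3 * (WhileLang.toGram G).m + 256 * (WhileLang.toGram G).m,
    by omega, ?_⟩
  · rw [mul_comm (Nat.log 2 T.length + 1)]
    exact Nat.mul_le_mul_left _ (Nat.mul_le_mul_right _ hms)
  intro M _ hM i j hi hij hj
  -- A `Node` and the five header words lie below `S`, so agreement there is all that a query needs.
  have hM' : ∀ a < 5 + 3 * (WhileLang.toGram G).m + 256 * (WhileLang.toGram G).m, M a = g.m a :=
    fun a ha => (hM a ha).trans (congrFun hrel.1 a)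
  have h5 : ∀ a, a < 5 → M a = RAM.words (encodeKR μ c ++ G.encode) a :=
    fun a ha => (hM' a (by omega)).trans (hlow a ha)
  obtain ⟨tq, s', g', hex', hrel', hmem, hreg, htq⟩ := WhileLang.query_spec (m := (WhileLang.toGram G).m)
    (Q := fun t h' => h'.m = M ∧ h'.v 0 = _ ∧ t ≤ _) (h := ⟨RAM.words [i, j], M⟩)
    E.two_le E.sq_le (by omega) (by omega : 5 + 3 * (WhileLang.toGram G).m +
      256 * (WhileLang.toGram G).m ≤ 2 ^ w) (by omega) (by omega) (h5 0 (by omega)) (h5 1 (by omega))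
    (h5 2 (by omega)) (h5 3 (by omega)) (h5 4 (by omega)) (hnode.congr hM') hi hij hj rfl rfl
    (fun t v e1 e2 => ⟨rfl, e1, e2⟩) (RAM.State.init [i, j] M) ⟨rfl, fun _ _ => rfl⟩
  refine ⟨tq, s', hex', by omega, fun a _ => ?_, ?_⟩
  · rw [hrel'.1, hmem]
  · rw [hrel'.2 0 (by norm_num), hreg]
    exact WhileLang.kap_eq_karpRabin (WhileLang.cres_cast hμ.pos c) _
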